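/- Let $a_0=1$ and let $a_1,a_2,\dots$ and $m$ be real numbers. Consider the field theory obtained from the free scalar field of mass $m$ in four-dimensional Minkowski space by the field diffeomorphism $F(\phi)=\sum_{k\ge 0}a_k\phi^{k+1}$. Its propagator is $\frac{i}{p^2-m^2}$, and for each $N\ge 3$ its $N$-valent vertex with incident momenta $p_1,\dots,p_N$ is $$i\,\frac{d_{N-2}}{2}\,(p_1^2+\dots+p_N^2)+i\,c_{N-2},\qquad d_n=n!\sum_{l=0}^n(l+1)(n-l+1)a_la_{n-l},\qquad c_n=-m^2\,\frac{(n+2)!}{2}\sum_{l=0}^n a_la_{n-l}.$$ Let $n\ge 3$ and $0\le j\le n$. Let the external momenta $q_1,\dots,q_n$ satisfy $\sum_i q_i=0$ and $q_i^2=m^2$ for $i>j$. Put $x_i=q_i^2-m^2$, and assume general position, in the sense that $\big(\sum_{i\in U}q_i\big)^2\neq m^2$ for all $U\subseteq\{1,\dots,n\}$ with $2\le|U|\le n-2$. Let $A^j_n$ be $i$ times the sum, over all trees with external legs labelled $1,\dots,n$ and unlabelled vertices of valence at least $3$, of the product of the Feynman rules of all vertices and internal edges. Let $$b_{r+1}=\sum_{k=0}^{r}\frac{(r+k)!}{r!}\,B_{r,k}(-1!a_1,-2!a_2,-3!a_3,\dots)\quad(r\ge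 0),$$ where $B_{r,k}$ are the partial Bell polynomials, and let $B_r=\sum_{i>r}b_i$ (a formal sum). For $S\subseteq\{1,\dots,j\}$, a *meta-tree* on $S$ is an unrooted tree $T$ with vertex set $S$ (the *meta-vertices*) together with a distribution of the $n-|S|$ legs not in $S$ over the vertices of $T$. The leg $s\in S$ is attached to the vertex $s$. If $|v|$ is the number of edges of $T$ at $v$ and $r_v$ is the number of legs distributed to $v$, it is required that $|v|+r_v\ge 2$ for every $v$, that is, every vertex has total valence at least $3$. For an edge $e$ of $T$ let $x_e=q_e^2-m^2$, where $q_e$ is the sum of the external momenta of all legs on one side of $e$. **Theorem.** For all such $n$ and $j$, and for all such momenta, $$A^j_n=\sum_{k=0}^{j}\ \sum_{\substack{S\subseteq\{1,\dots,j\}\\|S|=k}}\Big(\prod_{s\in S}x_s\Big)\,C_S,\qquad C_S=\sum_{T}\ \prod_{v\in V_T}\big[B_{\max(|v|-1,\,1)}\big]_{|v|+r_v}\ \prod_{e\in E_T}\frac{1}{x_e}.$$ Here $T$ runs over all meta-trees on $S$, and $[B_r]_i$ is the term of index $i$ of the formal sum $B_r$ (it equals $b_i$ if $i>r$ and $0$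 otherwise). So the coefficient $C_k^{(j)}$ of the degree-$k$ elementary symmetric monomials is a sum over unrooted trees with $k$ meta-vertices; each meta-vertex $v$ contributes $B_{\max(|v|-1,1)}=\sum_{i\ge\max(|v|,2)}b_i$, whose term with index $i$ belongs to the distributions with $i-|v|$ legs at $v$, and each of the $k-1$ internal edges contributes a propagator $1/x_e$. Moreover, for fixed $(a_i)$, $m$, $n$ and $j$ this expansion is unique. Suppose that complex numbers $c_{S,T}$, independent of the momenta, satisfy $A^j_n=\sum_S\big(\prod_{s\in S}x_s\big)\sum_T c_{S,T}\prod_{e\in E_T}1/x_e$ for all momenta as above, where $S$ runs over the subsets of $\{1,\dots,j\}$ and $T$ over the meta-trees on $S$. Then $c_{S,T}=\prod_{v\in V_T}b_{|v|+r_v}$ for all $S$ and $T$. -/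

import Mathlib

namespace FieldDiffeo

/-! ### Bell polynomials and the numbers `b_n` -/

/-- The partial Bell polynomial `B_{n,k}(x_1, x_2, …)`: the sum over all `(j_1, j_2, …)` with
`∑ j_i = k` and `∑ i j_i = n` of `n! / ∏ j_i! * ∏ (x_i / i!) ^ j_i`.  The multiplicity `j_{i+1}` is
`μ i`; only `1 ≤ i ≤ n` and `j_i ≤ n` can occur. -/
noncomputable def bellPoly (n k : ℕ) (x : ℕ → ℝ) : ℝ :=
  ∑ μ ∈ (Fintype.piFinset (fun _ : Fin n => Finset.range (n + 1))).filter
      (fun μ : Fin n → ℕ => ∑ i : Fin n, μ i = k ∧ ∑ i : Fin n, ((i : ℕ) + 1) * μ i = n),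
    ((n.factorial : ℝ) / ∏ i : Fin n, ((μ i).factorial : ℝ)) *
      ∏ i : Fin n, (x ((i : ℕ) + 1) / (((i : ℕ) + 1).factorial : ℝ)) ^ (μ i)

/-- `b_{n+1} = ∑_{k=0}^{n} (n+k)!/n! B_{n,k}(-1! a_1, -2! a_2, …)`; the value at index `0` is
not used. -/
noncomputable def b (a : ℕ → ℝ) : ℕ → ℝ
  | 0 => 0
  | n + 1 => ∑ k ∈ Finset.range (n + 1),
      (((n + k).factorial : ℝ) / (n.factorial : ℝ)) *
        bellPoly n k (fun i => -((i.factorial : ℝ) * a i))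

/-- The formal sum `B_r = ∑_{i > r} b_i`, kept as a formal power series `∑_{i > r} b_i X^i`, so
that its individual summands can be addressed. -/
noncomputable def formalB (a : ℕ → ℝ) (r : ℕ) : PowerSeries ℝ :=
  PowerSeries.mk fun i => if r < i then b a i else 0

/-! ### Kinematics -/

/-- Four-momenta. -/
abbrev Momentum : Type := Fin 4 → ℝ

/-- The Minkowski square `p^2`. -/
def mink (p : Momentum) : ℝ := p 0 ^ 2 - p 1 ^ 2 - p 2 ^ 2 - p 3 ^ 2

/-- The off-shell variable `x = p^2 - m^2`. -/
def offShellVar (m : ℝ) (p : Momentum) : ℝ := mink p - m ^ 2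

/-- The legs `1, …, j` (here `0, …, j - 1`), which are allowed to be off-shell. -/
def offShellLegs (n j : ℕ) : Finset (Fin n) := Finset.univ.filter fun i => (i : ℕ) < j

/-- Admissible external momenta for `n` legs of which the first `j` may be off-shell: momentum is
conserved, the remaining legs are on-shell, and no partial sum of external momenta that can flow
through an internal edge is on-shell. -/
structure GeneralPosition (m : ℝ) {n : ℕ} (j : ℕ) (q : Fin n → Momentum) : Prop where
  conservation : ∑ i, q i = 0
  onShell : ∀ i : Fin n, j ≤ (i : ℕ) → offShellVar m (q i) = 0
  generic : ∀ U : Finset (Fin n), 2 ≤ U.card → U.card + 2 ≤ n →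
    offShellVar m (∑ i ∈ U, q i) ≠ 0

/-! ### Trees with external legs

A tree with `n` external legs and vertex set `V` is a graph `G` on `V` that is a tree (its edges are
the internal edges) together with a map `ℓ : Fin n → V` telling to which vertex each leg is
attached. -/

section Trees

variable {n : ℕ} {V : Type} [Fintype V]

open Classical in
/-- The number of internal edges at `v`. -/
noncomputable def internalValence (G : SimpleGraph V) (v : V) : ℕ :=
  (Finset.univ.filter fun w => G.Adj v w).card

open Classical in
/-- The number of external legs at `v`. -/
noncomputable def legsAt (ℓ : Fin n → V) (v : V) : ℕ :=
  (Finset.univ.filter fun i => ℓ i = v).card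

/-- The number of all edges, internal and external, at `v`. -/
noncomputable def valence (G : SimpleGraph V) (ℓ : Fin n → V) (v : V) : ℕ :=
  internalValence G v + legsAt ℓ v

/-- `(G, ℓ)` is a tree with external legs all of whose vertices have valence at least three. -/
def IsLegTree (G : SimpleGraph V) (ℓ : Fin n → V) : Prop :=
  G.IsTree ∧ ∀ v, 3 ≤ valence G ℓ v

open Classical in
/-- The momentum flowing through the edge `uw` from `u` to `w`: the sum of the momenta of all external
legs that lie on the side of `u` after the edge `uw` is cut. -/
noncomputable def flow (G : SimpleGraph V) (ℓ : Fin n → V) (q : Fin n → Momentum) (u w : V) :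
    Momentum :=
  ∑ i ∈ Finset.univ.filter (fun i => (G.deleteEdges {s(u, w)}).Reachable u (ℓ i)), q i

open Classical in
/-- The internal edges, each one once, as pairs `(u, w)` with `u < w`. -/
noncomputable def edgePairs [LinearOrder V] (G : SimpleGraph V) : Finset (V × V) :=
  Finset.univ.filter fun p => p.1 < p.2 ∧ G.Adj p.1 p.2

end Trees

/-! ### Feynman rules and the tree amplitude -/

/-- `d_n = n! ∑_{j=0}^n (j+1)(n-j+1) a_j a_{n-j}`. -/
noncomputable def dCoeff (a : ℕ → ℝ) (n : ℕ) : ℝ :=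
  (n.factorial : ℝ) * ∑ j ∈ Finset.range (n + 1),
    ((j : ℝ) + 1) * (((n - j : ℕ) : ℝ) + 1) * a j * a (n - j)

/-- `c_n = - m^2 (n+2)!/2 ∑_{j=0}^n a_j a_{n-j}`. -/
noncomputable def cCoeff (a : ℕ → ℝ) (m : ℝ) (n : ℕ) : ℝ :=
  -m ^ 2 * (((n + 2).factorial : ℝ) / 2) * ∑ j ∈ Finset.range (n + 1), a j * a (n - j)

/-- The sum of the kinematic and the massive Feynman rule for a vertex of valence `N ≥ 3`, where
`P` is the sum of the squares of the `N` incident momenta. -/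
noncomputable def vertexRule (a : ℕ → ℝ) (m : ℝ) (N : ℕ) (P : ℝ) : ℂ :=
  Complex.I * ((dCoeff a (N - 2) / 2 * P : ℝ) : ℂ) + Complex.I * ((cCoeff a m (N - 2) : ℝ) : ℂ)

section Amplitude

variable {n : ℕ} {V : Type} [Fintype V]

open Classical in
/-- The sum of the squared momenta of all edges, internal and external, at `v`. -/
noncomputable def sumSq (G : SimpleGraph V) (ℓ : Fin n → V) (q : Fin n → Momentum) (v : V) : ℝ :=
  (∑ w ∈ Finset.univ.filter (fun w => G.Adj v w), mink (flow G ℓ q v w)) +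
    ∑ i ∈ Finset.univ.filter (fun i => ℓ i = v), mink (q i)

/-- The contribution of a tree: the product of the Feynman rules of its vertices and of the
propagators `i / (p^2 - m^2)` of its internal edges. -/
noncomputable def treeContribution [LinearOrder V] (a : ℕ → ℝ) (m : ℝ) (q : Fin n → Momentum)
    (G : SimpleGraph V) (ℓ : Fin n → V) : ℂ :=
  (∏ v, vertexRule a m (valence G ℓ v) (sumSq G ℓ q v)) *
    ∏ e ∈ edgePairs G, Complex.I / ((offShellVar m (flow G ℓ q e.1 e.2) : ℝ) : ℂ)

end Amplitude

open Classical in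
/-- The tree-level `n`-point amplitude: the sum over all trees with labelled external legs and
unlabelled vertices of valence at least three.  Such a tree has no nontrivial automorphism
fixing the legs, so it arises from exactly `v!` pairs `(G, ℓ)` on the vertex set `Fin v`.  It has at
most `n - 2` vertices, so all trees are covered by `v < n`. -/
noncomputable def treeAmplitude (a : ℕ → ℝ) (m : ℝ) {n : ℕ} (q : Fin n → Momentum) : ℂ :=
  ∑ v ∈ Finset.range n, (1 / (v.factorial : ℂ)) *
    ∑ T ∈ (Finset.univ : Finset (SimpleGraph (Fin v) × (Fin n → Fin v))).filter
        (fun T => IsLegTree T.1 T.2),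
      treeContribution a m q T.1 T.2

/-! ### Meta-trees

A meta-tree for a set `S` of off-shell legs has one meta-vertex for every `s ∈ S`; the leg `s` is
attached to the meta-vertex `s`, and all other legs are distributed over the meta-vertices. -/

/-- Meta-trees on `S`: trees with external legs, all vertices of valence at least three (the
legs counted), such that each `s ∈ S` is attached to the vertex `s`. -/
def IsMetaTree {n : ℕ} (S : Finset (Fin n)) (G : SimpleGraph S) (ℓ : Fin n → S) : Prop :=
  IsLegTree G ℓ ∧ ∀ s : S, ℓ s = s

/-- A choice of a number for each meta-tree, for all `S`. -/
abbrev MetaWeights (n : ℕ) : Type :=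
  ∀ S : Finset (Fin n), SimpleGraph S → (Fin n → S) → ℂ

open Classical in
/-- The sum over all meta-trees on `S` of the weight times `∏_e 1 / x_e`. -/
noncomputable def metaSum (m : ℝ) {n : ℕ} (q : Fin n → Momentum) (c : MetaWeights n)
    (S : Finset (Fin n)) : ℂ :=
  ∑ T ∈ (Finset.univ : Finset (SimpleGraph S × (Fin n → S))).filter
      (fun T => IsMetaTree S T.1 T.2),
    c S T.1 T.2 * ∏ e ∈ edgePairs T.1, 1 / ((offShellVar m (flow T.1 T.2 q e.1 e.2) : ℝ) : ℂ)

/-- The weights `c` describe the expansion of the amplitude in the elementary symmetric monomials of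
the off-shell variables: the coefficient of a monomial of degree `k` is a combination of
products of `k - 1` intermediate propagators, with coefficients that do not depend on the momenta.
The amplitude is normalised by an overall factor `i`. -/
def IsExpansion (a : ℕ → ℝ) (m : ℝ) (n j : ℕ) (c : MetaWeights n) : Prop :=
  ∀ q : Fin n → Momentum, GeneralPosition m j q →
    Complex.I * treeAmplitude a m q =
      ∑ k ∈ Finset.range (j + 1), ∑ S ∈ Finset.powersetCard k (offShellLegs n j),
        (∏ s ∈ S, ((offShellVar m (q s) : ℝ) : ℂ)) * metaSum m q c S

/-- The product over the meta-vertices `v` of the term of the formal sum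
`B_{max (|v| - 1, 1)}` that belongs to the given distribution of legs: if `|v|` internal edges and
`r` further legs, besides the leg `v` itself, are attached to `v`, this is the term with index
`|v| + r`. -/
noncomputable def bWeights (a : ℕ → ℝ) (n : ℕ) : MetaWeights n := fun _ G ℓ =>
  ∏ v, ((PowerSeries.coeff (valence G ℓ v - 1)
    (formalB a (max (internalValence G v - 1) 1)) : ℝ) : ℂ)

end FieldDiffeo

/-! Write ρ = F(φ) and let K be multiplication by x = p² − m². The transformed theory is the free
theory in the variable ρ, so its tree currents solve F'(φ)·K F(φ) = J, with J the source of the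
external legs. If G is the compositional inverse of F, then G'(ρ) inverts F'(φ) and the equation
becomes Kρ = J·G'(ρ). Lagrange inversion (`b_eq_compInvCoeff`) gives G = Σ b_k X^k/k!. Hence ρ is
generated by trees with propagator 1/x whose vertices have weight b_k times the off-shell variable x
of one of their own external legs. The amplitude is read off at the set I of all legs except a root
leg r, where the current φ is truncated. There G(ρ) = φ vanishes, which determines ρ(I) and
contributes x_I. By momentum conservation x_I is the off-shell variable of r, so r enters like every
other leg. The amplitude thus becomes a sum over trees of ∏_v b·(sum of x over the legs at v)·∏_e
1/x_e. Multiplying out the inner sums chooses one leg at each vertex; the chosen legs form S, and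
the tree with this choice is a meta-tree.

To make this exact, currents are functions on finite sets of legs under the convolution product
(`SubsetAlgebra`), where powers expand over set partitions (`SubsetAlgebra.pow_apply`). The argument
above is `amplitude_eq_of_currents`. The Feynman rules are identified with the coefficients of F'(φ)
K F(φ) in `vertex_eq_sum_powerset`. A tree rooted at r is encoded by the laminar family of the sets
of legs below its vertices. The tree recursion is then `hierarchySum_eq`, and `I_mul_treeAmplitude`
and `sum_powersetCard_metaSum` translate both sides of the theorem into sums over such families.

For uniqueness, the difference of two expansions vanishes identically. Induction on S, with all legs
outside S on-shell, isolates one coefficient sum. For a given meta-tree there are momenta, depending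
on t > 0, for which exactly its internal lines go on-shell as t → 0 (`IsMetaTree.exists_momenta`).
All meta-trees on S have |S| − 1 lines, so every other one is less singular, and the limit extracts
the given coefficient (`IsMetaTree.coeff_eq_zero`). -/

namespace FieldDiffeo

/-! ### Lagrange inversion: the b_n are the coefficients of the inverse diffeomorphism -/

section Inversion

open PowerSeries

/-- The coefficients of the compositional inverse of a power series `F = X + …`. -/
noncomputable def compInvCoeff (F : ℝ⟦X⟧) : ℕ → ℝ
  | n => (if n = 1 then 1 else 0) - ∑ k : Fin n, compInvCoeff F k * coeff n (F ^ (k : ℕ))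
decreasing_by exact k.2

theorem coeff_X_mul_pow (H : ℝ⟦X⟧) (n k : ℕ) :
    coeff n ((X * H) ^ k) = if k ≤ n then coeff (n - k) (H ^ k) else 0 := by
  rw [mul_pow, coeff_X_pow_mul']

/-- The recursion for `compInvCoeff` is this identity solved for the term k = n, in which the power
has leading coefficient 1. -/
theorem sum_compInvCoeff (H : ℝ⟦X⟧) (hH : constantCoeff H = 1) (n : ℕ) :
    ∑ k ∈ Finset.range (n + 1), compInvCoeff (X * H) k * coeff n ((X * H) ^ k) =
      if n = 1 then 1 else 0 := by
  rw [Finset.sum_range_succ]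
  have h1 : coeff n ((X * H) ^ n) = 1 := by
    rw [coeff_X_mul_pow]; simp [hH]
  rw [h1, mul_one]
  conv_lhs => rw [compInvCoeff]
  rw [Finset.sum_range]
  ring

theorem compInvCoeff_zero (F : ℝ⟦X⟧) : compInvCoeff F 0 = 0 := by
  rw [compInvCoeff]; simp

theorem sum_compInvCoeff_of_le (H : ℝ⟦X⟧) (hH : constantCoeff H = 1) {n N : ℕ} (hn : n ≤ N) :
    ∑ k ∈ Finset.range (N + 1), compInvCoeff (X * H) k * coeff n ((X * H) ^ k) =
      if n = 1 then 1 else 0 := by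
  rw [← sum_compInvCoeff H hH n]
  symm
  apply Finset.sum_subset
  · intro k hk; simp only [Finset.mem_range] at *; omega
  · intro k _ hk
    rw [coeff_X_mul_pow, if_neg (by simpa using hk), mul_zero]

/-- With F = XH this is the residue of F'/F^(m+1). For m > 0 that form is exact: m times the series
is mH⁻ᵐ − X(H⁻ᵐ)', whose coefficient in degree m cancels. -/
theorem coeff_lagrange_term (H : ℝ⟦X⟧) (hH : constantCoeff H = 1) (m : ℕ) :
    coeff m (H⁻¹ ^ (m + 1) * d⁄dX ℝ (X * H)) = if m = 0 then 1 else 0 := by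
  have hH' : constantCoeff H ≠ 0 := by rw [hH]; exact one_ne_zero
  have hinv : H⁻¹ * H = 1 := PowerSeries.inv_mul_cancel H hH'
  have hF : d⁄dX ℝ (X * H) = H + X * d⁄dX ℝ H := by
    rw [Derivation.leibniz, derivative_X]; simp [add_comm]
  rcases Nat.eq_zero_or_pos m with rfl | hm
  · rw [hF]; simp [hH]
  · rw [if_neg hm.ne']
    have hd : d⁄dX ℝ (H⁻¹ ^ m) = -((m : ℝ⟦X⟧) * (H⁻¹ ^ (m + 1) * d⁄dX ℝ H)) := by
      rw [derivative_pow, derivative_inv']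
      obtain ⟨k, rfl⟩ := Nat.exists_eq_succ_of_ne_zero hm.ne'
      simp only [Nat.succ_eq_add_one, Nat.add_sub_cancel]
      ring
    have hmul : (m : ℝ⟦X⟧) * (H⁻¹ ^ (m + 1) * d⁄dX ℝ (X * H)) =
        (m : ℝ⟦X⟧) * H⁻¹ ^ m - X * d⁄dX ℝ (H⁻¹ ^ m) := by
      rw [hF, hd]
      linear_combination (m : ℝ⟦X⟧) * H⁻¹ ^ m * hinv
    have hc := congrArg (coeff m) hmul
    obtain ⟨k, rfl⟩ := Nat.exists_eq_succ_of_ne_zero hm.ne'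
    have hcast : ((k.succ : ℕ) : ℝ⟦X⟧) = C ((k.succ : ℕ) : ℝ) := by simp
    rw [hcast, map_sub, coeff_C_mul, coeff_C_mul, coeff_succ_X_mul, coeff_derivative] at hc
    have hk : ((k.succ : ℕ) : ℝ) ≠ 0 := by positivity
    apply mul_left_cancel₀ hk
    rw [hc]; push_cast; ring

/-- Differentiate Σ g_k F^k = X, multiply by H^(-(n+1)) and take the coefficient of X^n; by
`coeff_lagrange_term` only the term with g_(n+1) survives. -/
theorem lagrange_inversion (H : ℝ⟦X⟧) (hH : constantCoeff H = 1) (n : ℕ) :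
    ((n : ℝ) + 1) * compInvCoeff (X * H) (n + 1) = coeff n (H⁻¹ ^ (n + 1)) := by
  have hH' : constantCoeff H ≠ 0 := by rw [hH]; exact one_ne_zero
  have hinv : H⁻¹ * H = 1 := PowerSeries.inv_mul_cancel H hH'
  set F := X * H with hF
  set g := compInvCoeff F with hg
  -- The composition of the inverse with F, cut off so that it still agrees with X through degree n
  -- + 1.
  set P : ℝ⟦X⟧ := ∑ k ∈ Finset.range (n + 2), C (g k) * F ^ k with hP
  have hcoef : ∀ i ≤ n + 1, coeff i P = if i = 1 then 1 else 0 := by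
    intro i hi
    rw [hP, map_sum, ← sum_compInvCoeff_of_le H hH hi]
    exact Finset.sum_congr rfl fun k _ => by rw [coeff_C_mul]
  have hdP : ∀ i ≤ n, coeff i (d⁄dX ℝ P) = if i = 0 then 1 else 0 := by
    intro i hi
    rw [coeff_derivative, hcoef _ (by omega)]
    by_cases h : i = 0 <;> simp [h]
  have h1 : coeff n (H⁻¹ ^ (n + 1) * d⁄dX ℝ P) = coeff n (H⁻¹ ^ (n + 1)) := by
    rw [coeff_mul, Finset.sum_eq_single (n, 0)]
    · rw [hdP 0 (Nat.zero_le _)]; simp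
    · rintro ⟨i, k⟩ hik hne
      have hik : i + k = n := by simpa using hik
      rw [hdP k (by omega), if_neg, mul_zero]
      rintro rfl
      exact hne (by simpa using hik)
    · intro h; exact absurd (by simp) h
  have h2 : d⁄dX ℝ P = ∑ k ∈ Finset.range (n + 1),
      C (((k : ℝ) + 1) * g (k + 1)) * (F ^ k * d⁄dX ℝ F) := by
    rw [hP, Finset.sum_range_succ', map_add, map_sum]
    simp only [pow_zero, mul_one, derivative_C, add_zero]
    refine Finset.sum_congr rfl fun k _ => ?_
    rw [Derivation.leibniz, derivative_C, derivative_pow]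
    simp only [smul_eq_mul, mul_zero, add_zero, Nat.add_sub_cancel, map_mul, map_add, map_one,
      map_natCast]
    push_cast
    ring
  rw [← h1, h2, Finset.mul_sum, map_sum, Finset.sum_range_succ, Finset.sum_eq_zero, zero_add]
  · have : H⁻¹ ^ (n + 1) * (C (((n : ℝ) + 1) * g (n + 1)) * (F ^ n * d⁄dX ℝ F)) =
        C (((n : ℝ) + 1) * g (n + 1)) * (X ^ n * (H⁻¹ ^ (0 + 1) * d⁄dX ℝ F)) := by
      rw [hF, mul_pow]
      have : H⁻¹ ^ n * H ^ n = 1 := by rw [← mul_pow, hinv, one_pow]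
      linear_combination (C (((n : ℝ) + 1) * g (n + 1)) * X ^ n * H⁻¹ * d⁄dX ℝ (X * H)) * this
    rw [this, coeff_C_mul, coeff_X_pow_mul', if_pos le_rfl, Nat.sub_self, hF,
      coeff_lagrange_term H hH, if_pos rfl, mul_one]
  · intro k hk
    rw [Finset.mem_range] at hk
    have : H⁻¹ ^ (n + 1) * (C (((k : ℝ) + 1) * g (k + 1)) * (F ^ k * d⁄dX ℝ F)) =
        C (((k : ℝ) + 1) * g (k + 1)) * (X ^ k * (H⁻¹ ^ (n - k + 1) * d⁄dX ℝ F)) := by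
      have hs : n + 1 = k + (n - k + 1) := by omega
      rw [hF, mul_pow, hs, pow_add H⁻¹ k]
      have : H⁻¹ ^ k * H ^ k = 1 := by rw [← mul_pow, hinv, one_pow]
      linear_combination (C (((k : ℝ) + 1) * g (k + 1)) * X ^ k * H⁻¹ ^ (n - k + 1) *
        d⁄dX ℝ (X * H)) * this
    rw [this, coeff_C_mul, coeff_X_pow_mul', if_pos hk.le, hF,
      coeff_lagrange_term H hH, if_neg (by omega), mul_zero]

/-- Substitute 1 − H for X in the binomial series of (1 − X)^(-(r+1)). Since 1 − H has no constant
term, powers above r do not reach degree r. -/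
theorem coeff_inv_pow_eq_sum (H : ℝ⟦X⟧) (hH : constantCoeff H = 1) (r : ℕ) :
    coeff r (H⁻¹ ^ (r + 1)) =
      ∑ k ∈ Finset.range (r + 1), ((r + k).choose r : ℝ) * coeff r ((1 - H) ^ k) := by
  have hH' : constantCoeff H ≠ 0 := by rw [hH]; exact one_ne_zero
  have hinv : H⁻¹ * H = 1 := PowerSeries.inv_mul_cancel H hH'
  have hs : HasSubst (1 - H) := HasSubst.of_constantCoeff_zero (by
    rw [map_sub, map_one]
    exact sub_eq_zero.mpr hH.symm)
  have h1 : (mk fun n => ((r + n).choose r : ℝ)) * (1 - X : ℝ⟦X⟧) ^ (r + 1) = 1 :=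
    (invOneSubPow ℝ (r + 1)).val_inv
  have h2 := congrArg (subst (1 - H)) h1
  rw [subst_mul hs, subst_pow hs, subst_sub hs, subst_X hs] at h2
  have hone : subst (1 - H) (1 : ℝ⟦X⟧) = 1 := by
    rw [← coe_substAlgHom hs, map_one]
  rw [hone, sub_sub_cancel] at h2
  have h3 : subst (1 - H) (mk fun n => ((r + n).choose r : ℝ)) = H⁻¹ ^ (r + 1) := by
    have : H⁻¹ ^ (r + 1) * H ^ (r + 1) = 1 := by rw [← mul_pow, hinv, one_pow]
    calc _ = subst (1 - H) (mk fun n => ((r + n).choose r : ℝ)) * H ^ (r + 1) *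
          H⁻¹ ^ (r + 1) := by
            rw [mul_assoc, mul_comm (H ^ _), this, mul_one]
      _ = _ := by rw [h2, one_mul]
  rw [← h3, coeff_subst' hs, finsum_eq_sum_of_support_subset]
  · exact Finset.sum_congr rfl fun k _ => by rw [coeff_mk, smul_eq_mul]
  · intro k hk
    simp only [Function.mem_support, ne_eq] at hk
    by_contra hlt
    apply hk
    suffices h : coeff r ((1 - H) ^ k) = 0 by rw [h, smul_zero]
    apply coeff_of_lt_order
    refine lt_of_lt_of_le ?_ (le_order_pow_of_constantCoeff_eq_zero k ?_)
    · simp only [Finset.coe_range, Set.mem_Iio, not_lt] at hlt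
      exact_mod_cast hlt
    · rw [map_sub, map_one, hH, sub_self]

/-- The multinomial theorem for the exponential generating series of y: each multiplicity function μ
is one monomial of the k-th power. -/
theorem bellPoly_eq_coeff (r k : ℕ) (y : ℕ → ℝ) :
    bellPoly r k y = (r.factorial : ℝ) / k.factorial *
      coeff r ((mk fun i => if i = 0 then 0 else y i / (i.factorial : ℝ)) ^ k) := by
  set z : ℕ → ℝ := fun i => y i / (i.factorial : ℝ) with hz
  set Q : Polynomial ℝ := ∑ i : Fin r, Polynomial.C (z ((i : ℕ) + 1)) * Polynomial.X ^ ((i : ℕ) + 1)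
    with hQ
  -- Degree r of the power sees the series only through degree r, so the finite multinomial theorem
  -- applies.
  have hQt : trunc (r + 1) (mk fun i => if i = 0 then 0 else z i) = Q := by
    ext m
    rw [coeff_trunc, hQ, Polynomial.finsetSum_coeff]
    simp only [Polynomial.coeff_C_mul, Polynomial.coeff_X_pow, coeff_mk]
    by_cases hm : m < r + 1
    · rw [if_pos hm]
      rcases Nat.eq_zero_or_pos m with rfl | hm0
      · rw [if_pos rfl, Finset.sum_eq_zero]; intro i _; simp
      · rw [if_neg hm0.ne', Finset.sum_eq_single (⟨m - 1, by omega⟩ : Fin r)]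
        · simp [Nat.sub_add_cancel hm0]
        · intro i _ hi
          rw [if_neg, mul_zero]
          intro h; apply hi; ext; simp; omega
        · simp
    · rw [if_neg hm, Finset.sum_eq_zero]
      intro i _
      rw [if_neg (by have := i.2; omega), mul_zero]
  have hc : coeff r ((mk fun i => if i = 0 then 0 else z i) ^ k) = (Q ^ k).coeff r := by
    rw [← Polynomial.coeff_coe, Polynomial.coe_pow, ← hQt,
      ← coeff_coe_trunc_of_lt (Nat.lt_succ_self r), ← trunc_trunc_pow,
      coeff_coe_trunc_of_lt (Nat.lt_succ_self r)]
  have hpow : (Q ^ k).coeff r = ∑ μ ∈ (Finset.piAntidiag (Finset.univ : Finset (Fin r)) k).filter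
      (fun μ => ∑ i : Fin r, ((i : ℕ) + 1) * μ i = r),
      (Nat.multinomial Finset.univ μ : ℝ) * ∏ i : Fin r, z ((i : ℕ) + 1) ^ μ i := by
    rw [hQ, Finset.sum_pow_eq_sum_piAntidiag, Polynomial.finsetSum_coeff, Finset.sum_filter]
    refine Finset.sum_congr rfl fun μ _ => ?_
    simp only [mul_pow, Finset.prod_mul_distrib, ← Polynomial.C_pow, ← pow_mul]
    rw [← map_prod, Finset.prod_pow_eq_pow_sum, ← Polynomial.C_eq_natCast, Polynomial.coeff_C_mul,
      Polynomial.coeff_C_mul, Polynomial.coeff_X_pow]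
    simp only [eq_comm (a := r), mul_ite, mul_one, mul_zero]
  rw [hc, hpow, bellPoly, Finset.mul_sum]
  have hset : (Fintype.piFinset (fun _ : Fin r => Finset.range (r + 1))).filter
      (fun μ : Fin r → ℕ => ∑ i : Fin r, μ i = k ∧ ∑ i : Fin r, ((i : ℕ) + 1) * μ i = r) =
      (Finset.piAntidiag (Finset.univ : Finset (Fin r)) k).filter
      (fun μ => ∑ i : Fin r, ((i : ℕ) + 1) * μ i = r) := by
    ext μ
    simp only [Finset.mem_filter, Fintype.mem_piFinset, Finset.mem_range, Finset.mem_piAntidiag,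
      Finset.mem_univ, implies_true, and_true]
    refine ⟨fun h => h.2, fun h => ⟨fun i => ?_, h⟩⟩
    have h1 : ((i : ℕ) + 1) * μ i ≤ r := by
      conv_rhs => rw [← h.2]
      exact Finset.single_le_sum (f := fun i : Fin r => ((i : ℕ) + 1) * μ i)
        (fun _ _ => Nat.zero_le _) (Finset.mem_univ i)
    nlinarith
  rw [hset]
  refine Finset.sum_congr rfl fun μ hμ => ?_
  rw [Finset.mem_filter, Finset.mem_piAntidiag] at hμ
  have hmul : ((∏ i : Fin r, (μ i).factorial : ℕ) : ℝ) * (Nat.multinomial Finset.univ μ : ℝ) =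
      (k.factorial : ℝ) := by
    rw [← Nat.cast_mul, Nat.multinomial_spec]
    exact congrArg (fun n : ℕ => (n.factorial : ℝ)) hμ.1.1
  have hk : (k.factorial : ℝ) ≠ 0 := by positivity
  have hp : ((∏ i : Fin r, (μ i).factorial : ℕ) : ℝ) ≠ 0 := by
    rw [Nat.cast_ne_zero]; exact Finset.prod_ne_zero_iff.mpr fun i _ => (μ i).factorial_ne_zero
  have hm : (Nat.multinomial Finset.univ μ : ℝ) =
      (k.factorial : ℝ) / ∏ i : Fin r, ((μ i).factorial : ℝ) := by
    rw [eq_div_iff (by exact_mod_cast hp), ← hmul]; push_cast; ring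
  rw [hm, ← mul_assoc]
  congr 1
  field_simp

theorem b_eq_compInvCoeff (a : ℕ → ℝ) (ha : a 0 = 1) (r : ℕ) :
    b a (r + 1) = ((r + 1).factorial : ℝ) * compInvCoeff (X * mk a) (r + 1) := by
  have hH : constantCoeff (mk a) = 1 := by
    rw [← coeff_zero_eq_constantCoeff_apply, coeff_mk, ha]
  have h := lagrange_inversion (mk a) hH r
  rw [coeff_inv_pow_eq_sum _ hH] at h
  rw [Nat.factorial_succ, Nat.cast_mul, mul_comm ((r + 1 : ℕ) : ℝ), mul_assoc]
  push_cast
  rw [h, b, Finset.mul_sum]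
  refine Finset.sum_congr rfl fun k _ => ?_
  have hs : (mk fun i => if i = 0 then 0 else -((i.factorial : ℝ) * a i) / (i.factorial : ℝ)) =
      1 - mk a := by
    ext i
    rw [coeff_mk, map_sub, coeff_mk, coeff_one]
    by_cases hi : i = 0
    · simp [hi, ha]
    · rw [if_neg hi, if_neg hi]; field_simp; simp
  rw [bellPoly_eq_coeff, hs]
  have hch : ((r + k).choose r : ℝ) * (r.factorial : ℝ) * (k.factorial : ℝ) =
      ((r + k).factorial : ℝ) := by
    have := Nat.add_choose_mul_factorial_mul_factorial r k
    rw [← Nat.choose_symm_add] at this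
    exact_mod_cast this
  rw [← hch]
  field_simp

/-- The field diffeomorphism `F(x) = ∑ a_k x^{k+1}`, truncated. -/
noncomputable def diffeoPoly (a : ℕ → ℝ) (N : ℕ) : Polynomial ℝ :=
  ∑ k ∈ Finset.range (N + 1), Polynomial.C (a k) * Polynomial.X ^ (k + 1)

/-- The inverse `∑ b_k x^k / k!` of the field diffeomorphism, truncated. -/
noncomputable def inversePoly (a : ℕ → ℝ) (N : ℕ) : Polynomial ℝ :=
  ∑ k ∈ Finset.range (N + 1),
    Polynomial.C (b a (k + 1) / ((k + 1).factorial : ℝ)) * Polynomial.X ^ (k + 1)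

theorem diffeoPoly_eq_trunc (a : ℕ → ℝ) (N : ℕ) :
    diffeoPoly a N = trunc (N + 2) (X * mk a) := by
  ext m
  rw [coeff_trunc, diffeoPoly, Polynomial.finsetSum_coeff]
  simp only [Polynomial.coeff_C_mul, Polynomial.coeff_X_pow]
  rcases m with _ | m
  · simp
  · rw [coeff_succ_X_mul, coeff_mk]
    simp

theorem X_pow_dvd_inversePoly_comp (a : ℕ → ℝ) (ha : a 0 = 1) (N : ℕ) :
    (Polynomial.X : Polynomial ℝ) ^ (N + 2) ∣
      (inversePoly a N).comp (diffeoPoly a N) - Polynomial.X := by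
  have hH : constantCoeff (mk a) = 1 := by
    rw [← coeff_zero_eq_constantCoeff_apply, coeff_mk, ha]
  rw [Polynomial.X_pow_dvd_iff]
  intro d hd
  rw [Polynomial.coeff_sub, sub_eq_zero, Polynomial.coeff_X]
  have h := sum_compInvCoeff_of_le (mk a) hH (n := d) (N := N + 1) (by omega)
  simp only [eq_comm (a := 1) (b := d)]
  rw [← h, Finset.sum_range_succ', compInvCoeff_zero, zero_mul, add_zero, inversePoly,
    Polynomial.sum_comp, Polynomial.finsetSum_coeff]
  refine Finset.sum_congr rfl fun k _ => ?_
  rw [Polynomial.mul_comp, Polynomial.C_comp, Polynomial.X_pow_comp, Polynomial.coeff_C_mul,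
    b_eq_compInvCoeff a ha, mul_div_cancel_left₀ _ (by positivity), diffeoPoly_eq_trunc,
    ← Polynomial.coeff_coe, Polynomial.coe_pow,
    ← coeff_coe_trunc_of_lt hd, trunc_trunc_pow, coeff_coe_trunc_of_lt hd]

theorem X_pow_dvd_derivative_inversePoly_comp (a : ℕ → ℝ) (ha : a 0 = 1) (N : ℕ) :
    (Polynomial.X : Polynomial ℝ) ^ (N + 1) ∣
      (Polynomial.derivative (inversePoly a N)).comp (diffeoPoly a N) *
        Polynomial.derivative (diffeoPoly a N) - 1 := by
  obtain ⟨Q, hQ⟩ := X_pow_dvd_inversePoly_comp a ha N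
  have h := congrArg Polynomial.derivative hQ
  rw [Polynomial.derivative_sub, Polynomial.derivative_comp, Polynomial.derivative_X,
    Polynomial.derivative_mul, Polynomial.derivative_X_pow,
    show N + 2 - 1 = N + 1 by omega] at h
  rw [mul_comm (Polynomial.comp _ _), h]
  exact ⟨Polynomial.C ((N + 2 : ℕ) : ℝ) * Q + Polynomial.X * Polynomial.derivative Q, by
    push_cast; ring⟩

variable {A : Type*} [CommRing A] [Algebra ℝ A]

/-- Truncated identities become exact at nilpotent elements, so polynomials can stand in for the
series F and G. -/
theorem aeval_eq_of_X_pow_dvd {N : ℕ} {p q : Polynomial ℝ} (h : Polynomial.X ^ N ∣ p - q) {φ : A}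
    (hφ : φ ^ N = 0) : Polynomial.aeval φ p = Polynomial.aeval φ q := by
  obtain ⟨Q, hQ⟩ := h
  rw [← sub_eq_zero, ← map_sub, hQ, map_mul, map_pow, Polynomial.aeval_X, hφ, zero_mul]

theorem aeval_inversePoly (a : ℕ → ℝ) (ha : a 0 = 1) {N : ℕ} {φ : A} (hφ : φ ^ (N + 1) = 0) :
    Polynomial.aeval (Polynomial.aeval φ (diffeoPoly a N)) (inversePoly a N) = φ := by
  have h := aeval_eq_of_X_pow_dvd (X_pow_dvd_inversePoly_comp a ha N) (φ := φ)
    (by rw [pow_succ, hφ, zero_mul])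
  rwa [Polynomial.aeval_comp, Polynomial.aeval_X] at h

theorem aeval_derivative_inversePoly (a : ℕ → ℝ) (ha : a 0 = 1) {N : ℕ} {φ : A}
    (hφ : φ ^ (N + 1) = 0) :
    Polynomial.aeval (Polynomial.aeval φ (diffeoPoly a N)) (Polynomial.derivative (inversePoly a N)) *
      Polynomial.aeval φ (Polynomial.derivative (diffeoPoly a N)) = 1 := by
  have h := aeval_eq_of_X_pow_dvd (X_pow_dvd_derivative_inversePoly_comp a ha N) hφ
  rwa [map_mul, Polynomial.aeval_comp, map_one] at h

end Inversion

end FieldDiffeo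

namespace FieldDiffeo

/-! ### Set partitions and their decompositions -/

section SetPartitions

variable {ι : Type*} [DecidableEq ι]

/-- The set partitions of `U`, as sets of blocks. -/
def partitions (U : Finset ι) : Finset (Finset (Finset ι)) :=
  U.powerset.powerset.filter fun π =>
    ∅ ∉ π ∧ (∀ B ∈ π, ∀ C ∈ π, B ≠ C → Disjoint B C) ∧ π.biUnion id = U

theorem mem_partitions {U : Finset ι} {π : Finset (Finset ι)} :
    π ∈ partitions U ↔
      ∅ ∉ π ∧ (∀ B ∈ π, ∀ C ∈ π, B ≠ C → Disjoint B C) ∧ π.biUnion id = U := by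
  simp only [partitions, Finset.mem_filter, Finset.mem_powerset, and_iff_right_iff_imp]
  rintro ⟨_, _, rfl⟩ B hB
  rw [Finset.mem_powerset]
  exact Finset.subset_biUnion_of_mem id hB

theorem subset_of_mem_partitions {U B : Finset ι} {π : Finset (Finset ι)} (hπ : π ∈ partitions U)
    (hB : B ∈ π) : B ⊆ U := by
  rw [← (mem_partitions.mp hπ).2.2]
  exact Finset.subset_biUnion_of_mem id hB

theorem nonempty_of_mem_partitions {U B : Finset ι} {π : Finset (Finset ι)}
    (hπ : π ∈ partitions U) (hB : B ∈ π) : B.Nonempty := by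
  rw [Finset.nonempty_iff_ne_empty]
  rintro rfl
  exact (mem_partitions.mp hπ).1 hB

theorem singleton_mem_partitions {U : Finset ι} (hU : U.Nonempty) : {U} ∈ partitions U := by
  rw [mem_partitions]
  refine ⟨?_, ?_, by simp⟩
  · simpa [eq_comm] using hU.ne_empty
  · intro B hB C hC h
    simp only [Finset.mem_singleton] at hB hC
    exact absurd (hB.trans hC.symm) h

theorem eq_singleton_of_mem_partitions {U : Finset ι} {π : Finset (Finset ι)}
    (hπ : π ∈ partitions U) (h : U ∈ π) : π = {U} := by
  apply Finset.eq_singleton_iff_unique_mem.mpr ⟨h, fun B hB => ?_⟩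
  by_contra hne
  have hd := (mem_partitions.mp hπ).2.1 B hB U h hne
  have hs := subset_of_mem_partitions hπ hB
  have hn := nonempty_of_mem_partitions hπ hB
  rw [Finset.disjoint_of_subset_iff_left_eq_empty hs] at hd
  exact hn.ne_empty hd

theorem ssubset_of_mem_partitions {U B : Finset ι} {π : Finset (Finset ι)}
    (hπ : π ∈ partitions U) (h2 : 2 ≤ π.card) (hB : B ∈ π) : B ⊂ U := by
  refine (subset_of_mem_partitions hπ hB).ssubset_of_ne ?_
  rintro rfl
  rw [eq_singleton_of_mem_partitions hπ hB] at h2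
  simp at h2

theorem card_partition_eq_one {U : Finset ι} {π : Finset (Finset ι)}
    (hπ : π ∈ partitions U) (h : π.card = 1) : π = {U} := by
  obtain ⟨B, rfl⟩ := Finset.card_eq_one.mp h
  have := (mem_partitions.mp hπ).2.2
  simp at this
  rw [this]

theorem card_partition_pos {U : Finset ι} (hU : U.Nonempty) {π : Finset (Finset ι)}
    (hπ : π ∈ partitions U) : 0 < π.card := by
  rw [Finset.card_pos, Finset.nonempty_iff_ne_empty]
  rintro rfl
  have := (mem_partitions.mp hπ).2.2
  simp at this
  exact hU.ne_empty this.symm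

theorem partitions_empty : partitions (∅ : Finset ι) = {∅} := by
  ext π
  rw [mem_partitions, Finset.mem_singleton]
  constructor
  · rintro ⟨h0, -, h⟩
    rw [Finset.eq_empty_iff_forall_notMem]
    intro B hB
    have : B ⊆ ∅ := by rw [← h]; exact Finset.subset_biUnion_of_mem id hB
    rw [Finset.subset_empty] at this
    exact h0 (this ▸ hB)
  · rintro rfl; simp

theorem card_partition_le {U : Finset ι} {π : Finset (Finset ι)} (hπ : π ∈ partitions U) :
    π.card ≤ U.card := by
  rw [← (mem_partitions.mp hπ).2.2, show π.biUnion id = π.biUnion fun B => B from rfl,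
    Finset.card_biUnion (fun B hB C hC h =>
      (mem_partitions.mp hπ).2.1 B hB C hC h), Finset.card_eq_sum_ones]
  exact Finset.sum_le_sum fun B hB => (nonempty_of_mem_partitions hπ hB).card_pos

theorem mem_partitions_of_subset {U : Finset ι} {π Z : Finset (Finset ι)}
    (hπ : π ∈ partitions U) (hZ : Z ⊆ π) : Z ∈ partitions (Z.biUnion id) := by
  rw [mem_partitions] at *
  exact ⟨fun h => hπ.1 (hZ h), fun B hB C hC => hπ.2.1 B (hZ hB) C (hZ hC), rfl⟩

theorem biUnion_sdiff_of_mem_partitions {U : Finset ι} {π Z : Finset (Finset ι)}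
    (hπ : π ∈ partitions U) (hZ : Z ⊆ π) : (π \ Z).biUnion id = U \ Z.biUnion id := by
  have h := mem_partitions.mp hπ
  ext i
  rw [← h.2.2]
  simp only [Finset.mem_biUnion, Finset.mem_sdiff, id]
  constructor
  · rintro ⟨B, ⟨hB, hBZ⟩, hi⟩
    refine ⟨⟨B, hB, hi⟩, ?_⟩
    rintro ⟨C, hC, hiC⟩
    have hne : B ≠ C := fun e => hBZ (e ▸ hC)
    exact Finset.disjoint_left.mp (h.2.1 B hB C (hZ hC) hne) hi hiC
  · rintro ⟨⟨B, hB, hi⟩, hn⟩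
    exact ⟨B, ⟨hB, fun hBZ => hn ⟨B, hBZ, hi⟩⟩, hi⟩

theorem disjoint_of_partitions_sdiff {U W : Finset ι} {Z Z' : Finset (Finset ι)}
    (hZ : Z ∈ partitions W) (hZ' : Z' ∈ partitions (U \ W)) : Disjoint Z Z' := by
  rw [Finset.disjoint_left]
  intro B hB hB'
  obtain ⟨i, hi⟩ := nonempty_of_mem_partitions hZ hB
  exact (Finset.mem_sdiff.mp (subset_of_mem_partitions hZ' hB' hi)).2
    (subset_of_mem_partitions hZ hB hi)

theorem union_mem_partitions {U W : Finset ι} {Z Z' : Finset (Finset ι)} (hW : W ⊆ U)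
    (hZ : Z ∈ partitions W) (hZ' : Z' ∈ partitions (U \ W)) : Z ∪ Z' ∈ partitions U := by
  have key : ∀ B ∈ Z, ∀ C ∈ Z', Disjoint B C := fun B hB C hC =>
    Finset.disjoint_of_subset_left (subset_of_mem_partitions hZ hB)
      (Finset.disjoint_of_subset_right (subset_of_mem_partitions hZ' hC) Finset.disjoint_sdiff)
  rw [mem_partitions] at *
  refine ⟨by simp [hZ.1, hZ'.1], ?_, ?_⟩
  · intro B hB C hC hne
    rw [Finset.mem_union] at hB hC
    rcases hB with hB | hB <;> rcases hC with hC | hC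
    · exact hZ.2.1 B hB C hC hne
    · exact key B hB C hC
    · exact (key C hC B hB).symm
    · exact hZ'.2.1 B hB C hC hne
  · rw [Finset.union_biUnion, hZ.2.2, hZ'.2.2, Finset.union_sdiff_of_subset hW]

variable {M : Type*} [AddCommMonoid M]

/-- Choosing a partition and some of its blocks amounts to choosing a subset and partitions of it
and of its complement. -/
theorem sum_partitions_powerset (U : Finset ι)
    (f : Finset (Finset ι) → Finset (Finset ι) → M) :
    ∑ π ∈ partitions U, ∑ Z ∈ π.powerset, f Z (π \ Z) =
      ∑ W ∈ U.powerset, ∑ Z ∈ partitions W, ∑ Z' ∈ partitions (U \ W), f Z Z' := by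
  simp_rw [Finset.sum_sigma']
  refine Finset.sum_bij' (fun p _ => ⟨p.2.biUnion id, p.2, p.1 \ p.2⟩)
    (fun p _ => ⟨p.2.1 ∪ p.2.2, p.2.1⟩) ?_ ?_ ?_ ?_ ?_
  · rintro ⟨π, Z⟩ h
    simp only [Finset.mem_sigma, Finset.mem_powerset] at h ⊢
    refine ⟨?_, mem_partitions_of_subset h.1 h.2, ?_⟩
    · rw [Finset.biUnion_subset]
      exact fun B hB => subset_of_mem_partitions h.1 (h.2 hB)
    · rw [← biUnion_sdiff_of_mem_partitions h.1 h.2]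
      exact mem_partitions_of_subset h.1 Finset.sdiff_subset
  · rintro ⟨W, Z, Z'⟩ h
    simp only [Finset.mem_sigma, Finset.mem_powerset] at h ⊢
    exact ⟨union_mem_partitions h.1 h.2.1 h.2.2, Finset.subset_union_left⟩
  · rintro ⟨π, Z⟩ h
    simp only [Finset.mem_sigma, Finset.mem_powerset] at h
    simp [Finset.union_sdiff_of_subset h.2]
  · rintro ⟨W, Z, Z'⟩ h
    simp only [Finset.mem_sigma, Finset.mem_powerset] at h
    have hd := disjoint_of_partitions_sdiff h.2.1 h.2.2
    have hZ := (mem_partitions.mp h.2.1).2.2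
    subst hZ
    simp [Finset.union_sdiff_cancel_left hd]
  · rintro ⟨π, Z⟩ _
    rfl

/-- Choosing a partition and one of its blocks amounts to choosing a nonempty subset and a partition
of its complement. -/
theorem sum_partitions_block (U : Finset ι) (f : Finset ι → Finset (Finset ι) → M) :
    ∑ π ∈ partitions U, ∑ B ∈ π, f B (π.erase B) =
      ∑ W ∈ U.powerset.erase ∅, ∑ Z ∈ partitions (U \ W), f W Z := by
  simp_rw [Finset.sum_sigma']
  have hnot : ∀ W Z, W ∈ U.powerset.erase ∅ → Z ∈ partitions (U \ W) → W ∉ Z := by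
    intro W Z hW hZ h
    rw [Finset.mem_erase] at hW
    obtain ⟨i, hi⟩ := Finset.nonempty_iff_ne_empty.mpr hW.1
    exact (Finset.mem_sdiff.mp (subset_of_mem_partitions hZ h hi)).2 hi
  refine Finset.sum_bij' (fun p _ => ⟨p.2, p.1.erase p.2⟩)
    (fun p _ => ⟨insert p.1 p.2, p.1⟩) ?_ ?_ ?_ ?_ ?_
  · rintro ⟨π, B⟩ h
    simp only [Finset.mem_sigma, Finset.mem_erase, Finset.mem_powerset] at h ⊢
    refine ⟨⟨(nonempty_of_mem_partitions h.1 h.2).ne_empty, subset_of_mem_partitions h.1 h.2⟩, ?_⟩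
    have := biUnion_sdiff_of_mem_partitions h.1 (Finset.singleton_subset_iff.mpr h.2)
    rw [Finset.singleton_biUnion, id] at this
    rw [← this, Finset.sdiff_singleton_eq_erase]
    exact mem_partitions_of_subset h.1 (Finset.erase_subset _ _)
  · rintro ⟨W, Z⟩ h
    simp only [Finset.mem_sigma, Finset.mem_insert_self, and_true] at h ⊢
    have hW := Finset.mem_erase.mp h.1
    rw [Finset.mem_powerset] at hW
    rw [Finset.insert_eq]
    exact union_mem_partitions hW.2
      (singleton_mem_partitions (Finset.nonempty_iff_ne_empty.mpr hW.1)) h.2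
  · rintro ⟨π, B⟩ h
    simp only [Finset.mem_sigma] at h
    simp [Finset.insert_erase h.2]
  · rintro ⟨W, Z⟩ h
    simp only [Finset.mem_sigma] at h
    simp [Finset.erase_insert (hnot W Z h.1 h.2)]
  · rintro ⟨π, B⟩ _
    rfl

end SetPartitions

/-! ### The convolution algebra of functions on finite sets -/

/-- Functions on the finite subsets of `ι`, with the product that sums over the decompositions of a
set into two disjoint sets. -/
@[ext]
structure SubsetAlgebra (ι : Type*) where
  /-- the underlying function -/
  toFun : Finset ι → ℝ

namespace SubsetAlgebra

variable {ι : Type*}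

instance : CoeFun (SubsetAlgebra ι) fun _ => Finset ι → ℝ := ⟨toFun⟩

/-- An element of the algebra is a function on finite subsets. -/
def equivFun : SubsetAlgebra ι ≃ (Finset ι → ℝ) := ⟨toFun, mk, fun _ => rfl, fun _ => rfl⟩

instance : AddCommGroup (SubsetAlgebra ι) := equivFun.addCommGroup

noncomputable instance : Module ℝ (SubsetAlgebra ι) := equivFun.module ℝ

theorem add_apply (f g : SubsetAlgebra ι) (U : Finset ι) : (f + g) U = f U + g U := rfl

theorem smul_apply (c : ℝ) (f : SubsetAlgebra ι) (U : Finset ι) : (c • f) U = c * f U := rfl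

theorem zero_apply (U : Finset ι) : (0 : SubsetAlgebra ι) U = 0 := rfl

variable [DecidableEq ι]

instance : Mul (SubsetAlgebra ι) := ⟨fun f g => ⟨fun U => ∑ W ∈ U.powerset, f W * g (U \ W)⟩⟩

instance : One (SubsetAlgebra ι) := ⟨⟨fun U => if U = ∅ then 1 else 0⟩⟩

theorem mul_apply (f g : SubsetAlgebra ι) (U : Finset ι) :
    (f * g) U = ∑ W ∈ U.powerset, f W * g (U \ W) := rfl

theorem one_apply (U : Finset ι) : (1 : SubsetAlgebra ι) U = if U = ∅ then 1 else 0 := rfl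

theorem mul_comm' (f g : SubsetAlgebra ι) : f * g = g * f := by
  ext U
  rw [mul_apply, mul_apply]
  refine Finset.sum_bij' (fun W _ => U \ W) (fun W _ => U \ W) ?_ ?_ ?_ ?_ ?_ <;>
    intro W hW <;> rw [Finset.mem_powerset] at hW
  · simp
  · simp
  · simp [hW]
  · simp [hW]
  · rw [Finset.sdiff_sdiff_eq_self hW, mul_comm]

theorem mul_assoc' (f g h : SubsetAlgebra ι) : f * g * h = f * (g * h) := by
  ext U
  simp only [mul_apply, Finset.sum_mul, Finset.mul_sum]
  rw [Finset.sum_sigma', Finset.sum_sigma']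
  refine Finset.sum_bij' (fun p _ => ⟨p.2, p.1 \ p.2⟩) (fun p _ => ⟨p.1 ∪ p.2, p.1⟩) ?_ ?_ ?_ ?_ ?_
  · rintro ⟨W, V⟩ hp
    simp only [Finset.mem_sigma, Finset.mem_powerset] at hp ⊢
    exact ⟨hp.2.trans hp.1, Finset.sdiff_subset_sdiff hp.1 subset_rfl⟩
  · rintro ⟨W, V⟩ hp
    simp only [Finset.mem_sigma, Finset.mem_powerset] at hp ⊢
    exact ⟨Finset.union_subset hp.1 (hp.2.trans Finset.sdiff_subset), Finset.subset_union_left⟩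
  · rintro ⟨W, V⟩ hp
    simp only [Finset.mem_sigma, Finset.mem_powerset] at hp
    simp [Finset.union_sdiff_of_subset hp.2]
  · rintro ⟨W, V⟩ hp
    simp only [Finset.mem_sigma, Finset.mem_powerset] at hp
    have : Disjoint W V :=
      Finset.disjoint_of_subset_right hp.2 Finset.disjoint_sdiff
    simp [Finset.union_sdiff_cancel_left this]
  · rintro ⟨W, V⟩ hp
    simp only [Finset.mem_sigma, Finset.mem_powerset] at hp
    simp only [sdiff_sdiff_left, Finset.sup_eq_union, Finset.union_sdiff_of_subset hp.2, mul_assoc]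

theorem one_mul' (f : SubsetAlgebra ι) : 1 * f = f := by
  ext U
  rw [mul_apply, Finset.sum_eq_single ∅]
  · simp [one_apply]
  · intro W _ hW; simp [one_apply, hW]
  · simp

theorem mul_add' (f g h : SubsetAlgebra ι) : f * (g + h) = f * g + f * h := by
  ext U
  simp only [mul_apply, add_apply, mul_add, Finset.sum_add_distrib]

theorem mul_zero' (f : SubsetAlgebra ι) : f * 0 = 0 := by
  ext U
  simp [mul_apply, zero_apply]

instance : CommRing (SubsetAlgebra ι) :=
  { (inferInstance : AddCommGroup (SubsetAlgebra ι)) with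
    mul := (· * ·)
    one := 1
    mul_assoc := mul_assoc'
    mul_comm := mul_comm'
    one_mul := one_mul'
    mul_one := fun f => by rw [mul_comm', one_mul']
    left_distrib := mul_add'
    right_distrib := fun f g h => by rw [mul_comm', mul_add', mul_comm' h f, mul_comm' h g]
    mul_zero := mul_zero'
    zero_mul := fun f => by rw [mul_comm', mul_zero'] }

noncomputable instance : Algebra ℝ (SubsetAlgebra ι) :=
  Algebra.ofModule
    (fun c f g => by
      ext U
      simp only [mul_apply, smul_apply, Finset.mul_sum, mul_assoc])
    (fun c f g => by
      ext U
      simp only [mul_apply, smul_apply, Finset.mul_sum]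
      exact Finset.sum_congr rfl fun W _ => by ring)

/-- A k-fold convolution power sums over ordered decompositions into k parts. Empty parts contribute
zero, and each partition into k blocks is ordered in k! ways. -/
theorem pow_apply {φ : SubsetAlgebra ι} (hφ : φ ∅ = 0) (k : ℕ) (U : Finset ι) :
    (φ ^ k) U = (k.factorial : ℝ) *
      ∑ π ∈ partitions U, if π.card = k then ∏ B ∈ π, φ B else 0 := by
  induction k generalizing U with
  | zero =>
    rw [pow_zero, one_apply, Nat.factorial_zero, Nat.cast_one, one_mul]
    by_cases hU : U = ∅
    · subst hU
      rw [partitions_empty, Finset.sum_singleton, if_pos rfl, if_pos Finset.card_empty]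
      rfl
    · rw [if_neg hU, Finset.sum_eq_zero]
      intro π hπ
      rw [if_neg (card_partition_pos (Finset.nonempty_iff_ne_empty.mpr hU) hπ).ne']
  | succ k ih =>
    have h := sum_partitions_block U
      (fun W Z => if Z.card = k then φ W * ∏ B ∈ Z, φ B else 0)
    -- A partition into k + 1 blocks arises k + 1 times, once for each choice of the block that is
    -- split off.
    have hl : ∀ π ∈ partitions U,
        ∑ B ∈ π, (if (π.erase B).card = k then φ B * ∏ C ∈ π.erase B, φ C else 0) =
          ((k : ℝ) + 1) * if π.card = k + 1 then ∏ B ∈ π, φ B else 0 := by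
      intro π _
      rw [show ∑ B ∈ π, (if (π.erase B).card = k then φ B * ∏ C ∈ π.erase B, φ C else 0) =
        ∑ B ∈ π, if π.card = k + 1 then ∏ C ∈ π, φ C else 0 from
        Finset.sum_congr rfl fun B hB => by
          rw [Finset.card_erase_of_mem hB, Finset.mul_prod_erase π φ hB]
          have : 0 < π.card := Finset.card_pos.mpr ⟨B, hB⟩
          simp only [show (π.card - 1 = k) ↔ (π.card = k + 1) by omega]]
      rw [Finset.sum_const, nsmul_eq_mul]
      by_cases hk : π.card = k + 1
      · simp [hk]
      · simp [hk]
    rw [Finset.sum_congr rfl hl, ← Finset.mul_sum] at h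
    rw [Nat.factorial_succ, mul_comm (k + 1), Nat.cast_mul, mul_assoc]
    push_cast
    rw [h, pow_succ', mul_apply, Finset.mul_sum,
      ← Finset.sum_erase (a := ∅) U.powerset (by rw [hφ, zero_mul])]
    refine Finset.sum_congr rfl fun W _ => ?_
    rw [ih, mul_left_comm, Finset.mul_sum]
    congr 1
    exact Finset.sum_congr rfl fun Z _ => by rw [mul_ite, mul_zero]

theorem pow_eq_zero_of_card_lt [Fintype ι] {φ : SubsetAlgebra ι} (hφ : φ ∅ = 0) {k : ℕ}
    (hk : Fintype.card ι < k) : φ ^ k = 0 := by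
  ext U
  rw [pow_apply hφ, Finset.sum_eq_zero, mul_zero, zero_apply]
  intro π hπ
  rw [if_neg]
  have := card_partition_le hπ
  have := Finset.card_le_univ U
  omega

/-- Here k! times the k-th coefficient becomes the weight of a vertex joining k blocks; the power
series calculus of F and G thus turns into tree recursions. -/
theorem aeval_apply {φ : SubsetAlgebra ι} (hφ : φ ∅ = 0) (p : Polynomial ℝ) (U : Finset ι) :
    (Polynomial.aeval φ p) U =
      ∑ π ∈ partitions U, ((π.card.factorial : ℝ) * p.coeff π.card) * ∏ B ∈ π, φ B := by
  induction p using Polynomial.induction_on' with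
  | add p q hp hq =>
    rw [map_add, add_apply, hp, hq, ← Finset.sum_add_distrib]
    exact Finset.sum_congr rfl fun π _ => by rw [Polynomial.coeff_add]; ring
  | monomial k c =>
    rw [Polynomial.aeval_monomial, ← Algebra.smul_def, smul_apply, pow_apply hφ, Finset.mul_sum,
      Finset.mul_sum]
    refine Finset.sum_congr rfl fun π _ => ?_
    rw [Polynomial.coeff_monomial]
    by_cases h : k = π.card
    · subst h; simp; ring
    · rw [if_neg (Ne.symm h), if_neg h]; ring

end SubsetAlgebra

end FieldDiffeo

namespace FieldDiffeo

/-! ### Equality of the two recursions for currents -/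

section Currents

open Polynomial

variable {ι : Type*}

/-- The sum of the off-shell variables of the one-element blocks of a partition. -/
def legSum (x : Finset ι → ℝ) (π : Finset (Finset ι)) : ℝ :=
  ∑ B ∈ π, if B.card = 1 then x B else 0

theorem legSum_singleton (x : Finset ι → ℝ) {U : Finset ι} (hU : 2 ≤ U.card) :
    legSum x {U} = 0 := by
  rw [legSum, Finset.sum_singleton, if_neg (by omega)]

variable [DecidableEq ι]

/-- The vertex of the transformed theory at which the blocks of `π` and one further line meet. -/
def diffeoVertex (a : ℕ → ℝ) (x : Finset ι → ℝ) (π : Finset (Finset ι)) : ℝ :=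
  ∑ Z ∈ π.powerset, if Z = ∅ then 0 else
    ((Z.card.factorial : ℝ) * a (Z.card - 1)) *
      (((π \ Z).card + 1).factorial * a (π \ Z).card) * x (Z.biUnion id)

theorem factorial_mul_coeff_diffeoPoly (a : ℕ → ℝ) {N k : ℕ} (hk : k ≤ N) :
    (k.factorial : ℝ) * (diffeoPoly a N).coeff k =
      if k = 0 then 0 else (k.factorial : ℝ) * a (k - 1) := by
  rw [diffeoPoly_eq_trunc, PowerSeries.coeff_trunc, if_pos (by omega)]
  rcases k with _ | k
  · simp
  · rw [PowerSeries.coeff_succ_X_mul, PowerSeries.coeff_mk]; simp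

theorem factorial_mul_coeff_derivative_diffeoPoly (a : ℕ → ℝ) {N k : ℕ} (hk : k ≤ N) :
    (k.factorial : ℝ) * (derivative (diffeoPoly a N)).coeff k = ((k + 1).factorial : ℝ) * a k := by
  rw [coeff_derivative, diffeoPoly_eq_trunc, PowerSeries.coeff_trunc, if_pos (by omega),
    PowerSeries.coeff_succ_X_mul, PowerSeries.coeff_mk, Nat.factorial_succ]
  push_cast; ring

theorem coeff_inversePoly (a : ℕ → ℝ) {N k : ℕ} (hk : k ≤ N) :
    (inversePoly a N).coeff (k + 1) = b a (k + 1) / ((k + 1).factorial : ℝ) := by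
  rw [inversePoly, finsetSum_coeff]
  simp only [coeff_C_mul, coeff_X_pow]
  simp
  omega

theorem factorial_mul_coeff_derivative_inversePoly (a : ℕ → ℝ) {N k : ℕ} (hk : k ≤ N) :
    (k.factorial : ℝ) * (derivative (inversePoly a N)).coeff k = b a (k + 1) := by
  rw [coeff_derivative, coeff_inversePoly a hk, Nat.factorial_succ]
  push_cast
  field_simp

theorem factorial_mul_coeff_inversePoly (a : ℕ → ℝ) {N k : ℕ} (hk : k ≤ N) :
    (k.factorial : ℝ) * (inversePoly a N).coeff k = b a k := by
  rcases k with _ | k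
  · rw [inversePoly, finsetSum_coeff, Finset.sum_eq_zero, mul_zero, b]
    intro k _
    rw [coeff_C_mul, coeff_X_pow, if_neg (by omega), mul_zero]
  · rw [coeff_inversePoly a (by omega)]
    field_simp

theorem b_one (a : ℕ → ℝ) : b a 1 = 1 := by
  simp [b, bellPoly]

theorem card_partition_le_univ [Fintype ι] {U : Finset ι} {π : Finset (Finset ι)}
    (hπ : π ∈ partitions U) : π.card ≤ Fintype.card ι :=
  (card_partition_le hπ).trans (Finset.card_le_univ U)

theorem sum_partitions_eq_add {M : Type*} [AddCommMonoid M] {U : Finset ι} (hU : U.Nonempty)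
    (f : Finset (Finset ι) → M) :
    ∑ π ∈ partitions U, f π = f {U} + ∑ π ∈ partitions U with 2 ≤ π.card, f π := by
  rw [← Finset.sum_filter_add_sum_filter_not (partitions U) (fun π => 2 ≤ π.card), add_comm]
  congr 1
  have : (partitions U).filter (fun π => ¬ 2 ≤ π.card) = {{U}} := by
    ext π
    simp only [Finset.mem_filter, Finset.mem_singleton, not_le]
    constructor
    · rintro ⟨hπ, h⟩
      have := card_partition_pos hU hπ
      exact card_partition_eq_one hπ (by omega)
    · rintro rfl
      exact ⟨singleton_mem_partitions hU, by simp⟩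
  rw [this, Finset.sum_singleton]

variable [Fintype ι]

namespace SubsetAlgebra

theorem aeval_diffeoPoly_apply (a : ℕ → ℝ) {φ : SubsetAlgebra ι} (hφ : φ ∅ = 0) (U : Finset ι) :
    (aeval φ (diffeoPoly a (Fintype.card ι))) U = ∑ π ∈ partitions U,
      (if π = ∅ then 0 else (π.card.factorial : ℝ) * a (π.card - 1)) * ∏ B ∈ π, φ B := by
  rw [aeval_apply hφ]
  refine Finset.sum_congr rfl fun π hπ => ?_
  rw [factorial_mul_coeff_diffeoPoly a (card_partition_le_univ hπ)]
  simp only [Finset.card_eq_zero]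

theorem aeval_derivative_diffeoPoly_apply (a : ℕ → ℝ) {φ : SubsetAlgebra ι} (hφ : φ ∅ = 0)
    (U : Finset ι) :
    (aeval φ (derivative (diffeoPoly a (Fintype.card ι)))) U = ∑ π ∈ partitions U,
      ((π.card + 1).factorial * a π.card) * ∏ B ∈ π, φ B := by
  rw [aeval_apply hφ]
  refine Finset.sum_congr rfl fun π hπ => ?_
  rw [factorial_mul_coeff_derivative_diffeoPoly a (card_partition_le_univ hπ)]

theorem aeval_inversePoly_apply (a : ℕ → ℝ) {φ : SubsetAlgebra ι} (hφ : φ ∅ = 0)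
    (U : Finset ι) :
    (aeval φ (inversePoly a (Fintype.card ι))) U = ∑ π ∈ partitions U,
      b a π.card * ∏ B ∈ π, φ B := by
  rw [aeval_apply hφ]
  refine Finset.sum_congr rfl fun π hπ => ?_
  rw [factorial_mul_coeff_inversePoly a (card_partition_le_univ hπ)]

theorem aeval_derivative_inversePoly_apply (a : ℕ → ℝ) {φ : SubsetAlgebra ι} (hφ : φ ∅ = 0)
    (U : Finset ι) :
    (aeval φ (derivative (inversePoly a (Fintype.card ι)))) U = ∑ π ∈ partitions U,
      b a (π.card + 1) * ∏ B ∈ π, φ B := by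
  rw [aeval_apply hφ]
  refine Finset.sum_congr rfl fun π hπ => ?_
  rw [factorial_mul_coeff_derivative_inversePoly a (card_partition_le_univ hπ)]

/-- The variational derivative `F'(φ) K F(φ)` of the free action in the transformed variables. -/
theorem mul_aeval_derivative_diffeoPoly_apply (a : ℕ → ℝ) (x : Finset ι → ℝ) {φ Kρ : SubsetAlgebra ι}
    (hφ : φ ∅ = 0)
    (hK : ∀ U, Kρ U = x U * (aeval φ (diffeoPoly a (Fintype.card ι))) U) (U : Finset ι) :
    (Kρ * aeval φ (derivative (diffeoPoly a (Fintype.card ι)))) U =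
      ∑ π ∈ partitions U, diffeoVertex a x π * ∏ B ∈ π, φ B := by
  have h := sum_partitions_powerset U (fun Z Z' => (if Z = ∅ then 0 else
    ((Z.card.factorial : ℝ) * a (Z.card - 1)) * ((Z'.card + 1).factorial * a Z'.card) *
      x (Z.biUnion id)) * ((∏ B ∈ Z, φ B) * ∏ B ∈ Z', φ B))
  rw [mul_apply]
  have hr : ∀ W, Kρ W * (aeval φ (derivative (diffeoPoly a (Fintype.card ι)))) (U \ W) =
      ∑ Z ∈ partitions W, ∑ Z' ∈ partitions (U \ W), (if Z = ∅ then 0 else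
    ((Z.card.factorial : ℝ) * a (Z.card - 1)) * ((Z'.card + 1).factorial * a Z'.card) *
      x (Z.biUnion id)) * ((∏ B ∈ Z, φ B) * ∏ B ∈ Z', φ B) := by
    intro W
    rw [hK, aeval_diffeoPoly_apply a hφ, aeval_derivative_diffeoPoly_apply a hφ, mul_assoc, Finset.sum_mul_sum, Finset.mul_sum]
    simp_rw [Finset.mul_sum]
    refine Finset.sum_congr rfl fun Z hZ => Finset.sum_congr rfl fun Z' _ => ?_
    rw [(mem_partitions.mp hZ).2.2]
    by_cases h0 : Z = ∅
    · rw [if_pos h0, if_pos h0]; ring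
    · rw [if_neg h0, if_neg h0]; ring
  rw [Finset.sum_congr rfl fun W _ => hr W, ← h]
  refine Finset.sum_congr rfl fun π _ => ?_
  rw [diffeoVertex, Finset.sum_mul]
  refine Finset.sum_congr rfl fun Z hZ => ?_
  rw [Finset.mem_powerset] at hZ
  rw [mul_comm (∏ B ∈ Z, φ B), Finset.prod_sdiff hZ]

/-- The source term `G'(ρ) J` for a source `J` on one-element sets. -/
theorem source_mul_aeval_apply (a : ℕ → ℝ) (x : Finset ι → ℝ) {ρ J : SubsetAlgebra ι}
    (hρ : ρ ∅ = 0) {U : Finset ι} (hρ1 : ∀ i ∈ U, ρ {i} = 1)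
    (hJ : ∀ W, J W = if W.card = 1 then x W else 0) :
    (J * aeval ρ (derivative (inversePoly a (Fintype.card ι)))) U =
      ∑ π ∈ partitions U, b a π.card * legSum x π * ∏ B ∈ π, ρ B := by
  have h := sum_partitions_block U (fun W Z => (if W.card = 1 then x W else 0) *
    (b a (Z.card + 1) * ∏ B ∈ Z, ρ B))
  have hr : ∀ W, J W * (aeval ρ (derivative (inversePoly a (Fintype.card ι)))) (U \ W) =
      ∑ Z ∈ partitions (U \ W), (if W.card = 1 then x W else 0) *
        (b a (Z.card + 1) * ∏ B ∈ Z, ρ B) := by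
    intro W
    rw [hJ, aeval_derivative_inversePoly_apply a hρ, Finset.mul_sum]
  rw [mul_apply, ← Finset.sum_erase (a := ∅) U.powerset (by rw [hJ]; simp),
    Finset.sum_congr rfl fun W _ => hr W, ← h]
  refine Finset.sum_congr rfl fun π hπ => ?_
  rw [legSum, Finset.mul_sum, Finset.sum_mul]
  refine Finset.sum_congr rfl fun B hB => ?_
  by_cases h1 : B.card = 1
  · obtain ⟨i, rfl⟩ := Finset.card_eq_one.mp h1
    have hi : i ∈ U := subset_of_mem_partitions hπ hB (Finset.mem_singleton_self i)
    -- Restoring the singleton block leaves the product unchanged, because ρ is 1 on it, and makes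
    -- the index of b the full number of blocks.
    rw [if_pos h1, ← Finset.mul_prod_erase π ρ hB, hρ1 i hi, Finset.card_erase_add_one hB]
    ring
  · rw [if_neg h1]; ring

end SubsetAlgebra

open SubsetAlgebra in
/-- The tree recursion of the transformed theory, with propagator `-1 / x`, gives the same
amplitude as the tree recursion with the vertices `b_k` that carry the off-shell variable of one
of their legs, with propagator `1 / x`. -/
theorem amplitude_eq_of_currents (a : ℕ → ℝ) (ha : a 0 = 1) (x : Finset ι → ℝ) (I : Finset ι)
    (hI : 2 ≤ I.card) (hx : ∀ U ⊂ I, 2 ≤ U.card → x U ≠ 0) (φ ψ : Finset ι → ℝ)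
    (hφ1 : ∀ i, φ {i} = 1) (hψ1 : ∀ i, ψ {i} = 1)
    (hφ : ∀ U ⊂ I, 2 ≤ U.card → x U * φ U =
      -∑ π ∈ partitions U with 2 ≤ π.card, diffeoVertex a x π * ∏ B ∈ π, φ B)
    (hψ : ∀ U ⊂ I, 2 ≤ U.card → x U * ψ U =
      ∑ π ∈ partitions U with 2 ≤ π.card, b a π.card * legSum x π * ∏ B ∈ π, ψ B) :
    -∑ π ∈ partitions I with 2 ≤ π.card, diffeoVertex a x π * ∏ B ∈ π, φ B =
      ∑ π ∈ partitions I with 2 ≤ π.card, b a π.card * (legSum x π + x I) * ∏ B ∈ π, ψ B := by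
  classical
  set N := Fintype.card ι with hN
  have hIne : I.Nonempty := Finset.card_pos.mp (by omega)
  have hsing : ∀ i ∈ I, ({i} : Finset ι) ⊂ I := fun i hi =>
    (Finset.singleton_subset_iff.mpr hi).ssubset_of_ne (by rintro rfl; simp at hI)
  -- The current is cut off at I, where no propagator is available. Then T below vanishes on proper
  -- subsets of I with at least two elements, while T I is minus the amplitude.
  obtain ⟨Φ, hΦ⟩ : ∃ Φ : SubsetAlgebra ι, ∀ U, Φ U = if U ≠ ∅ ∧ U ⊂ I then φ U else 0 :=
    ⟨⟨fun U => if U ≠ ∅ ∧ U ⊂ I then φ U else 0⟩, fun _ => rfl⟩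
  have hΦ0 : Φ ∅ = 0 := by rw [hΦ]; simp
  have hΦI : Φ I = 0 := by rw [hΦ]; simp
  have hΦφ : ∀ U, U.Nonempty → U ⊂ I → Φ U = φ U := fun U h1 h2 => by
    rw [hΦ, if_pos ⟨h1.ne_empty, h2⟩]
  have hnil : Φ ^ (N + 1) = 0 := pow_eq_zero_of_card_lt hΦ0 (Nat.lt_succ_self _)
  set ρ : SubsetAlgebra ι := aeval Φ (diffeoPoly a N) with hρ
  set ρ' : SubsetAlgebra ι := aeval Φ (derivative (diffeoPoly a N)) with hρ'
  set γ : SubsetAlgebra ι := aeval ρ (derivative (inversePoly a N)) with hγ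
  have hρ0 : ρ ∅ = 0 := by
    rw [hρ, aeval_diffeoPoly_apply a hΦ0, partitions_empty, Finset.sum_singleton, if_pos rfl,
      zero_mul]
  have hGF : aeval ρ (inversePoly a N) = Φ := aeval_inversePoly a ha hnil
  -- The chain rule G'(F(φ))·F'(φ) = 1, exact because Φ is nilpotent.
  have hγρ' : γ * ρ' = 1 := aeval_derivative_inversePoly a ha hnil
  have hγ0 : γ ∅ = 1 := by
    rw [hγ, aeval_derivative_inversePoly_apply a hρ0, partitions_empty, Finset.sum_singleton,
      Finset.card_empty, zero_add, b_one, one_mul]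
    rfl
  have hρ1 : ∀ i ∈ I, ρ {i} = 1 := by
    intro i hi
    rw [hρ, aeval_diffeoPoly_apply a hΦ0, sum_partitions_eq_add (Finset.singleton_nonempty i),
      Finset.sum_eq_zero]
    · simp only [Finset.singleton_ne_empty, if_false, Finset.card_singleton, Nat.sub_self, ha]
      rw [Finset.prod_singleton, hΦφ _ (Finset.singleton_nonempty i) (hsing i hi), hφ1]
      simp
    · intro π hπ
      rw [Finset.mem_filter] at hπ
      have := card_partition_le hπ.1
      rw [Finset.card_singleton] at this
      omega
  obtain ⟨Kρ, hK⟩ : ∃ Kρ : SubsetAlgebra ι, ∀ U, Kρ U = x U * ρ U := ⟨⟨fun U => x U * ρ U⟩, fun _ => rfl⟩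
  set T : SubsetAlgebra ι := Kρ * ρ' with hT
  have hTapp : ∀ U, T U = ∑ π ∈ partitions U, diffeoVertex a x π * ∏ B ∈ π, Φ B :=
    mul_aeval_derivative_diffeoPoly_apply a x hΦ0 hK
  have hprod : ∀ U ⊆ I, ∀ π ∈ partitions U, 2 ≤ π.card → ∏ B ∈ π, Φ B = ∏ B ∈ π, φ B := by
    intro U hU π hπ h2
    exact Finset.prod_congr rfl fun B hB => hΦφ B (nonempty_of_mem_partitions hπ hB)
      ((ssubset_of_mem_partitions hπ h2 hB).trans_subset hU)
  have hvert1 : ∀ U : Finset ι, diffeoVertex a x {U} = x U := by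
    intro U
    rw [diffeoVertex, show ({U} : Finset (Finset ι)).powerset = {∅, {U}} from rfl,
      Finset.sum_pair (Finset.singleton_ne_empty U).symm]
    simp [ha]
  have hTsplit : ∀ U ⊆ I, U.Nonempty → T U = x U * Φ U +
      ∑ π ∈ partitions U with 2 ≤ π.card, diffeoVertex a x π * ∏ B ∈ π, φ B := by
    intro U hU hne
    rw [hTapp, sum_partitions_eq_add hne, hvert1, Finset.prod_singleton]
    congr 1
    refine Finset.sum_congr rfl fun π hπ => ?_
    rw [Finset.mem_filter] at hπ
    rw [hprod U hU π hπ.1 hπ.2]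
  have hT0 : T ∅ = 0 := by
    rw [hTapp, partitions_empty, Finset.sum_singleton]
    simp [diffeoVertex]
  have hT1 : ∀ i ∈ I, T {i} = x {i} := by
    intro i hi
    rw [hTsplit _ (hsing i hi).subset (Finset.singleton_nonempty i), Finset.sum_eq_zero, add_zero,
      hΦφ _ (Finset.singleton_nonempty i) (hsing i hi), hφ1, mul_one]
    intro π hπ
    rw [Finset.mem_filter] at hπ
    have := card_partition_le hπ.1
    rw [Finset.card_singleton] at this
    omega
  have hT2 : ∀ U ⊂ I, 2 ≤ U.card → T U = 0 := by
    intro U hU h2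
    have hne : U.Nonempty := Finset.card_pos.mp (by omega)
    rw [hTsplit U hU.subset hne, hΦφ U hne hU, hφ U hU h2, neg_add_cancel]
  obtain ⟨J, hJ⟩ : ∃ J : SubsetAlgebra ι, ∀ W, J W = if W.card = 1 then x W else 0 :=
    ⟨⟨fun W => if W.card = 1 then x W else 0⟩, fun _ => rfl⟩
  -- The field equation: below I the variational derivative of the action equals the one-leg source.
  have hTJ : ∀ U ⊂ I, T U = J U := by
    intro U hU
    rw [hJ]
    rcases Nat.lt_trichotomy U.card 1 with h | h | h
    · have : U = ∅ := Finset.card_eq_zero.mp (by omega)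
      rw [this, hT0]; simp
    · obtain ⟨i, rfl⟩ := Finset.card_eq_one.mp h
      rw [if_pos h, hT1 i (Finset.singleton_subset_iff.mp hU.subset)]
    · rw [if_neg (by omega), hT2 U hU h]
  -- Cancelling F'(φ) turns the equation into Kρ = T·G'(ρ), with only the free operator K acting on
  -- ρ.
  have hKT : Kρ = T * γ := by
    rw [hT, mul_assoc, mul_comm ρ' γ, hγρ', mul_one]
  have hsrc : ∀ U ⊆ I, (J * γ) U = ∑ π ∈ partitions U, b a π.card * legSum x π * ∏ B ∈ π, ρ B :=
    fun U hU => source_mul_aeval_apply a x hρ0 (fun i hi => hρ1 i (hU hi)) hJ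
  have hρrec : ∀ U ⊂ I, x U * ρ U =
      ∑ π ∈ partitions U, b a π.card * legSum x π * ∏ B ∈ π, ρ B := by
    intro U hU
    rw [← hK, ← hsrc U hU.subset, hKT, mul_apply, mul_apply]
    refine Finset.sum_congr rfl fun W hW => ?_
    rw [hTJ W ((Finset.mem_powerset.mp hW).trans_ssubset hU)]
  -- At I the factors T and J differ only in the term of the full subset, which contributes T I
  -- because γ ∅ = 1.
  have hρI : x I * ρ I =
      ∑ π ∈ partitions I, b a π.card * legSum x π * ∏ B ∈ π, ρ B + T I := by
    have hJI : J I = 0 := by rw [hJ, if_neg (by omega)]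
    rw [← hK, ← hsrc I subset_rfl, hKT, mul_apply, mul_apply,
      ← Finset.add_sum_erase _ _ (Finset.mem_powerset_self I),
      ← Finset.add_sum_erase I.powerset (fun W => J W * γ (I \ W)) (Finset.mem_powerset_self I)]
    rw [Finset.sdiff_self, hγ0, hJI, zero_mul, zero_add, mul_one, add_comm]
    congr 1
    refine Finset.sum_congr rfl fun W hW => ?_
    rw [Finset.mem_erase, Finset.mem_powerset] at hW
    rw [hTJ W (hW.2.ssubset_of_ne hW.1)]
  have hdrop : ∀ U : Finset ι, 2 ≤ U.card →
      ∑ π ∈ partitions U, b a π.card * legSum x π * ∏ B ∈ π, ρ B =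
      ∑ π ∈ partitions U with 2 ≤ π.card, b a π.card * legSum x π * ∏ B ∈ π, ρ B := by
    intro U h2
    rw [sum_partitions_eq_add (Finset.card_pos.mp (by omega)), legSum_singleton x h2, mul_zero,
      zero_mul, zero_add]
  -- ρ and ψ satisfy the same recursion below I, and it is uniquely solvable since x U ≠ 0.
  have hρψ : ∀ k, ∀ U ⊂ I, U.Nonempty → U.card = k → ρ U = ψ U := by
    intro k
    induction k using Nat.strong_induction_on with
    | _ k ih =>
      intro U hU hne hk
      rcases Nat.lt_or_ge U.card 2 with h | h
      · have := hne.card_pos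
        obtain ⟨i, rfl⟩ := Finset.card_eq_one.mp (show U.card = 1 by omega)
        rw [hρ1 i (Finset.singleton_subset_iff.mp hU.subset), hψ1]
      · apply mul_left_cancel₀ (hx U hU h)
        rw [hρrec U hU, hdrop U h, hψ U hU h]
        refine Finset.sum_congr rfl fun π hπ => ?_
        rw [Finset.mem_filter] at hπ
        congr 1
        refine Finset.prod_congr rfl fun B hB => ?_
        have hBU := ssubset_of_mem_partitions hπ.1 hπ.2 hB
        exact ih B.card (hk ▸ Finset.card_lt_card hBU) B (hBU.trans hU)
          (nonempty_of_mem_partitions hπ.1 hB) rfl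
  have hprodψ : ∀ π ∈ partitions I, 2 ≤ π.card → ∏ B ∈ π, ρ B = ∏ B ∈ π, ψ B :=
    fun π hπ h2 => Finset.prod_congr rfl fun B hB =>
      hρψ _ B (ssubset_of_mem_partitions hπ h2 hB) (nonempty_of_mem_partitions hπ hB) rfl
  -- Evaluate G(ρ) = Φ at I, where Φ was cut off to zero. Multiplied by x I, this gives the term of
  -- the root leg.
  have hρI' : ρ I = -∑ π ∈ partitions I with 2 ≤ π.card, b a π.card * ∏ B ∈ π, ψ B := by
    have h := aeval_inversePoly_apply a hρ0 I
    rw [← hN, hGF, hΦI, sum_partitions_eq_add hIne, Finset.card_singleton, b_one, one_mul,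
      Finset.prod_singleton] at h
    rw [eq_neg_iff_add_eq_zero, h]
    congr 1
    refine Finset.sum_congr rfl fun π hπ => ?_
    rw [Finset.mem_filter] at hπ
    rw [hprodψ π hπ.1 hπ.2]
  have hTI := hTsplit I subset_rfl hIne
  rw [hΦI, mul_zero, zero_add] at hTI
  have hsum : ∑ π ∈ partitions I with 2 ≤ π.card, b a π.card * legSum x π * ∏ B ∈ π, ρ B =
      ∑ π ∈ partitions I with 2 ≤ π.card, b a π.card * legSum x π * ∏ B ∈ π, ψ B := by
    refine Finset.sum_congr rfl fun π hπ => ?_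
    rw [Finset.mem_filter] at hπ
    rw [hprodψ π hπ.1 hπ.2]
  rw [hdrop I hI, hsum, hρI'] at hρI
  rw [← hTI]
  have hfin : ∑ π ∈ partitions I with 2 ≤ π.card, b a π.card * (legSum x π + x I) * ∏ B ∈ π, ψ B =
      ∑ π ∈ partitions I with 2 ≤ π.card, b a π.card * legSum x π * ∏ B ∈ π, ψ B +
      x I * ∑ π ∈ partitions I with 2 ≤ π.card, b a π.card * ∏ B ∈ π, ψ B := by
    rw [Finset.mul_sum, ← Finset.sum_add_distrib]
    exact Finset.sum_congr rfl fun π _ => by ring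
  rw [hfin]
  linarith

end Currents

end FieldDiffeo

namespace FieldDiffeo

/-! ### Laminar families and their recursion -/

section Hierarchies

variable {ι : Type*}

/-- A hierarchy on `U`: a laminar family of subsets of `U` with at least two elements, one of
which is `U`. -/
structure IsHierarchy (U : Finset ι) (R : Finset (Finset ι)) : Prop where
  top_mem : U ∈ R
  subset_top : ∀ D ∈ R, D ⊆ U
  two_le_card : ∀ D ∈ R, 2 ≤ D.card
  laminar : ∀ D ∈ R, ∀ E ∈ R, D ⊆ E ∨ E ⊆ D ∨ Disjoint D E

section

variable [Fintype ι]

open Classical in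
/-- The hierarchies on `U`; for sets with fewer than two elements, only the empty family. -/
noncomputable def hierarchies (U : Finset ι) : Finset (Finset (Finset ι)) :=
  if 2 ≤ U.card then Finset.univ.filter (IsHierarchy U) else {∅}

theorem mem_hierarchies {U : Finset ι} (hU : 2 ≤ U.card) {R : Finset (Finset ι)} :
    R ∈ hierarchies U ↔ IsHierarchy U R := by
  simp [hierarchies, hU]

theorem hierarchies_of_card_lt {U : Finset ι} (hU : U.card < 2) :
    hierarchies U = {∅} := by
  simp [hierarchies, hU]

theorem subset_of_mem_hierarchies {U D : Finset ι} {R : Finset (Finset ι)}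
    (hR : R ∈ hierarchies U) (hD : D ∈ R) : 2 ≤ U.card ∧ IsHierarchy U R := by
  by_cases hU : 2 ≤ U.card
  · exact ⟨hU, (mem_hierarchies hU).mp hR⟩
  · rw [hierarchies_of_card_lt (by omega), Finset.mem_singleton] at hR
    subst hR; simp at hD

end

variable [DecidableEq ι]

/-- The members of `R` and the one-element sets strictly inside `U`. -/
def subBlocks (R : Finset (Finset ι)) (U : Finset ι) : Finset (Finset ι) :=
  (R ∪ U.image fun i => {i}).filter (· ⊂ U)

/-- The maximal members of `R` and one-element sets strictly inside `U`. -/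
def blocks (R : Finset (Finset ι)) (U : Finset ι) : Finset (Finset ι) :=
  (subBlocks R U).filter fun B => ∀ C ∈ subBlocks R U, ¬ B ⊂ C

theorem mem_subBlocks {R : Finset (Finset ι)} {U B : Finset ι} :
    B ∈ subBlocks R U ↔ (B ∈ R ∨ ∃ i ∈ U, {i} = B) ∧ B ⊂ U := by
  simp [subBlocks]

theorem mem_blocks {R : Finset (Finset ι)} {U B : Finset ι} :
    B ∈ blocks R U ↔ B ∈ subBlocks R U ∧ ∀ C ∈ subBlocks R U, ¬ B ⊂ C := by
  simp [blocks]

theorem blocks_congr {R R' : Finset (Finset ι)} {U : Finset ι}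
    (h : ∀ C, C ⊂ U → (C ∈ R ↔ C ∈ R')) : blocks R U = blocks R' U := by
  have : subBlocks R U = subBlocks R' U := by
    ext C
    rw [mem_subBlocks, mem_subBlocks]
    constructor <;> rintro ⟨h1, h2⟩ <;> refine ⟨?_, h2⟩
    · rwa [← h C h2]
    · rwa [h C h2]
  rw [blocks, blocks, this]

theorem exists_block_of_mem_subBlocks {R : Finset (Finset ι)} {U C : Finset ι}
    (hC : C ∈ subBlocks R U) : ∃ B ∈ blocks R U, C ⊆ B := by
  obtain ⟨B, hCB, hB⟩ := Finset.exists_le_maximal _ hC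
  exact ⟨B, mem_blocks.mpr ⟨hB.1, fun D hD hBD => hBD.2 (hB.2 hD hBD.1)⟩, hCB⟩

theorem singleton_mem_subBlocks {R : Finset (Finset ι)} {U : Finset ι} (hU : 2 ≤ U.card) {i : ι}
    (hi : i ∈ U) : {i} ∈ subBlocks R U := by
  refine mem_subBlocks.mpr ⟨Or.inr ⟨i, hi, rfl⟩,
    (Finset.singleton_subset_iff.mpr hi).ssubset_of_ne ?_⟩
  rintro rfl
  simp at hU

theorem IsHierarchy.disjoint_of_mem_blocks {R : Finset (Finset ι)} {U : Finset ι}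
    (hlam : ∀ D ∈ R, ∀ E ∈ R, D ⊆ E ∨ E ⊆ D ∨ Disjoint D E) {B C : Finset ι}
    (hB : B ∈ blocks R U) (hC : C ∈ blocks R U) (hne : B ≠ C) : Disjoint B C := by
  rw [mem_blocks] at hB hC
  have h1 : ¬ B ⊆ C := fun h => hB.2 C hC.1 (h.ssubset_of_ne hne)
  have h2 : ¬ C ⊆ B := fun h => hC.2 B hB.1 (h.ssubset_of_ne hne.symm)
  rcases (mem_subBlocks.mp hB.1).1 with hBR | ⟨i, -, rfl⟩
  · rcases (mem_subBlocks.mp hC.1).1 with hCR | ⟨i, -, rfl⟩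
    · rcases hlam B hBR C hCR with h | h | h
      · exact absurd h h1
      · exact absurd h h2
      · exact h
    · rw [Finset.disjoint_singleton_right]
      exact fun h => h2 (Finset.singleton_subset_iff.mpr h)
  · rw [Finset.disjoint_singleton_left]
    exact fun h => h1 (Finset.singleton_subset_iff.mpr h)

theorem IsHierarchy.subBlocks_nonempty {R : Finset (Finset ι)} {U V B : Finset ι}
    (hR : IsHierarchy V R) (hB : B ∈ subBlocks R U) : B.Nonempty := by
  rcases (mem_subBlocks.mp hB).1 with h | ⟨i, -, rfl⟩
  · exact Finset.card_pos.mp (by have := hR.two_le_card B h; omega)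
  · exact Finset.singleton_nonempty i

theorem IsHierarchy.blocks_mem_partitions {R : Finset (Finset ι)} {U V : Finset ι}
    (hR : IsHierarchy V R) (hU : 2 ≤ U.card) : blocks R U ∈ partitions U := by
  rw [mem_partitions]
  refine ⟨?_, fun B hB C hC hne => disjoint_of_mem_blocks hR.laminar hB hC hne, ?_⟩
  · intro h
    have := hR.subBlocks_nonempty (mem_blocks.mp h).1
    simp at this
  · apply subset_antisymm
    · rw [Finset.biUnion_subset]
      exact fun B hB => (mem_subBlocks.mp (mem_blocks.mp hB).1).2.subset
    · intro i hi
      obtain ⟨B, hB, hiB⟩ := exists_block_of_mem_subBlocks (singleton_mem_subBlocks (R := R) hU hi)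
      exact Finset.mem_biUnion.mpr ⟨B, hB, hiB (Finset.mem_singleton_self i)⟩

theorem IsHierarchy.two_le_card_blocks {R : Finset (Finset ι)} {U V : Finset ι}
    (hR : IsHierarchy V R) (hU : 2 ≤ U.card) : 2 ≤ (blocks R U).card := by
  have h := hR.blocks_mem_partitions hU
  have h0 := card_partition_pos (Finset.card_pos.mp (by omega)) h
  by_contra hlt
  have h1 := card_partition_eq_one h (by omega)
  have : U ∈ blocks R U := by rw [h1]; exact Finset.mem_singleton_self U
  exact (mem_subBlocks.mp (mem_blocks.mp this).1).2.ne rfl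

theorem eq_of_subset_blocks {π : Finset (Finset ι)} {W B C D : Finset ι} (hπ : π ∈ partitions W) (hB : B ∈ π) (hC : C ∈ π)
    (hD : D.Nonempty) (hDB : D ⊆ B) (hDC : D ⊆ C) : B = C := by
  by_contra hne
  obtain ⟨i, hi⟩ := hD
  exact Finset.disjoint_left.mp ((mem_partitions.mp hπ).2.1 B hB C hC hne) (hDB hi) (hDC hi)

variable [Fintype ι]

theorem IsHierarchy.restrict {R : Finset (Finset ι)} {U B : Finset ι} (hR : IsHierarchy U R)
    (hB : B ∈ blocks R U) : R.filter (· ⊆ B) ∈ hierarchies B := by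
  by_cases h2 : 2 ≤ B.card
  · rw [mem_hierarchies h2]
    have hBR : B ∈ R := by
      rcases (mem_subBlocks.mp (mem_blocks.mp hB).1).1 with h | ⟨i, -, rfl⟩
      · exact h
      · simp at h2
    exact ⟨by simp [hBR], fun D hD => (Finset.mem_filter.mp hD).2,
      fun D hD => hR.two_le_card D (Finset.mem_filter.mp hD).1,
      fun D hD E hE => hR.laminar D (Finset.mem_filter.mp hD).1 E (Finset.mem_filter.mp hE).1⟩
  · rw [hierarchies_of_card_lt (by omega), Finset.mem_singleton, Finset.filter_eq_empty_iff]
    intro D hD hDB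
    have := hR.two_le_card D hD
    have := Finset.card_le_card hDB
    omega

/-- The sum over the hierarchies on `U` of a product of weights of the members, each of which depends
on the partition into maximal smaller members. -/
noncomputable def hierarchySum (c : Finset ι → Finset (Finset ι) → ℝ) (U : Finset ι) : ℝ :=
  ∑ R ∈ hierarchies U, ∏ D ∈ R, c D (blocks R D)

theorem hierarchySum_singleton (c : Finset ι → Finset (Finset ι) → ℝ) (i : ι) :
    hierarchySum c {i} = 1 := by
  rw [hierarchySum, hierarchies_of_card_lt (by simp)]
  simp

section Graft

variable {U : Finset ι} {π : Finset (Finset ι)} {p : Finset ι → Finset (Finset ι)}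

/-- Throughout this section p chooses a hierarchy on each block of π and is empty elsewhere;
grafting takes their union and adds the top set U. -/
theorem mem_graft {D : Finset ι}
    (hp : ∀ B, p B ∈ if B ∈ π then hierarchies B else {∅}) :
    D ∈ insert U (Finset.univ.biUnion p) ↔ D = U ∨ ∃ B ∈ π, D ∈ p B := by
  rw [Finset.mem_insert, Finset.mem_biUnion]
  refine or_congr_right ⟨?_, ?_⟩
  · rintro ⟨B, -, hD⟩
    refine ⟨B, ?_, hD⟩
    by_contra hB
    have := hp B
    rw [if_neg hB, Finset.mem_singleton] at this
    rw [this] at hD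
    simp at hD
  · rintro ⟨B, -, hD⟩
    exact ⟨B, Finset.mem_univ _, hD⟩

theorem isHierarchy_of_mem_graft (hp : ∀ B, p B ∈ if B ∈ π then hierarchies B else {∅})
    {B D : Finset ι} (hB : B ∈ π) (hD : D ∈ p B) : IsHierarchy B (p B) := by
  have := hp B
  rw [if_pos hB] at this
  exact (subset_of_mem_hierarchies this hD).2

theorem isHierarchy_graft (hU : 2 ≤ U.card) (hπ : π ∈ partitions U)
    (hp : ∀ B, p B ∈ if B ∈ π then hierarchies B else {∅}) :
    IsHierarchy U (insert U (Finset.univ.biUnion p)) := by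
  have hsub : ∀ D ∈ insert U (Finset.univ.biUnion p), D ⊆ U := by
    intro D hD
    rcases (mem_graft hp).mp hD with rfl | ⟨B, hB, hDB⟩
    · exact subset_rfl
    · exact ((isHierarchy_of_mem_graft hp hB hDB).subset_top D hDB).trans
        (subset_of_mem_partitions hπ hB)
  refine ⟨Finset.mem_insert_self _ _, hsub, ?_, ?_⟩
  · intro D hD
    rcases (mem_graft hp).mp hD with rfl | ⟨B, hB, hDB⟩
    · exact hU
    · exact (isHierarchy_of_mem_graft hp hB hDB).two_le_card D hDB
  · intro D hD E hE
    rcases (mem_graft hp).mp hD with rfl | ⟨B, hB, hDB⟩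
    · exact Or.inr (Or.inl (hsub E hE))
    rcases (mem_graft hp).mp hE with rfl | ⟨C, hC, hEC⟩
    · exact Or.inl (hsub D hD)
    by_cases h : B = C
    · subst h
      exact (isHierarchy_of_mem_graft hp hB hDB).laminar D hDB E hEC
    · exact Or.inr (Or.inr (Finset.disjoint_of_subset_left
        ((isHierarchy_of_mem_graft hp hB hDB).subset_top D hDB)
        (Finset.disjoint_of_subset_right ((isHierarchy_of_mem_graft hp hC hEC).subset_top E hEC)
          ((mem_partitions.mp hπ).2.1 B hB C hC h))))

theorem blocks_graft (hU : 2 ≤ U.card) (hπ : π ∈ partitions U) (h2 : 2 ≤ π.card)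
    (hp : ∀ B, p B ∈ if B ∈ π then hierarchies B else {∅}) :
    blocks (insert U (Finset.univ.biUnion p)) U = π := by
  have hH := isHierarchy_graft hU hπ hp
  have hsub : ∀ B ∈ π, B ∈ subBlocks (insert U (Finset.univ.biUnion p)) U := by
    intro B hB
    have hBU := ssubset_of_mem_partitions hπ h2 hB
    by_cases hB2 : 2 ≤ B.card
    · refine mem_subBlocks.mpr ⟨Or.inl ((mem_graft hp).mpr (Or.inr ⟨B, hB, ?_⟩)), hBU⟩
      have := hp B
      rw [if_pos hB, mem_hierarchies hB2] at this
      exact this.top_mem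
    · have := (nonempty_of_mem_partitions hπ hB).card_pos
      obtain ⟨i, rfl⟩ := Finset.card_eq_one.mp (show B.card = 1 by omega)
      exact singleton_mem_subBlocks hU (Finset.singleton_subset_iff.mp hBU.subset)
  have hcov : ∀ C ∈ subBlocks (insert U (Finset.univ.biUnion p)) U, ∃ B ∈ π, C ⊆ B := by
    intro C hC
    obtain ⟨h, hCU⟩ := mem_subBlocks.mp hC
    rcases h with h | ⟨i, hi, rfl⟩
    · rcases (mem_graft hp).mp h with rfl | ⟨B, hB, hCB⟩
      · exact absurd rfl hCU.ne
      · exact ⟨B, hB, (isHierarchy_of_mem_graft hp hB hCB).subset_top C hCB⟩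
    · rw [← (mem_partitions.mp hπ).2.2, Finset.mem_biUnion] at hi
      obtain ⟨B, hB, hi⟩ := hi
      exact ⟨B, hB, Finset.singleton_subset_iff.mpr hi⟩
  ext B
  rw [mem_blocks]
  constructor
  · rintro ⟨h1, hmax⟩
    obtain ⟨C, hC, hBC⟩ := hcov B h1
    by_cases h : B = C
    · exact h ▸ hC
    · exact absurd (hBC.ssubset_of_ne h) (hmax C (hsub C hC))
  · intro hB
    refine ⟨hsub B hB, fun C hC hBC => ?_⟩
    obtain ⟨B', hB', hCB'⟩ := hcov C hC
    have := eq_of_subset_blocks hπ hB hB' (nonempty_of_mem_partitions hπ hB) subset_rfl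
      (hBC.subset.trans hCB')
    subst this
    exact hBC.2 hCB'

theorem filter_graft (hπ : π ∈ partitions U) (h2 : 2 ≤ π.card)
    (hp : ∀ B, p B ∈ if B ∈ π then hierarchies B else {∅}) {B : Finset ι} (hB : B ∈ π) :
    (insert U (Finset.univ.biUnion p)).filter (· ⊆ B) = p B := by
  ext D
  rw [Finset.mem_filter, mem_graft hp]
  constructor
  · rintro ⟨rfl | ⟨C, hC, hD⟩, hDB⟩
    · exact absurd hDB (ssubset_of_mem_partitions hπ h2 hB).2
    · have hH := isHierarchy_of_mem_graft hp hC hD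
      have hne : D.Nonempty := Finset.card_pos.mp (by have := hH.two_le_card D hD; omega)
      rw [eq_of_subset_blocks hπ hB hC hne hDB (hH.subset_top D hD)]
      exact hD
  · intro hD
    exact ⟨Or.inr ⟨B, hB, hD⟩, (isHierarchy_of_mem_graft hp hB hD).subset_top D hD⟩

theorem prod_graft (c : Finset ι → Finset (Finset ι) → ℝ) (hU : 2 ≤ U.card)
    (hπ : π ∈ partitions U) (h2 : 2 ≤ π.card)
    (hp : ∀ B, p B ∈ if B ∈ π then hierarchies B else {∅}) :
    ∏ D ∈ insert U (Finset.univ.biUnion p), c D (blocks (insert U (Finset.univ.biUnion p)) D) =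
      c U π * ∏ B, ∏ D ∈ p B, c D (blocks (p B) D) := by
  have hmemπ : ∀ B D, D ∈ p B → B ∈ π := by
    intro B D hD
    by_contra hB
    have := hp B
    rw [if_neg hB, Finset.mem_singleton] at this
    rw [this] at hD
    simp at hD
  have hnot : U ∉ Finset.univ.biUnion p := by
    intro h
    obtain ⟨B, -, hD⟩ := Finset.mem_biUnion.mp h
    have hH := isHierarchy_of_mem_graft hp (hmemπ B U hD) hD
    exact (ssubset_of_mem_partitions hπ h2 (hmemπ B U hD)).2 (hH.subset_top U hD)
  have hdisj : ∀ B C, B ≠ C → Disjoint (p B) (p C) := by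
    intro B C hne
    rw [Finset.disjoint_left]
    intro D hD hD'
    have hH := isHierarchy_of_mem_graft hp (hmemπ B D hD) hD
    have hH' := isHierarchy_of_mem_graft hp (hmemπ C D hD') hD'
    have hne' : D.Nonempty := Finset.card_pos.mp (by have := hH.two_le_card D hD; omega)
    exact hne (eq_of_subset_blocks hπ (hmemπ B D hD) (hmemπ C D hD') hne' (hH.subset_top D hD)
      (hH'.subset_top D hD'))
  have hblocks : ∀ B, ∀ D ∈ p B,
      blocks (insert U (Finset.univ.biUnion p)) D = blocks (p B) D := by
    intro B D hD
    apply blocks_congr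
    intro C hC
    have hDB := (isHierarchy_of_mem_graft hp (hmemπ B D hD) hD).subset_top D hD
    have hf := congrArg (C ∈ ·) (filter_graft hπ h2 hp (hmemπ B D hD))
    simp only [Finset.mem_filter] at hf
    rw [← hf, and_iff_left (hC.subset.trans hDB)]
  rw [Finset.prod_insert hnot, blocks_graft hU hπ h2 hp,
    Finset.prod_biUnion fun B _ C _ hne => hdisj B C hne]
  exact congrArg _ (Finset.prod_congr rfl fun B _ => Finset.prod_congr rfl fun D hD => by
    rw [hblocks B D hD])

end Graft

/-- The tree recursion: a hierarchy on `U` consists of a partition of `U` and hierarchies on its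
blocks. -/
theorem hierarchySum_eq (c : Finset ι → Finset (Finset ι) → ℝ) {U : Finset ι} (hU : 2 ≤ U.card) :
    hierarchySum c U =
      ∑ π ∈ partitions U with 2 ≤ π.card, c U π * ∏ B ∈ π, hierarchySum c B := by
  -- The choices are functions on all finite sets, forced to be ∅ outside π, so that their type does
  -- not depend on π.
  have hprod : ∀ π : Finset (Finset ι), ∏ B ∈ π, hierarchySum c B =
      ∑ p ∈ Fintype.piFinset fun B : Finset ι => if B ∈ π then hierarchies B else {∅},
        ∏ B, ∏ D ∈ p B, c D (blocks (p B) D) := by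
    intro π
    rw [← Finset.prod_univ_sum (fun B : Finset ι => if B ∈ π then hierarchies B else {∅})
      (fun B R => ∏ D ∈ R, c D (blocks R D)), ← Finset.prod_subset (Finset.subset_univ π)]
    · exact Finset.prod_congr rfl fun B hB => by rw [if_pos hB, hierarchySum]
    · intro B _ hB
      rw [if_neg hB]; simp
  simp_rw [hprod, Finset.mul_sum]
  rw [Finset.sum_sigma', hierarchySum]
  symm
  refine Finset.sum_bij' (fun q _ => insert U (Finset.univ.biUnion q.2))
    (fun R _ => ⟨blocks R U, fun B => if B ∈ blocks R U then R.filter (· ⊆ B) else ∅⟩)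
    ?_ ?_ ?_ ?_ ?_
  · rintro ⟨π, p⟩ h
    simp only [Finset.mem_sigma, Finset.mem_filter, Fintype.mem_piFinset] at h
    exact (mem_hierarchies hU).mpr (isHierarchy_graft hU h.1.1 h.2)
  · intro R hR
    rw [mem_hierarchies hU] at hR
    simp only [Finset.mem_sigma, Finset.mem_filter, Fintype.mem_piFinset]
    refine ⟨⟨hR.blocks_mem_partitions hU, hR.two_le_card_blocks hU⟩, fun B => ?_⟩
    by_cases hB : B ∈ blocks R U
    · rw [if_pos hB, if_pos hB]; exact hR.restrict hB
    · rw [if_neg hB, if_neg hB]; exact Finset.mem_singleton_self _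
  · rintro ⟨π, p⟩ h
    simp only [Finset.mem_sigma, Finset.mem_filter, Fintype.mem_piFinset] at h
    simp only [blocks_graft hU h.1.1 h.1.2 h.2, Sigma.mk.injEq, heq_eq_eq, true_and]
    funext B
    by_cases hB : B ∈ π
    · rw [if_pos hB, filter_graft h.1.1 h.1.2 h.2 hB]
    · have := h.2 B
      rw [if_neg hB, Finset.mem_singleton] at this
      rw [if_neg hB, this]
  · intro R hR
    rw [mem_hierarchies hU] at hR
    ext D
    simp only [Finset.mem_insert, Finset.mem_biUnion, Finset.mem_univ, true_and]
    constructor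
    · rintro (rfl | ⟨B, hD⟩)
      · exact hR.top_mem
      · by_cases hB : B ∈ blocks R U
        · rw [if_pos hB] at hD; exact (Finset.mem_filter.mp hD).1
        · rw [if_neg hB] at hD; simp at hD
    · intro hD
      by_cases hDU : D = U
      · exact Or.inl hDU
      · obtain ⟨B, hB, hDB⟩ := exists_block_of_mem_subBlocks
          (mem_subBlocks.mpr ⟨Or.inl hD, (hR.subset_top D hD).ssubset_of_ne hDU⟩)
        refine Or.inr ⟨B, ?_⟩
        rw [if_pos hB, Finset.mem_filter]
        exact ⟨hD, hDB⟩
  · rintro ⟨π, p⟩ h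
    simp only [Finset.mem_sigma, Finset.mem_filter, Fintype.mem_piFinset] at h
    exact (prod_graft c hU h.1.1 h.1.2 h.2).symm

end Hierarchies

end FieldDiffeo

namespace FieldDiffeo

/-! ### The Feynman rules as coefficients of F'(φ) K F(φ) -/

section Vertex

/-- Average the sum with its reflection j ↦ K − j. -/
theorem two_mul_sum_range_mul_of_symm {K : ℕ} {w : ℕ → ℝ} (hw : ∀ j ≤ K, w (K - j) = w j) :
    2 * ∑ j ∈ Finset.range (K + 1), (j : ℝ) * w j = K * ∑ j ∈ Finset.range (K + 1), w j := by
  have h := Finset.sum_flip (n := K) fun j => (j : ℝ) * w j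
  rw [two_mul]
  nth_rewrite 1 [← h]
  rw [← Finset.sum_add_distrib, Finset.mul_sum]
  refine Finset.sum_congr rfl fun j hj => ?_
  have hj' : j ≤ K := by simpa [Nat.lt_succ_iff] using hj
  rw [hw j hj', Nat.cast_sub hj']
  ring

variable {κ : Type*}

theorem mink_sum (p : κ → Momentum) (Z : Finset κ) :
    mink (∑ B ∈ Z, p B) = ∑ B ∈ Z, ∑ C ∈ Z,
      (p B 0 * p C 0 - p B 1 * p C 1 - p B 2 * p C 2 - p B 3 * p C 3) := by
  simp only [mink, Finset.sum_apply, Finset.sum_sub_distrib, sq, Finset.sum_mul_sum]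

variable [DecidableEq κ]

theorem sum_powerset_superset_apply_card (s T : Finset κ) (hT : T ⊆ s) (f : ℕ → ℝ) :
    ∑ Z ∈ s.powerset with T ⊆ Z, f Z.card =
      ∑ j ∈ Finset.range (s.card - T.card + 1), ((s.card - T.card).choose j : ℝ) *
        f (j + T.card) := by
  have h := Finset.sum_powerset_apply_card (fun j => f (j + T.card)) (x := s \ T)
  rw [Finset.card_sdiff_of_subset hT] at h
  simp only [nsmul_eq_mul] at h
  rw [← h]
  refine Finset.sum_bij' (fun Z _ => Z \ T) (fun Z _ => Z ∪ T) ?_ ?_ ?_ ?_ ?_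
  · intro Z hZ
    simp only [Finset.mem_filter, Finset.mem_powerset] at hZ ⊢
    exact Finset.sdiff_subset_sdiff hZ.1 subset_rfl
  · intro Z hZ
    simp only [Finset.mem_filter, Finset.mem_powerset] at hZ ⊢
    exact ⟨Finset.union_subset (hZ.trans Finset.sdiff_subset) hT, Finset.subset_union_right⟩
  · intro Z hZ
    simp only [Finset.mem_filter, Finset.mem_powerset] at hZ
    exact Finset.sdiff_union_of_subset hZ.2
  · intro Z hZ
    rw [Finset.mem_powerset] at hZ
    have : Disjoint Z T := Finset.disjoint_of_subset_left hZ Finset.sdiff_disjoint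
    exact Finset.union_sdiff_cancel_right this
  · intro Z hZ
    simp only [Finset.mem_filter, Finset.mem_powerset] at hZ
    rw [Finset.card_sdiff_of_subset hZ.2, Nat.sub_add_cancel (Finset.card_le_card hZ.2)]

/-- After exchanging sums, a pair (B, C) is weighted by the sets Z containing both. Diagonal and
off-diagonal pairs are separated because {B, C} has one or two elements. -/
theorem sum_powerset_quadratic (s : Finset κ) (f : ℕ → ℝ) (d : κ → κ → ℝ) :
    ∑ Z ∈ s.powerset, f Z.card * ∑ B ∈ Z, ∑ C ∈ Z, d B C =
      (∑ j ∈ Finset.range (s.card - 1 + 1), ((s.card - 1).choose j : ℝ) * f (j + 1)) *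
          ∑ B ∈ s, d B B +
        (∑ j ∈ Finset.range (s.card - 2 + 1), ((s.card - 2).choose j : ℝ) * f (j + 2)) *
          (∑ B ∈ s, ∑ C ∈ s, d B C - ∑ B ∈ s, d B B) := by
  have h1 : ∀ Z ∈ s.powerset, f Z.card * ∑ B ∈ Z, ∑ C ∈ Z, d B C =
      ∑ B ∈ s, ∑ C ∈ s, if {B, C} ⊆ Z then f Z.card * d B C else 0 := by
    intro Z hZ
    rw [Finset.mem_powerset] at hZ
    rw [Finset.mul_sum, ← Finset.sum_subset hZ]
    · refine Finset.sum_congr rfl fun B hB => ?_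
      rw [Finset.mul_sum, ← Finset.sum_subset hZ]
      · refine Finset.sum_congr rfl fun C hC => ?_
        rw [if_pos (by simp [Finset.insert_subset_iff, hB, hC])]
      · intro C _ hC
        rw [if_neg (by simp [Finset.insert_subset_iff, hC])]
    · intro B _ hB
      exact Finset.sum_eq_zero fun C _ => by rw [if_neg (by simp [Finset.insert_subset_iff, hB])]
  rw [Finset.sum_congr rfl h1, Finset.sum_comm]
  have h2 : ∀ B ∈ s, ∑ Z ∈ s.powerset, ∑ C ∈ s, (if {B, C} ⊆ Z then f Z.card * d B C else 0) =
      (∑ j ∈ Finset.range (s.card - 1 + 1), ((s.card - 1).choose j : ℝ) * f (j + 1)) * d B B +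
      (∑ j ∈ Finset.range (s.card - 2 + 1), ((s.card - 2).choose j : ℝ) * f (j + 2)) *
        (∑ C ∈ s, d B C - d B B) := by
    intro B hB
    rw [Finset.sum_comm, ← Finset.add_sum_erase s _ hB, ← Finset.add_sum_erase s (d B) hB,
      add_sub_cancel_left, Finset.mul_sum]
    congr 1
    · rw [← Finset.sum_filter, ← Finset.sum_mul,
        sum_powerset_superset_apply_card s {B, B} (by simpa using hB)]
      simp
    · refine Finset.sum_congr rfl fun C hC => ?_
      rw [Finset.mem_erase] at hC
      rw [← Finset.sum_filter, ← Finset.sum_mul, sum_powerset_superset_apply_card s {B, C}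
        (by simp [Finset.insert_subset_iff, hB, hC.2]), Finset.card_pair (Ne.symm hC.1)]
  rw [Finset.sum_congr rfl h2, Finset.sum_add_distrib, ← Finset.mul_sum, ← Finset.mul_sum,
    Finset.sum_sub_distrib]

theorem choose_mul_factorials {n j : ℕ} (hj : j ≤ n) :
    (n.choose j : ℝ) * (j.factorial : ℝ) * ((n - j).factorial : ℝ) = (n.factorial : ℝ) := by
  exact_mod_cast Nat.choose_mul_factorial_mul_factorial hj

/-- The coefficient with which a composite line occurs in a vertex of the transformed theory. -/
noncomputable def splitCoeff (a : ℕ → ℝ) (k l : ℕ) : ℝ :=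
  if l = 0 then 0 else ((l.factorial : ℝ) * a (l - 1)) * (((k - l + 1).factorial : ℝ) * a (k - l))

theorem sum_choose_splitCoeff_one (a : ℕ → ℝ) (K : ℕ) :
    ∑ j ∈ Finset.range (K + 1), (K.choose j : ℝ) * splitCoeff a (K + 1) (j + 1) = dCoeff a K := by
  rw [dCoeff, Finset.mul_sum]
  refine Finset.sum_congr rfl fun j hj => ?_
  have hj' : j ≤ K := by simpa [Nat.lt_succ_iff] using hj
  rw [splitCoeff, if_neg (by omega), Nat.add_sub_cancel, show K + 1 - (j + 1) = K - j by omega,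
    ← choose_mul_factorials hj', Nat.factorial_succ, Nat.factorial_succ]
  push_cast
  ring

/-- The coefficient of the cross terms is half that of the squares found in
`sum_choose_splitCoeff_one`, by the symmetry j ↔ K + 1 − j. The quadratic part of the vertex
therefore collapses to (d/2)(Σ p_B² + (Σ p_B)²), symmetric in all lines including the distinguished
one. -/
theorem sum_choose_splitCoeff_two (a : ℕ → ℝ) (K : ℕ) :
    ∑ j ∈ Finset.range (K + 1), (K.choose j : ℝ) * splitCoeff a (K + 2) (j + 2) =
      dCoeff a (K + 1) / 2 := by
  have hs := two_mul_sum_range_mul_of_symm (K := K + 1)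
    (w := fun j => ((j : ℝ) + 1) * (((K + 1 - j : ℕ) : ℝ) + 1) * a j * a (K + 1 - j)) (by
      intro j hj
      rw [Nat.sub_sub_self hj]; ring)
  rw [dCoeff, eq_div_iff two_ne_zero, Nat.factorial_succ, Nat.cast_mul, mul_comm ((K + 1 : ℕ) : ℝ),
    mul_assoc, ← hs, Finset.sum_range_succ' _ (K + 1), Nat.cast_zero, zero_mul, add_zero, mul_comm _ (2 : ℝ),
    mul_left_comm, Finset.mul_sum _ _ (K.factorial : ℝ)]
  congr 1
  refine Finset.sum_congr rfl fun j hj => ?_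
  have hj' : j ≤ K := by simpa [Nat.lt_succ_iff] using hj
  rw [splitCoeff, if_neg (by omega), show K + 2 - (j + 2) = K - j by omega,
    show K + 1 - (j + 1) = K - j by omega, show j + 2 - 1 = j + 1 by omega,
    ← choose_mul_factorials hj', Nat.factorial_succ, Nat.factorial_succ, Nat.factorial_succ]
  push_cast
  ring

theorem sum_choose_splitCoeff_zero (a : ℕ → ℝ) (m : ℝ) (K : ℕ) :
    -m ^ 2 * ∑ j ∈ Finset.range (K + 2), ((K + 1).choose j : ℝ) * splitCoeff a (K + 1) j =
      cCoeff a m K := by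
  have hs := two_mul_sum_range_mul_of_symm (K := K) (w := fun j => a j * a (K - j)) (by
      intro j hj
      rw [Nat.sub_sub_self hj]; ring)
  have h1 : ∑ j ∈ Finset.range (K + 2), ((K + 1).choose j : ℝ) * splitCoeff a (K + 1) j =
      ((K + 1).factorial : ℝ) * (((K : ℝ) + 1) * ∑ j ∈ Finset.range (K + 1), a j * a (K - j) -
        ∑ j ∈ Finset.range (K + 1), (j : ℝ) * (a j * a (K - j))) := by
    rw [Finset.sum_range_succ', splitCoeff, if_pos rfl, mul_zero, add_zero, Finset.mul_sum,
      ← Finset.sum_sub_distrib, Finset.mul_sum]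
    refine Finset.sum_congr rfl fun j hj => ?_
    have hj' : j ≤ K := by simpa [Nat.lt_succ_iff] using hj
    rw [splitCoeff, if_neg (by omega), Nat.add_sub_cancel,
      ← choose_mul_factorials (show j + 1 ≤ K + 1 by omega), show K + 1 - (j + 1) = K - j by omega,
      Nat.factorial_succ (K - j)]
    push_cast
    rw [Nat.cast_sub hj']
    ring
  rw [h1, cCoeff, Nat.factorial_succ (K + 1)]
  push_cast
  linear_combination (m ^ 2 * ((K + 1).factorial : ℝ) / 2) * hs

/-- The Feynman rule of a vertex is a sum over the ways to gather the lines other than one chosen line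
into two groups, with the off-shell variable of the first group. -/
theorem vertex_eq_sum_powerset (a : ℕ → ℝ) (m : ℝ) (s : Finset κ) (hs : 2 ≤ s.card)
    (p : κ → Momentum) :
    dCoeff a (s.card - 1) / 2 * (∑ B ∈ s, mink (p B) + mink (∑ B ∈ s, p B)) +
        cCoeff a m (s.card - 1) =
      ∑ Z ∈ s.powerset, if Z = ∅ then 0 else
        ((Z.card.factorial : ℝ) * a (Z.card - 1)) *
          (((s \ Z).card + 1).factorial * a (s \ Z).card) * offShellVar m (∑ B ∈ Z, p B) := by
  obtain ⟨K, hK⟩ : ∃ K, s.card = K + 2 := ⟨s.card - 2, by omega⟩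
  have hr : ∀ Z ∈ s.powerset, (if Z = ∅ then 0 else
        ((Z.card.factorial : ℝ) * a (Z.card - 1)) *
          (((s \ Z).card + 1).factorial * a (s \ Z).card) * offShellVar m (∑ B ∈ Z, p B)) =
      splitCoeff a (K + 2) Z.card * ∑ B ∈ Z, ∑ C ∈ Z,
        (p B 0 * p C 0 - p B 1 * p C 1 - p B 2 * p C 2 - p B 3 * p C 3) +
      -m ^ 2 * splitCoeff a (K + 2) Z.card := by
    intro Z hZ
    rw [Finset.mem_powerset] at hZ
    by_cases h0 : Z = ∅
    · simp [h0, splitCoeff]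
    · rw [if_neg h0, ← mink_sum, splitCoeff, if_neg (by simpa using h0),
        Finset.card_sdiff_of_subset hZ, hK, offShellVar]
      ring
  rw [Finset.sum_congr rfl hr, Finset.sum_add_distrib, sum_powerset_quadratic, ← Finset.mul_sum,
    Finset.sum_powerset_apply_card (fun l => splitCoeff a (K + 2) l), hK]
  simp only [nsmul_eq_mul]
  have e1 : ∑ B ∈ s, (p B 0 * p B 0 - p B 1 * p B 1 - p B 2 * p B 2 - p B 3 * p B 3) =
      ∑ B ∈ s, mink (p B) := Finset.sum_congr rfl fun B _ => by simp only [mink, sq]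
  rw [show K + 2 - 1 = K + 1 by omega, show K + 2 - 2 = K by omega,
    sum_choose_splitCoeff_one a (K + 1), sum_choose_splitCoeff_two,
    sum_choose_splitCoeff_zero a m (K + 1), e1, ← mink_sum]
  ring

end Vertex

end FieldDiffeo

namespace FieldDiffeo

/-! ### Rooted trees through parent maps -/

section RootedTrees

variable {V : Type*}

/-- `par` maps every vertex of the graph `G` other than the root to its parent, and `depth` is the
distance from the root. -/
structure IsParentMap (G : SimpleGraph V) (root : V) (par : V → V) (depth : V → ℕ) : Prop where
  adj_iff : ∀ u w, G.Adj u w ↔ (u ≠ root ∧ par u = w) ∨ (w ≠ root ∧ par w = u)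
  depth_par : ∀ u, u ≠ root → depth (par u) + 1 = depth u
  par_root : par root = root

/-- `x` is `u` or a descendant of `u`. -/
def IsBelow (par : V → V) (x u : V) : Prop := ∃ k, par^[k] x = u

theorem IsBelow.refl (par : V → V) (x : V) : IsBelow par x x := ⟨0, rfl⟩

theorem IsBelow.of_par {par : V → V} {x u : V} (h : IsBelow par (par x) u) : IsBelow par x u := by
  obtain ⟨k, hk⟩ := h
  exact ⟨k + 1, hk⟩

theorem IsBelow.par_of_ne {par : V → V} {x u : V} (h : IsBelow par x u) (hne : x ≠ u) :
    IsBelow par (par x) u := by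
  obtain ⟨k, hk⟩ := h
  rcases k with _ | k
  · exact absurd hk hne
  · exact ⟨k, hk⟩

theorem IsBelow.trans {par : V → V} {x u w : V} (h : IsBelow par x u) (h' : IsBelow par u w) :
    IsBelow par x w := by
  obtain ⟨k, rfl⟩ := h
  obtain ⟨l, rfl⟩ := h'
  exact ⟨l + k, Function.iterate_add_apply par l k x⟩

theorem IsBelow.total {par : V → V} {x u w : V} (h : IsBelow par x u) (h' : IsBelow par x w) :
    IsBelow par u w ∨ IsBelow par w u := by
  obtain ⟨k, rfl⟩ := h
  obtain ⟨l, rfl⟩ := h'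
  rcases le_total k l with h | h
  · left; exact ⟨l - k, by rw [← Function.iterate_add_apply, Nat.sub_add_cancel h]⟩
  · right; exact ⟨k - l, by rw [← Function.iterate_add_apply, Nat.sub_add_cancel h]⟩

/-- The parent of u is the penultimate vertex of a shortest path from the root. Adjacent vertices
differ in depth by one, and acyclicity makes the neighbour nearer to the root unique. -/
theorem exists_isParentMap {G : SimpleGraph V} (hG : G.IsTree) (root : V) :
    ∃ par depth, IsParentMap G root par depth := by
  classical
  choose p hp hlen using fun u => hG.connected.exists_path_of_dist root u
  have hpar : ∀ u w, G.Adj u w → G.dist root u = G.dist root w + 1 → w = (p u).penultimate := by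
    intro u w hadj hd
    have hu : u ∉ (p w).support := by
      intro h
      have h1 := SimpleGraph.dist_le ((p w).takeUntil u h)
      have h2 := (p w).length_takeUntil_le_length h
      have := hlen w
      omega
    exact hG.isAcyclic.eq_penultimate_of_adj_end (hp u) hadj
      (hG.isAcyclic.mem_support_of_ne_mem_support_of_adj_of_isPath (hp u) (hp w) hadj hu)
  have hnil : ∀ u, u ≠ root → ¬ (p u).Nil := fun u hu h => hu h.eq.symm
  have hadj : ∀ u, u ≠ root → G.Adj (p u).penultimate u := fun u hu =>
    (p u).adj_penultimate (hnil u hu)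
  have hdist : ∀ u, u ≠ root → G.dist root (p u).penultimate + 1 = G.dist root u := by
    intro u hu
    have h1 := SimpleGraph.dist_le (p u).dropLast
    have h2 : (p u).dropLast.length + 1 = (p u).length :=
      (p u).length_dropLast_add_one (hnil u hu)
    have h3 := hlen u
    rcases hG.dist_eq_dist_add_one_of_adj root (hadj u hu) with h | h <;> omega
  refine ⟨fun u => if u = root then root else (p u).penultimate, G.dist root, ?_, ?_, ?_⟩
  · intro u w
    constructor
    · intro h
      rcases hG.dist_eq_dist_add_one_of_adj root h with hd | hd
      · have hu : u ≠ root := by rintro rfl; simp at hd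
        left; exact ⟨hu, by rw [if_neg hu]; exact (hpar u w h hd).symm⟩
      · have hw : w ≠ root := by rintro rfl; simp at hd
        right; exact ⟨hw, by rw [if_neg hw]; exact (hpar w u h.symm hd).symm⟩
    · rintro (⟨hu, rfl⟩ | ⟨hw, rfl⟩)
      · rw [if_neg hu]; exact (hadj u hu).symm
      · rw [if_neg hw]; exact hadj w hw
  · intro u hu
    simp only [if_neg hu]
    exact hdist u hu
  · simp

namespace IsParentMap

variable {G : SimpleGraph V} {root : V} {par : V → V} {depth : V → ℕ}

theorem isBelow_root (h : IsParentMap G root par depth) (x : V) : IsBelow par x root := by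
  induction hd : depth x using Nat.strong_induction_on generalizing x with
  | _ d ih =>
    by_cases hx : x = root
    · rw [hx]; exact IsBelow.refl par root
    · exact (ih (depth (par x)) (by have := h.depth_par x hx; omega) _ rfl).of_par

theorem eq_of_root_isBelow (h : IsParentMap G root par depth) {u : V} (hu : IsBelow par root u) :
    u = root := by
  obtain ⟨k, rfl⟩ := hu
  induction k with
  | zero => rfl
  | succ k ih => rw [Function.iterate_succ_apply, h.par_root, ih]

theorem depth_lt (h : IsParentMap G root par depth) {x u : V} (hxu : IsBelow par x u)
    (hne : x ≠ u) : depth u < depth x := by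
  induction hd : depth x using Nat.strong_induction_on generalizing x with
  | _ d ih =>
    have hx : x ≠ root := by
      rintro rfl; exact hne (h.eq_of_root_isBelow hxu).symm
    have h1 := h.depth_par x hx
    by_cases hp : par x = u
    · rw [hp] at h1; omega
    · have := ih (depth (par x)) (by omega) (hxu.par_of_ne hne) hp rfl
      omega

theorem antisymm (h : IsParentMap G root par depth) {x u : V} (hxu : IsBelow par x u)
    (hux : IsBelow par u x) : x = u := by
  by_contra hne
  have h1 := h.depth_lt hxu hne
  have h2 := h.depth_lt hux (Ne.symm hne)
  omega

theorem par_ne (h : IsParentMap G root par depth) {u : V} (hu : u ≠ root) : par u ≠ u := by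
  intro he
  have := h.depth_par u hu
  rw [he] at this
  omega

theorem not_isBelow_par (h : IsParentMap G root par depth) {u : V} (hu : u ≠ root) :
    ¬ IsBelow par (par u) u := by
  intro hb
  exact h.par_ne hu (h.antisymm hb ⟨1, rfl⟩)

/-- The parent is the smallest vertex strictly above. -/
theorem par_isBelow (h : IsParentMap G root par depth) {u w : V} (hu : u ≠ w)
    (huw : IsBelow par u w) : u ≠ root ∧ IsBelow par (par u) w :=
  ⟨by rintro rfl; exact hu (h.eq_of_root_isBelow huw).symm, huw.par_of_ne hu⟩

theorem adj_par (h : IsParentMap G root par depth) {u : V} (hu : u ≠ root) : G.Adj u (par u) :=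
  (h.adj_iff u (par u)).mpr (Or.inl ⟨hu, rfl⟩)

theorem edge_eq_iff (h : IsParentMap G root par depth) {u x : V} (hu : u ≠ root)
    (hx : x ≠ root) : s(x, par x) = s(u, par u) ↔ x = u := by
  constructor
  · intro he
    rcases Sym2.eq_iff.mp he with ⟨h1, -⟩ | ⟨h1, h2⟩
    · exact h1
    · have d1 := h.depth_par x hx
      have d2 := h.depth_par u hu
      rw [h2] at d1; rw [← h1] at d2
      omega
  · rintro rfl; rfl

theorem delete_adj_par (h : IsParentMap G root par depth) {u x : V} (hu : u ≠ root) (hx : x ≠ root)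
    (hxu : x ≠ u) : (G.deleteEdges {s(u, par u)}).Adj x (par x) := by
  rw [SimpleGraph.deleteEdges_adj]
  refine ⟨h.adj_par hx, ?_⟩
  rw [Set.mem_singleton_iff, h.edge_eq_iff hu hx]
  exact hxu

theorem reachable_of_isBelow (h : IsParentMap G root par depth) {u x : V} (hu : u ≠ root)
    (hxu : IsBelow par x u) : (G.deleteEdges {s(u, par u)}).Reachable u x := by
  induction hd : depth x using Nat.strong_induction_on generalizing x with
  | _ d ih =>
    by_cases hne : x = u
    · rw [hne]
    · obtain ⟨hx, hb⟩ := h.par_isBelow hne hxu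
      have := ih (depth (par x)) (by have := h.depth_par x hx; omega) hb rfl
      exact this.trans (h.delete_adj_par hu hx hne).symm.reachable

theorem reachable_root_of_not_isBelow (h : IsParentMap G root par depth) {u x : V} (hu : u ≠ root)
    (hxu : ¬ IsBelow par x u) : (G.deleteEdges {s(u, par u)}).Reachable root x := by
  induction hd : depth x using Nat.strong_induction_on generalizing x with
  | _ d ih =>
    by_cases hx : x = root
    · rw [hx]
    · have hne : x ≠ u := by rintro rfl; exact hxu (IsBelow.refl par x)
      have := ih (depth (par x)) (by have := h.depth_par x hx; omega)
        (fun hb => hxu hb.of_par) rfl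
      exact this.trans (h.delete_adj_par hu hx hne).symm.reachable

theorem isBelow_iff_of_delete_adj (h : IsParentMap G root par depth) {u x y : V} (hu : u ≠ root)
    (hxy : (G.deleteEdges {s(u, par u)}).Adj x y) : IsBelow par x u ↔ IsBelow par y u := by
  rw [SimpleGraph.deleteEdges_adj, Set.mem_singleton_iff] at hxy
  have key : ∀ z, z ≠ root → s(z, par z) ≠ s(u, par u) →
      (IsBelow par z u ↔ IsBelow par (par z) u) := by
    intro z hz hzu
    exact ⟨fun hb => hb.par_of_ne (fun he => hzu ((h.edge_eq_iff hu hz).mpr he)), fun hb => hb.of_par⟩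
  rcases (h.adj_iff x y).mp hxy.1 with ⟨hx, rfl⟩ | ⟨hy, rfl⟩
  · exact key x hx hxy.2
  · exact (key y hy (by rw [Sym2.eq_swap]; exact hxy.2)).symm

theorem isBelow_iff_of_reachable (h : IsParentMap G root par depth) {u x y : V} (hu : u ≠ root)
    (hxy : (G.deleteEdges {s(u, par u)}).Reachable x y) : IsBelow par x u ↔ IsBelow par y u := by
  obtain ⟨p⟩ := hxy
  induction p with
  | nil => rfl
  | cons hadj _ ih => exact (h.isBelow_iff_of_delete_adj hu hadj).trans ih

/-- Cutting the line above u separates exactly the descendants of u: every other parent line has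
both ends on the same side. -/
theorem reachable_iff (h : IsParentMap G root par depth) {u x : V} (hu : u ≠ root) :
    (G.deleteEdges {s(u, par u)}).Reachable u x ↔ IsBelow par x u :=
  ⟨fun hr => (h.isBelow_iff_of_reachable hu hr).mp (IsBelow.refl par u), h.reachable_of_isBelow hu⟩

theorem reachable_par_iff (h : IsParentMap G root par depth) {u x : V} (hu : u ≠ root) :
    (G.deleteEdges {s(u, par u)}).Reachable (par u) x ↔ ¬ IsBelow par x u :=
  ⟨fun hr hb => h.not_isBelow_par hu ((h.isBelow_iff_of_reachable hu hr).mpr hb),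
    fun hb => (h.reachable_root_of_not_isBelow hu (h.not_isBelow_par hu)).symm.trans
      (h.reachable_root_of_not_isBelow hu hb)⟩

theorem isTree (h : IsParentMap G root par depth) : G.IsTree := by
  have hreach : ∀ x, G.Reachable root x := by
    intro x
    induction hd : depth x using Nat.strong_induction_on generalizing x with
    | _ d ih =>
      by_cases hx : x = root
      · rw [hx]
      · exact (ih (depth (par x)) (by have := h.depth_par x hx; omega) _ rfl).trans
          (h.adj_par hx).symm.reachable
  have : Nonempty V := ⟨root⟩
  refine ⟨⟨fun x y => (hreach x).symm.trans (hreach y)⟩, ?_⟩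
  rw [SimpleGraph.isAcyclic_iff_forall_adj_isBridge]
  have key : ∀ u, u ≠ root → G.IsBridge s(u, par u) := by
    intro u hu
    rw [SimpleGraph.isBridge_iff, h.reachable_iff hu]
    exact h.not_isBelow_par hu
  intro u w huw
  rcases (h.adj_iff u w).mp huw with ⟨hu, rfl⟩ | ⟨hw, rfl⟩
  · exact key u hu
  · rw [Sym2.eq_swap]; exact key w hw

/-- By induction on depth: if the second map reversed the edge between u and its parent, it would
disagree with the first map at that parent, where they already agree. -/
theorem unique (h : IsParentMap G root par depth) {par' : V → V} {depth' : V → ℕ}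
    (h' : IsParentMap G root par' depth') : par' = par := by
  funext u
  induction hd : depth u using Nat.strong_induction_on generalizing u with
  | _ d ih =>
    by_cases hu : u = root
    · rw [hu, h.par_root, h'.par_root]
    · rcases (h'.adj_iff u (par u)).mp (h.adj_par hu) with ⟨-, he⟩ | ⟨hne, he⟩
      · exact he
      · have d1 := h.depth_par u hu
        have d2 := h.depth_par _ hne
        rw [← ih (depth (par u)) (by omega) (par u) rfl, he] at d2
        omega

end IsParentMap

end RootedTrees

end FieldDiffeo

namespace FieldDiffeo

/-! ### The sets of legs below the vertices -/

section LegSets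

variable {n : ℕ} {V : Type}

open Classical in
/-- The legs other than the root leg `r` that are attached to `u` or its descendants. -/
noncomputable def legsBelow (par : V → V) (ℓ : Fin n → V) (r : Fin n) (u : V) : Finset (Fin n) :=
  Finset.univ.filter fun i => i ≠ r ∧ IsBelow par (ℓ i) u

open Classical in
/-- The legs other than the root leg `r` that are attached to `u`. -/
noncomputable def properLegs (ℓ : Fin n → V) (r : Fin n) (u : V) : Finset (Fin n) :=
  Finset.univ.filter fun i => i ≠ r ∧ ℓ i = u

theorem mem_legsBelow {par : V → V} {ℓ : Fin n → V} {r : Fin n} {u : V} {i : Fin n} :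
    i ∈ legsBelow par ℓ r u ↔ i ≠ r ∧ IsBelow par (ℓ i) u := by
  simp [legsBelow]

theorem mem_properLegs {ℓ : Fin n → V} {r : Fin n} {u : V} {i : Fin n} :
    i ∈ properLegs ℓ r u ↔ i ≠ r ∧ ℓ i = u := by
  simp [properLegs]

namespace IsParentMap

variable {G : SimpleGraph V} {ℓ : Fin n → V} {r : Fin n} {par : V → V} {depth : V → ℕ}

theorem legsBelow_root (h : IsParentMap G (ℓ r) par depth) :
    legsBelow par ℓ r (ℓ r) = Finset.univ.erase r := by
  ext i
  simp [mem_legsBelow, h.isBelow_root]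

theorem legsBelow_mono {x u : V} (hxu : IsBelow par x u) :
    legsBelow par ℓ r x ⊆ legsBelow par ℓ r u := by
  intro i hi
  rw [mem_legsBelow] at *
  exact ⟨hi.1, hi.2.trans hxu⟩

theorem isBelow_or_of_mem {x u : V} {i : Fin n} (hx : i ∈ legsBelow par ℓ r x)
    (hu : i ∈ legsBelow par ℓ r u) : IsBelow par x u ∨ IsBelow par u x :=
  (mem_legsBelow.mp hx).2.total (mem_legsBelow.mp hu).2

open Classical in
theorem sum_legs {M : Type*} [AddCommMonoid M] (ℓ : Fin n → V) (r : Fin n) (u : V) (f : Fin n → M) :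
    ∑ i ∈ Finset.univ.filter (fun i => ℓ i = u), f i =
      ∑ i ∈ properLegs ℓ r u, f i + if u = ℓ r then f r else 0 := by
  have hset : (Finset.univ.filter fun i => ℓ i = u) =
      properLegs ℓ r u ∪ if u = ℓ r then {r} else ∅ := by
    ext i
    simp only [Finset.mem_filter, Finset.mem_univ, true_and, Finset.mem_union, mem_properLegs]
    by_cases hu : u = ℓ r
    · subst hu
      by_cases hi : i = r <;> simp [hi]
    · by_cases hi : i = r
      · subst hi; simp [hu, Ne.symm hu]
      · simp [hu, hi]
  rw [hset, Finset.sum_union]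
  · split_ifs <;> simp
  · split_ifs with hu
    · rw [Finset.disjoint_singleton_right, mem_properLegs]; simp
    · simp

end IsParentMap

variable [Fintype V]

open Classical in
/-- The children of `u`. -/
noncomputable def children (root : V) (par : V → V) (u : V) : Finset V :=
  Finset.univ.filter fun w => w ≠ root ∧ par w = u

theorem mem_children {root : V} {par : V → V} {u w : V} :
    w ∈ children root par u ↔ w ≠ root ∧ par w = u := by
  simp [children]

namespace IsParentMap

variable {G : SimpleGraph V} {ℓ : Fin n → V} {r : Fin n} {par : V → V} {depth : V → ℕ}

open Classical in
theorem sum_neighbors {M : Type*} [AddCommMonoid M] {root : V} (h : IsParentMap G root par depth)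
    (u : V) (f : V → M) :
    ∑ w ∈ Finset.univ.filter (fun w => G.Adj u w), f w =
      ∑ w ∈ children root par u, f w + if u = root then 0 else f (par u) := by
  have hset : (Finset.univ.filter fun w => G.Adj u w) =
      children root par u ∪ if u = root then ∅ else {par u} := by
    ext w
    simp only [Finset.mem_filter, Finset.mem_univ, true_and, Finset.mem_union, mem_children,
      h.adj_iff]
    by_cases hu : u = root
    · simp [hu]
    · simp [hu, or_comm, eq_comm]
  rw [hset, Finset.sum_union]
  · split_ifs <;> simp
  · split_ifs with hu
    · simp
    · rw [Finset.disjoint_singleton_right, mem_children]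
      rintro ⟨h1, h2⟩
      have d1 := h.depth_par u hu
      have d2 := h.depth_par _ h1
      rw [h2] at d2
      omega

/-- The final 1 is the line to the parent or, at the root vertex, the root leg itself. -/
theorem valence_eq (h : IsParentMap G (ℓ r) par depth) (u : V) :
    valence G ℓ u = (children (ℓ r) par u).card + (properLegs ℓ r u).card + 1 := by
  classical
  rw [valence, internalValence, legsAt, Finset.card_eq_sum_ones, Finset.card_eq_sum_ones,
    h.sum_neighbors, sum_legs ℓ r, ← Finset.card_eq_sum_ones, ← Finset.card_eq_sum_ones]
  split_ifs <;> omega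

theorem exists_child {root : V} (h : IsParentMap G root par depth) {x u : V} (hxu : IsBelow par x u)
    (hne : x ≠ u) : ∃ w ∈ children root par u, IsBelow par x w := by
  obtain ⟨k, hk⟩ := hxu
  induction k generalizing x with
  | zero => exact absurd hk hne
  | succ k ih =>
    rw [Function.iterate_succ_apply] at hk
    by_cases hp : par x = u
    · refine ⟨x, mem_children.mpr ⟨?_, hp⟩, IsBelow.refl par x⟩
      rintro rfl
      rw [h.par_root] at hp
      exact hne hp
    · obtain ⟨w, hw, hb⟩ := ih hp hk
      exact ⟨w, hw, hb.of_par⟩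

theorem isBelow_of_mem_children {root u w : V} (hw : w ∈ children root par u) : IsBelow par w u :=
  ⟨1, (mem_children.mp hw).2⟩

theorem ne_of_mem_children {root : V} (h : IsParentMap G root par depth) {u w : V}
    (hw : w ∈ children root par u) : w ≠ u := by
  rw [mem_children] at hw
  rintro rfl
  exact h.par_ne hw.1 hw.2

theorem legsBelow_eq (h : IsParentMap G (ℓ r) par depth) (u : V) :
    legsBelow par ℓ r u = properLegs ℓ r u ∪ (children (ℓ r) par u).biUnion (legsBelow par ℓ r) := by
  ext i
  rw [Finset.mem_union, Finset.mem_biUnion]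
  constructor
  · intro hi
    rw [mem_legsBelow] at hi
    by_cases hu : ℓ i = u
    · exact Or.inl (mem_properLegs.mpr ⟨hi.1, hu⟩)
    · obtain ⟨w, hw, hb⟩ := h.exists_child hi.2 hu
      exact Or.inr ⟨w, hw, mem_legsBelow.mpr ⟨hi.1, hb⟩⟩
  · rintro (hi | ⟨w, hw, hi⟩)
    · rw [mem_properLegs] at hi
      exact mem_legsBelow.mpr ⟨hi.1, 0, hi.2⟩
    · exact legsBelow_mono (isBelow_of_mem_children hw) hi

theorem disjoint_children (h : IsParentMap G (ℓ r) par depth) {u w w' : V}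
    (hw : w ∈ children (ℓ r) par u) (hw' : w' ∈ children (ℓ r) par u) (hne : w ≠ w') :
    Disjoint (legsBelow par ℓ r w) (legsBelow par ℓ r w') := by
  rw [Finset.disjoint_left]
  have key : ∀ {x y : V}, x ∈ children (ℓ r) par u → y ∈ children (ℓ r) par u → x ≠ y →
      ¬ IsBelow par x y := by
    intro x y hx hy hxy hb
    have := hb.par_of_ne hxy
    rw [(mem_children.mp hx).2] at this
    exact h.ne_of_mem_children hy (h.antisymm (isBelow_of_mem_children hy) this)
  intro i hi hi'
  rcases isBelow_or_of_mem hi hi' with hb | hb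
  · exact key hw hw' hne hb
  · exact key hw' hw (Ne.symm hne) hb

theorem card_legsBelow (h : IsParentMap G (ℓ r) par depth) (u : V) :
    (legsBelow par ℓ r u).card = (properLegs ℓ r u).card +
      ∑ w ∈ children (ℓ r) par u, (legsBelow par ℓ r w).card := by
  rw [h.legsBelow_eq, Finset.card_union_of_disjoint, Finset.card_biUnion]
  · exact fun w hw w' hw' hne => h.disjoint_children hw hw' hne
  · rw [Finset.disjoint_left]
    intro i hi hi'
    rw [Finset.mem_biUnion] at hi'
    obtain ⟨w, hw, hi'⟩ := hi'
    rw [mem_properLegs] at hi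
    rw [mem_legsBelow, hi.2] at hi'
    exact h.ne_of_mem_children hw (h.antisymm (isBelow_of_mem_children hw) hi'.2)

section Stable

variable (h : IsParentMap G (ℓ r) par depth) (hv : ∀ u, 3 ≤ valence G ℓ u)

include h hv

theorem two_le_card_legsBelow (u : V) : 2 ≤ (legsBelow par ℓ r u).card := by
  -- Induction from the leaves towards the root; the measure strictly decreases when passing to a
  -- child.
  induction hd : Finset.univ.sup depth - depth u using Nat.strong_induction_on generalizing u with
  | _ d ih =>
    have h1 : (children (ℓ r) par u).card ≤
        ∑ w ∈ children (ℓ r) par u, (legsBelow par ℓ r w).card := by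
      rw [Finset.card_eq_sum_ones]
      refine Finset.sum_le_sum fun w hw => ?_
      have hw' := mem_children.mp hw
      have hdw := h.depth_par w hw'.1
      rw [hw'.2] at hdw
      have hle : depth w ≤ Finset.univ.sup depth := Finset.le_sup (Finset.mem_univ w)
      exact (ih _ (by omega) w rfl).trans' (by norm_num)
    have h2 := h.card_legsBelow u
    have h3 := hv u
    rw [h.valence_eq u] at h3
    omega

theorem legsBelow_nonempty (u : V) : (legsBelow par ℓ r u).Nonempty :=
  Finset.card_pos.mp (by have := h.two_le_card_legsBelow hv u; omega)

/-- Valence at least three gives u two downward branches, counting legs, so one of them avoids x and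
adds a further leg. -/
theorem card_legsBelow_lt {x u : V} (hxu : IsBelow par x u) (hne : x ≠ u) :
    (legsBelow par ℓ r x).card < (legsBelow par ℓ r u).card := by
  classical
  obtain ⟨w, hw, hxw⟩ := h.exists_child hxu hne
  have h1 := Finset.card_le_card (legsBelow_mono (ℓ := ℓ) (r := r) hxw)
  have h2 := h.card_legsBelow u
  rw [← Finset.add_sum_erase _ _ hw] at h2
  have h3 : ((children (ℓ r) par u).erase w).card ≤
      ∑ w ∈ (children (ℓ r) par u).erase w, (legsBelow par ℓ r w).card := by
    rw [Finset.card_eq_sum_ones]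
    exact Finset.sum_le_sum fun w _ => (h.legsBelow_nonempty hv w).card_pos
  rw [Finset.card_erase_of_mem hw] at h3
  have h4 := hv u
  rw [h.valence_eq u] at h4
  omega

/-- Two vertices with a common leg below them are comparable, and the strict growth of leg sets
decides the order. The tree order is thus recovered from inclusion. -/
theorem isBelow_iff {x u : V} :
    IsBelow par x u ↔ legsBelow par ℓ r x ⊆ legsBelow par ℓ r u := by
  refine ⟨legsBelow_mono, fun hs => ?_⟩
  obtain ⟨i, hi⟩ := h.legsBelow_nonempty hv x
  rcases isBelow_or_of_mem hi (hs hi) with hb | hb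
  · exact hb
  · by_cases hne : u = x
    · rw [hne]; exact IsBelow.refl par x
    · have := h.card_legsBelow_lt hv hb hne
      have := Finset.card_le_card hs
      omega

theorem legsBelow_injective : Function.Injective (legsBelow par ℓ r) := by
  intro x u hxu
  exact h.antisymm ((h.isBelow_iff hv).mpr hxu.subset) ((h.isBelow_iff hv).mpr hxu.symm.subset)

theorem legsBelow_ssubset_iff {x u : V} :
    legsBelow par ℓ r x ⊂ legsBelow par ℓ r u ↔ IsBelow par x u ∧ x ≠ u := by
  rw [Finset.ssubset_iff_subset_ne, h.isBelow_iff hv, (h.legsBelow_injective hv).ne_iff]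

theorem isHierarchy :
    IsHierarchy (Finset.univ.erase r) (Finset.univ.image (legsBelow par ℓ r)) := by
  refine ⟨?_, ?_, ?_, ?_⟩
  · rw [← h.legsBelow_root]
    exact Finset.mem_image_of_mem _ (Finset.mem_univ _)
  · intro D hD
    obtain ⟨u, -, rfl⟩ := Finset.mem_image.mp hD
    rw [← h.legsBelow_root]
    exact legsBelow_mono (h.isBelow_root u)
  · intro D hD
    obtain ⟨u, -, rfl⟩ := Finset.mem_image.mp hD
    exact h.two_le_card_legsBelow hv u
  · intro D hD E hE
    obtain ⟨u, -, rfl⟩ := Finset.mem_image.mp hD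
    obtain ⟨w, -, rfl⟩ := Finset.mem_image.mp hE
    by_cases hdis : Disjoint (legsBelow par ℓ r u) (legsBelow par ℓ r w)
    · exact Or.inr (Or.inr hdis)
    · obtain ⟨i, hi, hi'⟩ := Finset.not_disjoint_iff.mp hdis
      rcases isBelow_or_of_mem hi hi' with hb | hb
      · exact Or.inl (legsBelow_mono hb)
      · exact Or.inr (Or.inl (legsBelow_mono hb))

/-- This matches the local structure: the blocks inside the leg set of u are the lines and legs
leaving u downwards. -/
theorem blocks_legsBelow (u : V) :
    blocks (Finset.univ.image (legsBelow par ℓ r)) (legsBelow par ℓ r u) =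
      (children (ℓ r) par u).image (legsBelow par ℓ r) ∪
        (properLegs ℓ r u).image fun i => {i} := by
  set R := Finset.univ.image (legsBelow par ℓ r) with hR
  have hmem : ∀ w, legsBelow par ℓ r w ∈ R := fun w => Finset.mem_image_of_mem _ (Finset.mem_univ w)
  have hchild : ∀ w ∈ children (ℓ r) par u, legsBelow par ℓ r w ∈ subBlocks R (legsBelow par ℓ r u) :=
    fun w hw => mem_subBlocks.mpr ⟨Or.inl (hmem w), (h.legsBelow_ssubset_iff hv).mpr
      ⟨isBelow_of_mem_children hw, h.ne_of_mem_children hw⟩⟩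
  have hone : ∀ (i : Fin n) w, ¬ legsBelow par ℓ r w ⊂ {i} := by
    intro i w hs
    have h1 := Finset.card_lt_card hs
    rw [Finset.card_singleton] at h1
    have := h.two_le_card_legsBelow hv w
    omega
  ext B
  rw [mem_blocks, Finset.mem_union, Finset.mem_image, Finset.mem_image]
  constructor
  · rintro ⟨hB, hmax⟩
    obtain ⟨h1, hBu⟩ := mem_subBlocks.mp hB
    rcases h1 with h1 | ⟨i, hi, rfl⟩
    · obtain ⟨x, -, rfl⟩ := Finset.mem_image.mp h1
      obtain ⟨hxu, hne⟩ := (h.legsBelow_ssubset_iff hv).mp hBu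
      obtain ⟨w, hw, hxw⟩ := h.exists_child hxu hne
      left
      refine ⟨w, hw, ?_⟩
      by_contra hne'
      exact hmax _ (hchild w hw) ((legsBelow_mono hxw).ssubset_of_ne (Ne.symm hne'))
    · have hi' := mem_legsBelow.mp hi
      by_cases hu : ℓ i = u
      · exact Or.inr ⟨i, mem_properLegs.mpr ⟨hi'.1, hu⟩, rfl⟩
      · obtain ⟨w, hw, hb⟩ := h.exists_child hi'.2 hu
        exfalso
        refine hmax _ (hchild w hw) ((Finset.singleton_subset_iff.mpr
          (mem_legsBelow.mpr ⟨hi'.1, hb⟩)).ssubset_of_ne ?_)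
        intro he
        have := h.two_le_card_legsBelow hv w
        rw [← he, Finset.card_singleton] at this
        omega
  · rintro (⟨w, hw, rfl⟩ | ⟨i, hi, rfl⟩)
    · refine ⟨hchild w hw, fun C hC hwC => ?_⟩
      obtain ⟨h1, hCu⟩ := mem_subBlocks.mp hC
      rcases h1 with h1 | ⟨i, -, rfl⟩
      · obtain ⟨x, -, rfl⟩ := Finset.mem_image.mp h1
        obtain ⟨hwx, hne⟩ := (h.legsBelow_ssubset_iff hv).mp hwC
        obtain ⟨hxu, hne'⟩ := (h.legsBelow_ssubset_iff hv).mp hCu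
        have := hwx.par_of_ne hne
        rw [(mem_children.mp hw).2] at this
        exact hne' (h.antisymm hxu this)
      · exact hone i w hwC
    · rw [mem_properLegs] at hi
      have hiu : i ∈ legsBelow par ℓ r u := mem_legsBelow.mpr ⟨hi.1, 0, hi.2⟩
      refine ⟨singleton_mem_subBlocks (h.two_le_card_legsBelow hv u) hiu, fun C hC hiC => ?_⟩
      obtain ⟨h1, hCu⟩ := mem_subBlocks.mp hC
      rcases h1 with h1 | ⟨k, -, rfl⟩
      · obtain ⟨x, -, rfl⟩ := Finset.mem_image.mp h1
        obtain ⟨hxu, hne'⟩ := (h.legsBelow_ssubset_iff hv).mp hCu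
        have := (mem_legsBelow.mp (Finset.singleton_subset_iff.mp hiC.subset)).2
        rw [hi.2] at this
        exact hne' (h.antisymm hxu this)
      · have := Finset.card_lt_card hiC
        simp at this

theorem disjoint_image_children_legs (u : V) :
    Disjoint ((children (ℓ r) par u).image (legsBelow par ℓ r))
      ((properLegs ℓ r u).image fun i => {i}) := by
  rw [Finset.disjoint_left]
  intro B hB hB'
  obtain ⟨w, -, rfl⟩ := Finset.mem_image.mp hB
  obtain ⟨i, -, hi⟩ := Finset.mem_image.mp hB'
  have := h.two_le_card_legsBelow hv w
  rw [← hi, Finset.card_singleton] at this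
  omega

theorem sum_blocks {M : Type*} [AddCommMonoid M] (u : V) (f : Finset (Fin n) → M) :
    ∑ B ∈ blocks (Finset.univ.image (legsBelow par ℓ r)) (legsBelow par ℓ r u), f B =
      ∑ w ∈ children (ℓ r) par u, f (legsBelow par ℓ r w) + ∑ i ∈ properLegs ℓ r u, f {i} := by
  rw [h.blocks_legsBelow hv, Finset.sum_union (h.disjoint_image_children_legs hv u),
    Finset.sum_image fun x _ y _ hxy => h.legsBelow_injective hv hxy,
    Finset.sum_image fun x _ y _ hxy => Finset.singleton_injective hxy]

theorem card_blocks (u : V) :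
    (blocks (Finset.univ.image (legsBelow par ℓ r)) (legsBelow par ℓ r u)).card + 1 =
      valence G ℓ u := by
  rw [h.valence_eq u, Finset.card_eq_sum_ones, h.sum_blocks hv, ← Finset.card_eq_sum_ones,
    ← Finset.card_eq_sum_ones]

end Stable

end IsParentMap

end LegSets

end FieldDiffeo

namespace FieldDiffeo

/-! ### Trees with legs correspond to labelled hierarchies -/

section Correspondence

variable {n : ℕ} {V : Type} [Fintype V]

/-- An injective labelling of the members of a hierarchy on the legs other than `r`. -/
def IsHierarchyMap (r : Fin n) (D : V → Finset (Fin n)) : Prop :=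
  Function.Injective D ∧ IsHierarchy (Finset.univ.erase r) (Finset.univ.image D)

open Classical in
/-- For every vertex of a tree with external legs, the legs that are separated by it from the root
leg `r`, or attached to it. -/
noncomputable def legSets (G : SimpleGraph V) (ℓ : Fin n → V) (r : Fin n) : V → Finset (Fin n) :=
  if h : ∃ par depth, IsParentMap G (ℓ r) par depth then legsBelow h.choose ℓ r else fun _ => ∅

theorem IsLegTree.exists_legSets_eq {G : SimpleGraph V} {ℓ : Fin n → V} (hT : IsLegTree G ℓ)
    (r : Fin n) :
    ∃ par depth, IsParentMap G (ℓ r) par depth ∧ legSets G ℓ r = legsBelow par ℓ r := by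
  have h := exists_isParentMap hT.1 (ℓ r)
  obtain ⟨depth, hd⟩ := h.choose_spec
  exact ⟨h.choose, depth, hd, by rw [legSets, dif_pos h]⟩

theorem IsLegTree.isHierarchyMap {G : SimpleGraph V} {ℓ : Fin n → V} (hT : IsLegTree G ℓ)
    (r : Fin n) : IsHierarchyMap r (legSets G ℓ r) := by
  obtain ⟨par, depth, h, he⟩ := hT.exists_legSets_eq r
  rw [he]
  exact ⟨h.legsBelow_injective hT.2, h.isHierarchy hT.2⟩

/-- Inclusion of leg sets determines the order. From it one recovers parents as least strict upper
bounds, and the vertex of a leg as the least one whose set contains it. -/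
theorem IsLegTree.eq_of_legSets_eq {G G' : SimpleGraph V} {ℓ ℓ' : Fin n → V} (hT : IsLegTree G ℓ)
    (hT' : IsLegTree G' ℓ') {r : Fin n} (he : legSets G ℓ r = legSets G' ℓ' r) :
    G = G' ∧ ℓ = ℓ' := by
  obtain ⟨par, depth, h, h1⟩ := hT.exists_legSets_eq r
  obtain ⟨par', depth', h', h2⟩ := hT'.exists_legSets_eq r
  have hD : legsBelow par ℓ r = legsBelow par' ℓ' r := by rw [← h1, he, h2]
  have hb : ∀ x u, IsBelow par x u ↔ IsBelow par' x u := fun x u => by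
    rw [h.isBelow_iff hT.2, h'.isBelow_iff hT'.2, hD]
  have hroot : ℓ r = ℓ' r := by
    apply h.legsBelow_injective hT.2
    rw [h.legsBelow_root, hD, h'.legsBelow_root]
  have hpar : ∀ u, u ≠ ℓ r → par u = par' u := by
    intro u hu
    have hu' : u ≠ ℓ' r := hroot ▸ hu
    apply h.antisymm
    · refine (h.par_isBelow (h'.par_ne hu').symm ?_).2
      rw [hb]; exact ⟨1, rfl⟩
    · rw [hb]
      refine (h'.par_isBelow (h.par_ne hu).symm ?_).2
      rw [← hb]; exact ⟨1, rfl⟩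
  constructor
  · ext u w
    rw [h.adj_iff, h'.adj_iff, ← hroot]
    constructor <;> rintro (⟨h1, h2⟩ | ⟨h1, h2⟩)
    · exact Or.inl ⟨h1, (hpar u h1) ▸ h2⟩
    · exact Or.inr ⟨h1, (hpar w h1) ▸ h2⟩
    · exact Or.inl ⟨h1, (hpar u h1).symm ▸ h2⟩
    · exact Or.inr ⟨h1, (hpar w h1).symm ▸ h2⟩
  · funext i
    by_cases hi : i = r
    · rw [hi, hroot]
    · apply h.antisymm
      · have : i ∈ legsBelow par ℓ r (ℓ' i) := by
          rw [hD]; exact mem_legsBelow.mpr ⟨hi, IsBelow.refl _ _⟩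
        exact (mem_legsBelow.mp this).2
      · have : i ∈ legsBelow par' ℓ' r (ℓ i) := by
          rw [← hD]; exact mem_legsBelow.mpr ⟨hi, IsBelow.refl _ _⟩
        exact (hb _ _).mpr (mem_legsBelow.mp this).2

section Construction

variable {r : Fin n} {D : V → Finset (Fin n)}

theorem IsHierarchyMap.subset_or_subset (hD : IsHierarchyMap r D) {u w : V} {i : Fin n}
    (hu : i ∈ D u) (hw : i ∈ D w) : D u ⊆ D w ∨ D w ⊆ D u := by
  rcases hD.2.laminar (D u) (Finset.mem_image_of_mem _ (Finset.mem_univ u)) (D w)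
    (Finset.mem_image_of_mem _ (Finset.mem_univ w)) with h | h | h
  · exact Or.inl h
  · exact Or.inr h
  · exact absurd hw (Finset.disjoint_left.mp h hu)

theorem IsHierarchyMap.two_le_card (hD : IsHierarchyMap r D) (u : V) : 2 ≤ (D u).card :=
  hD.2.two_le_card _ (Finset.mem_image_of_mem _ (Finset.mem_univ u))

theorem IsHierarchyMap.exists_minimal (hD : IsHierarchyMap r D) (P : V → Prop) {i : Fin n}
    (hP : ∃ u, P u) (hPi : ∀ u, P u → i ∈ D u) : ∃ u, P u ∧ ∀ w, P w → D u ⊆ D w := by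
  classical
  obtain ⟨u₀, hu₀⟩ := hP
  obtain ⟨u, hu, hmin⟩ := Finset.exists_min_image (Finset.univ.filter P) (fun u => (D u).card)
    ⟨u₀, by simp [hu₀]⟩
  rw [Finset.mem_filter] at hu
  refine ⟨u, hu.2, fun w hw => ?_⟩
  rcases hD.subset_or_subset (hPi u hu.2) (hPi w hw) with h | h
  · exact h
  · exact (Finset.eq_of_subset_of_card_le h (hmin w (by simp [hw]))).symm.subset

/-- The members containing a fixed leg form a chain. This makes it possible to take the least
strictly larger member as parent, and to attach each leg to the least member containing it. The root
leg goes to the top. -/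
theorem IsHierarchyMap.exists_legTree (hD : IsHierarchyMap r D) :
    ∃ (G : SimpleGraph V) (ℓ : Fin n → V), IsLegTree G ℓ ∧ legSets G ℓ r = D := by
  classical
  obtain ⟨root, -, hroot⟩ := Finset.mem_image.mp hD.2.top_mem
  have hsub : ∀ u, D u ⊆ D root := fun u => by
    rw [hroot]; exact hD.2.subset_top _ (Finset.mem_image_of_mem _ (Finset.mem_univ u))
  have hpar : ∀ u, ∃ v, (u = root → v = root) ∧ (u ≠ root → D u ⊂ D v ∧ ∀ w, D u ⊂ D w → D v ⊆ D w) := by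
    intro u
    by_cases hu : u = root
    · exact ⟨root, fun _ => rfl, fun h => absurd hu h⟩
    · obtain ⟨i, hi⟩ := Finset.card_pos.mp (show 0 < (D u).card by have := hD.two_le_card u; omega)
      obtain ⟨v, hv⟩ := hD.exists_minimal (fun w => D u ⊂ D w) (i := i)
        ⟨root, (hsub u).ssubset_of_ne (hD.1.ne hu)⟩ (fun w hw => hw.subset hi)
      exact ⟨v, fun h => absurd h hu, fun _ => hv⟩
  choose par hpar_root hpar_spec using hpar
  have hleg : ∀ i, ∃ v, (i = r → v = root) ∧ (i ≠ r → i ∈ D v ∧ ∀ w, i ∈ D w → D v ⊆ D w) := by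
    intro i
    by_cases hi : i = r
    · exact ⟨root, fun _ => rfl, fun h => absurd hi h⟩
    · obtain ⟨v, hv⟩ := hD.exists_minimal (fun w => i ∈ D w) (i := i)
        ⟨root, by rw [hroot]; simp [hi]⟩ (fun w hw => hw)
      exact ⟨v, fun h => absurd h hi, fun _ => hv⟩
  choose ℓ hℓ_root hℓ_spec using hleg
  -- The number of strictly larger members; passing to the parent loses exactly the parent itself.
  set depth : V → ℕ := fun u => (Finset.univ.filter fun w => D u ⊂ D w).card with hdepth
  have hdpar : ∀ u, u ≠ root → depth (par u) + 1 = depth u := by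
    intro u hu
    obtain ⟨h1, h2⟩ := hpar_spec u hu
    have : (Finset.univ.filter fun w => D u ⊂ D w) =
        insert (par u) (Finset.univ.filter fun w => D (par u) ⊂ D w) := by
      ext w
      simp only [Finset.mem_filter, Finset.mem_univ, true_and, Finset.mem_insert]
      constructor
      · intro hw
        by_cases hne : w = par u
        · exact Or.inl hne
        · exact Or.inr ((h2 w hw).ssubset_of_ne (hD.1.ne (Ne.symm hne)))
      · rintro (rfl | hw)
        · exact h1
        · exact h1.trans hw
    simp only [hdepth]
    rw [this, Finset.card_insert_of_notMem (by simp)]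
  have hne : ∀ u, u ≠ root → par u ≠ u := by
    intro u hu he
    have := (hpar_spec u hu).1
    rw [he] at this
    exact this.ne rfl
  set G : SimpleGraph V :=
    { Adj := fun u w => (u ≠ root ∧ par u = w) ∨ (w ≠ root ∧ par w = u)
      symm := ⟨fun u w h => h.symm⟩
      loopless := ⟨by rintro u (⟨h1, h2⟩ | ⟨h1, h2⟩) <;> exact hne u h1 h2⟩ } with hG
  have hr : ℓ r = root := hℓ_root r rfl
  have h : IsParentMap G (ℓ r) par depth := by
    rw [hr]
    exact ⟨fun u w => Iff.rfl, hdpar, hpar_root root rfl⟩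
  have hbelow : ∀ x u, IsBelow par x u ↔ D x ⊆ D u := by
    intro x u
    constructor
    · rintro ⟨k, rfl⟩
      induction k generalizing x with
      | zero => exact subset_rfl
      | succ k ih =>
        rw [Function.iterate_succ_apply]
        refine subset_trans ?_ (ih (par x))
        by_cases hx : x = root
        · rw [hx, hpar_root root rfl]
        · exact (hpar_spec x hx).1.subset
    · intro hs
      induction hd : depth x using Nat.strong_induction_on generalizing x with
      | _ d ih =>
        by_cases hxu : x = u
        · rw [hxu]; exact IsBelow.refl par u
        · have hss : D x ⊂ D u := hs.ssubset_of_ne (hD.1.ne hxu)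
          have hx : x ≠ root := by
            rintro rfl
            exact hss.2 (hsub u)
          exact (ih (depth (par x)) (by have := hdpar x hx; omega) (par x)
            ((hpar_spec x hx).2 u hss) rfl).of_par
  have hlegs : legsBelow par ℓ r = D := by
    funext u
    ext i
    rw [mem_legsBelow]
    constructor
    · rintro ⟨hi, hb⟩
      exact (hbelow _ _).mp hb (hℓ_spec i hi).1
    · intro hi
      have hir : i ≠ r := by
        have := hsub u hi
        rw [hroot] at this
        exact (Finset.mem_erase.mp this).1
      exact ⟨hir, (hbelow _ _).mpr ((hℓ_spec i hir).2 u hi)⟩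
  -- Without children the two or more elements of `D u` are all legs at u; with one child, strict
  -- inclusion leaves a leg at u; two children suffice by themselves.
  have hval : ∀ u, 3 ≤ valence G ℓ u := by
    intro u
    rw [h.valence_eq u]
    have hcard := h.card_legsBelow u
    have h2 := hD.two_le_card u
    rw [hlegs] at hcard
    rcases Nat.lt_trichotomy (children (ℓ r) par u).card 1 with hc | hc | hc
    · have : children (ℓ r) par u = ∅ := Finset.card_eq_zero.mp (by omega)
      rw [this, Finset.sum_empty] at hcard
      omega
    · obtain ⟨w, hw⟩ := Finset.card_eq_one.mp hc
      rw [hw, Finset.sum_singleton] at hcard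
      have hwu : w ∈ children (ℓ r) par u := by rw [hw]; exact Finset.mem_singleton_self w
      have hss : D w ⊂ D u := ((hbelow w u).mp
        (IsParentMap.isBelow_of_mem_children hwu)).ssubset_of_ne
          (hD.1.ne (h.ne_of_mem_children hwu))
      have := Finset.card_lt_card hss
      omega
    · omega
  have hT : IsLegTree G ℓ := ⟨h.isTree, hval⟩
  refine ⟨G, ℓ, hT, ?_⟩
  obtain ⟨par', depth', h', he⟩ := hT.exists_legSets_eq r
  rw [he, ← hlegs]
  rw [h.unique h']

end Construction

/-- The leg `i` is attached to the vertex that belongs to the member `U` of the hierarchy `R` on the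
legs other than `r`. -/
def LegAt (r : Fin n) (R : Finset (Finset (Fin n))) (U : Finset (Fin n)) (i : Fin n) : Prop :=
  (i ≠ r ∧ {i} ∈ blocks R U) ∨ (i = r ∧ U = Finset.univ.erase r)

theorem IsLegTree.legAt_iff {G : SimpleGraph V} {ℓ : Fin n → V} (hT : IsLegTree G ℓ) (r : Fin n)
    (u : V) (i : Fin n) :
    LegAt r (Finset.univ.image (legSets G ℓ r)) (legSets G ℓ r u) i ↔ ℓ i = u := by
  obtain ⟨par, depth, h, he⟩ := hT.exists_legSets_eq r
  rw [he, LegAt, h.blocks_legsBelow hT.2, Finset.mem_union, Finset.mem_image, Finset.mem_image]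
  by_cases hi : i = r
  · subst hi
    rw [← h.legsBelow_root, (h.legsBelow_injective hT.2).eq_iff]
    simp [eq_comm]
  · simp only [ne_eq, hi, not_false_eq_true, true_and, false_and, or_false]
    constructor
    · rintro (⟨w, -, hw⟩ | ⟨k, hk, hki⟩)
      · have := h.two_le_card_legsBelow hT.2 w
        rw [hw, Finset.card_singleton] at this
        omega
      · rw [Finset.singleton_inj] at hki
        subst hki
        exact (mem_properLegs.mp hk).2
    · intro hu
      exact Or.inr ⟨i, mem_properLegs.mpr ⟨hi, hu⟩, rfl⟩

/-- Sums over trees with external legs are sums over labelled hierarchies. -/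
theorem sum_legTrees_eq {M : Type*} [AddCommMonoid M] (r : Fin n)
    {s : Finset (SimpleGraph V × (Fin n → V))} {t : Finset (V → Finset (Fin n))}
    {P : SimpleGraph V × (Fin n → V) → Prop} {Q : (V → Finset (Fin n)) → Prop}
    (hs : ∀ T, T ∈ s ↔ IsLegTree T.1 T.2 ∧ P T) (ht : ∀ D, D ∈ t ↔ IsHierarchyMap r D ∧ Q D)
    (hPQ : ∀ T : SimpleGraph V × (Fin n → V), IsLegTree T.1 T.2 → (P T ↔ Q (legSets T.1 T.2 r)))
    {f : SimpleGraph V × (Fin n → V) → M} {g : (V → Finset (Fin n)) → M}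
    (hfg : ∀ T : SimpleGraph V × (Fin n → V), IsLegTree T.1 T.2 → f T = g (legSets T.1 T.2 r)) :
    ∑ T ∈ s, f T = ∑ D ∈ t, g D := by
  refine Finset.sum_bij (fun T _ => legSets T.1 T.2 r) ?_ ?_ ?_ ?_
  · intro T hT
    rw [hs] at hT
    exact (ht _).mpr ⟨hT.1.isHierarchyMap r, (hPQ T hT.1).mp hT.2⟩
  · intro T hT T' hT' he
    rw [hs] at hT hT'
    exact Prod.ext_iff.mpr (hT.1.eq_of_legSets_eq hT'.1 he)
  · intro D hD
    rw [ht] at hD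
    obtain ⟨G, ℓ, hT, rfl⟩ := hD.1.exists_legTree
    exact ⟨(G, ℓ), (hs _).mpr ⟨hT, (hPQ (G, ℓ) hT).mpr hD.2⟩, rfl⟩
  · intro T hT
    exact hfg T ((hs T).mp hT).1

/-- Summing valences gives 2(|V| − 1) + n ≥ 3|V|. -/
theorem IsLegTree.card_lt {G : SimpleGraph V} {ℓ : Fin n → V} (hT : IsLegTree G ℓ) :
    Fintype.card V + 2 ≤ n := by
  classical
  have h1 := hT.1.card_edgeFinset
  have h2 := G.sum_degrees_eq_twice_card_edges
  have h3 : ∑ v, legsAt ℓ v = n := by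
    have := Finset.card_eq_sum_card_fiberwise (f := ℓ) (s := Finset.univ) (t := Finset.univ)
      (fun _ _ => Finset.mem_univ _)
    rw [Finset.card_univ, Fintype.card_fin] at this
    exact Eq.trans (Finset.sum_congr rfl fun v _ => by rw [legsAt]) this.symm
  have h4 : ∑ v, internalValence G v = ∑ v, G.degree v :=
    Finset.sum_congr rfl fun v _ => by
      rw [internalValence, ← SimpleGraph.card_neighborFinset_eq_degree,
        SimpleGraph.neighborFinset_eq_filter]
  have h5 : ∑ _v : V, 3 ≤ ∑ v, valence G ℓ v := Finset.sum_le_sum fun v _ => hT.2 v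
  have h6 : ∑ v, valence G ℓ v = ∑ v, internalValence G v + ∑ v, legsAt ℓ v :=
    Finset.sum_add_distrib
  rw [Finset.sum_const, Finset.card_univ, smul_eq_mul] at h5
  omega

end Correspondence

end FieldDiffeo

namespace FieldDiffeo

/-! ### Momenta flowing along the lines of a rooted tree -/

section Weights

theorem mink_neg (p : Momentum) : mink (-p) = mink p := by
  simp [mink]

theorem offShellVar_neg (m : ℝ) (p : Momentum) : offShellVar m (-p) = offShellVar m p := by
  rw [offShellVar, mink_neg, offShellVar]

variable {n : ℕ} {V : Type} [Fintype V]

namespace IsParentMap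

variable {G : SimpleGraph V} {ℓ : Fin n → V} {r : Fin n} {par : V → V} {depth : V → ℕ}

theorem flow_par (h : IsParentMap G (ℓ r) par depth) (q : Fin n → Momentum) {u : V} (hu : u ≠ ℓ r) :
    flow G ℓ q u (par u) = ∑ i ∈ legsBelow par ℓ r u, q i := by
  classical
  rw [flow]
  refine Finset.sum_congr ?_ fun _ _ => rfl
  ext i
  rw [Finset.mem_filter, h.reachable_iff hu, mem_legsBelow]
  refine ⟨fun hi => ⟨?_, hi.2⟩, fun hi => ⟨Finset.mem_univ _, hi.2⟩⟩
  rintro rfl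
  exact hu (h.eq_of_root_isBelow hi.2)

theorem flow_par_left (h : IsParentMap G (ℓ r) par depth) {q : Fin n → Momentum} (hq : ∑ i, q i = 0)
    {u : V} (hu : u ≠ ℓ r) : flow G ℓ q (par u) u = -∑ i ∈ legsBelow par ℓ r u, q i := by
  classical
  rw [flow, eq_neg_iff_add_eq_zero, ← hq,
    ← Finset.sum_filter_add_sum_filter_not Finset.univ (fun i => ¬ IsBelow par (ℓ i) u)]
  congr 1
  · refine Finset.sum_congr ?_ fun _ _ => rfl
    ext i
    rw [Finset.mem_filter, Finset.mem_filter, Sym2.eq_swap, h.reachable_par_iff hu]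
  · refine Finset.sum_congr ?_ fun _ _ => rfl
    ext i
    rw [Finset.mem_filter, mem_legsBelow, not_not]
    refine ⟨fun hi => ⟨Finset.mem_univ _, hi.2⟩, fun hi => ⟨?_, hi.2⟩⟩
    rintro rfl
    exact hu (h.eq_of_root_isBelow hi.2)

/-- Each edge is the line above exactly one non-root vertex; symmetry of f absorbs the orientation
imposed by the linear order. -/
theorem prod_edgePairs [LinearOrder V] {M : Type*} [CommMonoid M] {root : V}
    (h : IsParentMap G root par depth) {f : V → V → M} (hf : ∀ u w, f u w = f w u) :
    ∏ e ∈ edgePairs G, f e.1 e.2 = ∏ u ∈ Finset.univ.erase root, f u (par u) := by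
  classical
  symm
  refine Finset.prod_bij (fun u _ => if u < par u then (u, par u) else (par u, u)) ?_ ?_ ?_ ?_
  · intro u hu
    have hu' := (Finset.mem_erase.mp hu).1
    rw [edgePairs, Finset.mem_filter]
    refine ⟨Finset.mem_univ _, ?_⟩
    split_ifs with hlt
    · exact ⟨hlt, h.adj_par hu'⟩
    · exact ⟨lt_of_le_of_ne (not_lt.mp hlt) (h.par_ne hu'), (h.adj_par hu').symm⟩
  · intro u hu w hw he
    have hu' := (Finset.mem_erase.mp hu).1
    have hw' := (Finset.mem_erase.mp hw).1
    rw [← h.edge_eq_iff hw' hu', Sym2.eq_iff]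
    split_ifs at he <;> simp only [Prod.mk.injEq] at he
    · exact Or.inl he
    · exact Or.inr he
    · exact Or.inr ⟨he.2, he.1⟩
    · exact Or.inl ⟨he.2, he.1⟩
  · rintro ⟨u, w⟩ he
    rw [edgePairs, Finset.mem_filter] at he
    obtain ⟨-, hlt, hadj⟩ := he
    simp only at hlt hadj
    rcases (h.adj_iff u w).mp hadj with ⟨hu, rfl⟩ | ⟨hw, rfl⟩
    · exact ⟨u, Finset.mem_erase.mpr ⟨hu, Finset.mem_univ _⟩, by rw [if_pos hlt]⟩
    · exact ⟨w, Finset.mem_erase.mpr ⟨hw, Finset.mem_univ _⟩, by rw [if_neg (not_lt.mpr hlt.le)]⟩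
  · intro u hu
    split_ifs
    · rfl
    · exact hf _ _

/-- Up to sign the incident momenta are the totals of the blocks and the total of the whole leg set.
At the root the latter is minus the momentum of the root leg, by conservation. -/
theorem sumSq_eq (h : IsParentMap G (ℓ r) par depth) (hv : ∀ u, 3 ≤ valence G ℓ u)
    {q : Fin n → Momentum} (hq : ∑ i, q i = 0) (u : V) :
    sumSq G ℓ q u =
      ∑ B ∈ blocks (Finset.univ.image (legsBelow par ℓ r)) (legsBelow par ℓ r u),
          mink (∑ i ∈ B, q i) + mink (∑ i ∈ legsBelow par ℓ r u, q i) := by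
  classical
  rw [h.sum_blocks hv, sumSq, h.sum_neighbors, sum_legs ℓ r]
  simp only [Finset.sum_singleton]
  have hc : ∑ w ∈ children (ℓ r) par u, mink (flow G ℓ q u w) =
      ∑ w ∈ children (ℓ r) par u, mink (∑ i ∈ legsBelow par ℓ r w, q i) := by
    refine Finset.sum_congr rfl fun w hw => ?_
    rw [mem_children] at hw
    rw [← hw.2, h.flow_par_left hq hw.1, mink_neg]
  rw [hc]
  by_cases hu : u = ℓ r
  · have hr : ∑ i ∈ legsBelow par ℓ r u, q i = - q r := by
      rw [hu, h.legsBelow_root, eq_neg_iff_add_eq_zero, Finset.sum_erase_add _ _ (Finset.mem_univ r),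
        hq]
    rw [if_pos hu, if_pos hu, hr, mink_neg]
    ring
  · rw [if_neg hu, if_neg hu, h.flow_par q hu]
    ring

end IsParentMap

end Weights

end FieldDiffeo

namespace FieldDiffeo

/-! ### Tree contributions as products over a hierarchy -/

section HierarchyWeights

variable {n : ℕ}

/-- The off-shell variable of the total momentum of a set of legs. -/
def partialVar (m : ℝ) (q : Fin n → Momentum) (U : Finset (Fin n)) : ℝ :=
  offShellVar m (∑ i ∈ U, q i)

/-- The propagator `1 / x` of the line above `U`, which is absent for the root. -/
noncomputable def lineWeight (m : ℝ) (q : Fin n → Momentum) (r : Fin n) (U : Finset (Fin n)) : ℝ :=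
  if U = Finset.univ.erase r then 1 else (partialVar m q U)⁻¹

/-- The weight of a vertex of the transformed theory and of the line above it. -/
noncomputable def diffeoWeight (a : ℕ → ℝ) (m : ℝ) (q : Fin n → Momentum) (r : Fin n)
    (U : Finset (Fin n)) (π : Finset (Finset (Fin n))) : ℝ :=
  -diffeoVertex a (partialVar m q) π * lineWeight m q r U

/-- The weight of a meta-vertex and of the line above it. -/
noncomputable def metaWeight (a : ℕ → ℝ) (m : ℝ) (q : Fin n → Momentum) (r : Fin n)
    (U : Finset (Fin n)) (π : Finset (Finset (Fin n))) : ℝ :=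
  b a π.card * lineWeight m q r U

/-- The total weight of the meta-vertices that differ only by the choice of the off-shell leg. -/
noncomputable def legSumWeight (a : ℕ → ℝ) (m : ℝ) (q : Fin n → Momentum) (r : Fin n)
    (U : Finset (Fin n)) (π : Finset (Finset (Fin n))) : ℝ :=
  b a π.card * (legSum (partialVar m q) π +
    if U = Finset.univ.erase r then partialVar m q U else 0) * lineWeight m q r U

theorem partialVar_compl {m : ℝ} {q : Fin n → Momentum} (hq : ∑ i, q i = 0) (U : Finset (Fin n)) :
    partialVar m q Uᶜ = partialVar m q U := by
  have : ∑ i ∈ Uᶜ, q i = -∑ i ∈ U, q i := by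
    rw [eq_neg_iff_add_eq_zero, Finset.sum_compl_add_sum, hq]
  rw [partialVar, this, offShellVar_neg, partialVar]

theorem partialVar_erase {m : ℝ} {q : Fin n → Momentum} (hq : ∑ i, q i = 0) (r : Fin n) :
    partialVar m q (Finset.univ.erase r) = offShellVar m (q r) := by
  have : Finset.univ.erase r = ({r} : Finset (Fin n))ᶜ := by ext; simp
  rw [this, partialVar_compl hq, partialVar, Finset.sum_singleton]

theorem vertexRule_eq (a : ℕ → ℝ) (m : ℝ) (q : Fin n → Momentum) {U : Finset (Fin n)}
    {π : Finset (Finset (Fin n))} (hπ : π ∈ partitions U) (h2 : 2 ≤ π.card) :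
    vertexRule a m (π.card + 1) (∑ B ∈ π, mink (∑ i ∈ B, q i) + mink (∑ i ∈ U, q i)) =
      Complex.I * (diffeoVertex a (partialVar m q) π : ℝ) := by
  have hsum : ∀ Z ⊆ π, ∑ B ∈ Z, ∑ i ∈ B, q i = ∑ i ∈ Z.biUnion id, q i := by
    intro Z hZ
    rw [Finset.sum_biUnion]
    · rfl
    · exact fun B hB C hC hne => (mem_partitions.mp hπ).2.1 B (hZ hB) C (hZ hC) hne
  have h := vertex_eq_sum_powerset a m π h2 (fun B => ∑ i ∈ B, q i)
  rw [hsum π subset_rfl, (mem_partitions.mp hπ).2.2] at h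
  have hd : diffeoVertex a (partialVar m q) π = ∑ Z ∈ π.powerset, if Z = ∅ then 0 else
        ((Z.card.factorial : ℝ) * a (Z.card - 1)) *
          (((π \ Z).card + 1).factorial * a (π \ Z).card) *
            offShellVar m (∑ B ∈ Z, ∑ i ∈ B, q i) := by
    rw [diffeoVertex]
    refine Finset.sum_congr rfl fun Z hZ => ?_
    rw [hsum Z (Finset.mem_powerset.mp hZ), partialVar]
  rw [vertexRule, hd, ← h, show π.card + 1 - 2 = π.card - 1 by omega]
  push_cast
  ring

variable {V : Type} [Fintype V]

theorem IsLegTree.prod_edgePairs [LinearOrder V] {G : SimpleGraph V} {ℓ : Fin n → V}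
    (hT : IsLegTree G ℓ) {m : ℝ} {q : Fin n → Momentum} (hq : ∑ i, q i = 0) (r : Fin n) (c : ℂ) :
    ∏ e ∈ edgePairs G, c / ((offShellVar m (flow G ℓ q e.1 e.2) : ℝ) : ℂ) =
      c ^ (Fintype.card V - 1) *
        ∏ U ∈ Finset.univ.image (legSets G ℓ r), ((lineWeight m q r U : ℝ) : ℂ) := by
  classical
  obtain ⟨par, depth, h, he⟩ := hT.exists_legSets_eq r
  have hmemU : ∀ u, u ≠ ℓ r →
      offShellVar m (flow G ℓ q u (par u)) = partialVar m q (legsBelow par ℓ r u) := by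
    intro u hu
    rw [h.flow_par q hu, partialVar]
  have hsymm : ∀ u w, G.Adj u w →
      offShellVar m (flow G ℓ q u w) = offShellVar m (flow G ℓ q w u) := by
    intro u w hadj
    rcases (h.adj_iff u w).mp hadj with ⟨hu, rfl⟩ | ⟨hw, rfl⟩
    · rw [h.flow_par q hu, h.flow_par_left hq hu, offShellVar_neg]
    · rw [h.flow_par q hw, h.flow_par_left hq hw, offShellVar_neg]
  have h1 : ∏ e ∈ edgePairs G, c / ((offShellVar m (flow G ℓ q e.1 e.2) : ℝ) : ℂ) =
      ∏ e ∈ edgePairs G, (fun u w => if G.Adj u w then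
        c / ((offShellVar m (flow G ℓ q u w) : ℝ) : ℂ) else 1) e.1 e.2 := by
    refine Finset.prod_congr rfl fun e hed => ?_
    rw [edgePairs, Finset.mem_filter] at hed
    simp only [if_pos hed.2.2]
  rw [h1, h.prod_edgePairs (f := fun u w => if G.Adj u w then
        c / ((offShellVar m (flow G ℓ q u w) : ℝ) : ℂ) else 1), he,
    Finset.prod_image fun x _ y _ hxy => h.legsBelow_injective hT.2 hxy,
    ← Finset.mul_prod_erase Finset.univ _ (Finset.mem_univ (ℓ r))]
  · have hroot : lineWeight m q r (legsBelow par ℓ r (ℓ r)) = 1 := by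
      rw [lineWeight, if_pos h.legsBelow_root]
    rw [hroot, Complex.ofReal_one, one_mul,
      show c ^ (Fintype.card V - 1) = ∏ _u ∈ Finset.univ.erase (ℓ r), c by
        rw [Finset.prod_const, Finset.card_erase_of_mem (Finset.mem_univ _), Finset.card_univ],
      ← Finset.prod_mul_distrib]
    refine Finset.prod_congr rfl fun u hu => ?_
    have hu' := (Finset.mem_erase.mp hu).1
    have hne : legsBelow par ℓ r u ≠ Finset.univ.erase r := by
      rw [← h.legsBelow_root]
      exact (h.legsBelow_injective hT.2).ne hu'
    rw [if_pos (h.adj_par hu'), hmemU u hu', lineWeight, if_neg hne, div_eq_mul_inv,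
      Complex.ofReal_inv]
  · intro u w
    by_cases hadj : G.Adj u w
    · rw [if_pos hadj, if_pos hadj.symm, hsymm u w hadj]
    · rw [if_neg hadj, if_neg fun h' => hadj h'.symm]

theorem IsLegTree.prod_vertices {G : SimpleGraph V} {ℓ : Fin n → V} (hT : IsLegTree G ℓ)
    (r : Fin n) {M : Type*} [CommMonoid M] {f : V → M} {g : Finset (Fin n) → M}
    (hfg : ∀ u, f u = g (legSets G ℓ r u)) :
    ∏ u, f u = ∏ U ∈ Finset.univ.image (legSets G ℓ r), g U := by
  rw [Finset.prod_image fun x _ y _ hxy => (hT.isHierarchyMap r).1 hxy]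
  exact Finset.prod_congr rfl fun u _ => hfg u

theorem IsLegTree.card_blocks {G : SimpleGraph V} {ℓ : Fin n → V} (hT : IsLegTree G ℓ) (r : Fin n)
    (u : V) :
    (blocks (Finset.univ.image (legSets G ℓ r)) (legSets G ℓ r u)).card + 1 = valence G ℓ u := by
  obtain ⟨par, depth, h, he⟩ := hT.exists_legSets_eq r
  rw [he]
  exact h.card_blocks hT.2 u

theorem IsLegTree.sumSq_eq {G : SimpleGraph V} {ℓ : Fin n → V} (hT : IsLegTree G ℓ) (r : Fin n)
    {q : Fin n → Momentum} (hq : ∑ i, q i = 0) (u : V) :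
    sumSq G ℓ q u =
      ∑ B ∈ blocks (Finset.univ.image (legSets G ℓ r)) (legSets G ℓ r u), mink (∑ i ∈ B, q i) +
        mink (∑ i ∈ legSets G ℓ r u, q i) := by
  obtain ⟨par, depth, h, he⟩ := hT.exists_legSets_eq r
  rw [he]
  exact h.sumSq_eq hT.2 hq u

theorem I_mul_treeContribution [LinearOrder V] (a : ℕ → ℝ) (m : ℝ) {q : Fin n → Momentum}
    (hq : ∑ i, q i = 0) (r : Fin n) {G : SimpleGraph V} {ℓ : Fin n → V} (hT : IsLegTree G ℓ) :
    Complex.I * treeContribution a m q G ℓ =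
      ∏ U ∈ Finset.univ.image (legSets G ℓ r),
        ((diffeoWeight a m q r U (blocks (Finset.univ.image (legSets G ℓ r)) U) : ℝ) : ℂ) := by
  classical
  set R := Finset.univ.image (legSets G ℓ r) with hR
  have hH := (hT.isHierarchyMap r).2
  have hvert : ∀ u, vertexRule a m (valence G ℓ u) (sumSq G ℓ q u) = (fun U => Complex.I *
      (diffeoVertex a (partialVar m q) (blocks R U) : ℝ)) (legSets G ℓ r u) := by
    intro u
    have h2 : 2 ≤ (legSets G ℓ r u).card :=
      hH.two_le_card _ (Finset.mem_image_of_mem _ (Finset.mem_univ u))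
    rw [← hT.card_blocks r, hT.sumSq_eq r hq]
    exact vertexRule_eq a m q (hH.blocks_mem_partitions h2) (hH.two_le_card_blocks h2)
  have hcard : R.card = Fintype.card V := by
    rw [hR, Finset.card_image_of_injective _ (hT.isHierarchyMap r).1, Finset.card_univ]
  have hpos : 0 < R.card := Finset.card_pos.mpr ⟨_, hH.top_mem⟩
  rw [treeContribution, hT.prod_vertices r (g := fun U => Complex.I *
      (diffeoVertex a (partialVar m q) (blocks R U) : ℝ)) hvert, hT.prod_edgePairs hq r, ← hR,
    Finset.prod_mul_distrib, Finset.prod_const, ← hcard]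
  -- With v vertices there are v − 1 propagators, so with the normalising factor the powers of i
  -- combine to one sign −1 per vertex.
  have hI : Complex.I * (Complex.I ^ R.card * Complex.I ^ (R.card - 1)) = (-1) ^ R.card := by
    rw [mul_left_comm, ← pow_succ', Nat.sub_add_cancel hpos, ← mul_pow, Complex.I_mul_I]
  simp only [diffeoWeight, Complex.ofReal_mul, Complex.ofReal_neg, Finset.prod_mul_distrib]
  rw [Finset.prod_neg, ← hI]
  ring

end HierarchyWeights

end FieldDiffeo

namespace FieldDiffeo

/-! ### Removing the labels of vertices -/

section Labellings

/-- A sum over injective labellings with `k` labels is `k!` times a sum over sets. -/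
theorem sum_injective_eq {α M : Type*} [Fintype α] [DecidableEq α] [AddCommMonoid M] {k : ℕ}
    {s : Finset (Fin k → α)} (hs : ∀ σ, σ ∈ s ↔ Function.Injective σ) (W : Finset α → M) :
    ∑ σ ∈ s, W (Finset.univ.image σ) =
      k.factorial • ∑ S ∈ Finset.powersetCard k Finset.univ, W S := by
  classical
  have hmaps : ∀ σ ∈ s, Finset.univ.image σ ∈ Finset.powersetCard k Finset.univ := by
    intro σ hσ
    rw [Finset.mem_powersetCard_univ, Finset.card_image_of_injective _ ((hs σ).mp hσ),
      Finset.card_univ, Fintype.card_fin]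
  rw [← Finset.sum_fiberwise_of_maps_to hmaps, Finset.smul_sum]
  refine Finset.sum_congr rfl fun S hS => ?_
  have hcard : (s.filter fun σ => Finset.univ.image σ = S).card = k.factorial := by
    have hS' : S.card = k := Finset.mem_powersetCard_univ.mp hS
    have e₀ : Fin k ≃ S := (Fintype.equivFinOfCardEq (by rw [Fintype.card_coe, hS'])).symm
    have h := Fintype.card_equiv e₀
    rw [Fintype.card_fin] at h
    rw [← h, ← Finset.card_univ]
    symm
    refine Finset.card_bij (fun e _ i => (e i : α)) ?_ ?_ ?_
    · intro e _
      rw [Finset.mem_filter, hs]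
      refine ⟨Subtype.val_injective.comp e.injective, ?_⟩
      ext x
      simp only [Finset.mem_image, Finset.mem_univ, true_and]
      constructor
      · rintro ⟨i, rfl⟩; exact (e i).2
      · intro hx; exact ⟨e.symm ⟨x, hx⟩, by simp⟩
    · intro e _ e' _ h
      ext i
      exact congrFun h i
    · intro σ hσ
      rw [Finset.mem_filter, hs] at hσ
      have hmem : ∀ i, σ i ∈ S := fun i => by
        rw [← hσ.2]; exact Finset.mem_image_of_mem _ (Finset.mem_univ i)
      refine ⟨Equiv.ofBijective (fun i => ⟨σ i, hmem i⟩) ⟨fun i i' h => hσ.1 (by simpa using h), ?_⟩,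
        Finset.mem_univ _, rfl⟩
      rintro ⟨x, hx⟩
      rw [← hσ.2] at hx
      obtain ⟨i, -, hi⟩ := Finset.mem_image.mp hx
      exact ⟨i, by simpa using hi⟩
  rw [← hcard, ← Finset.sum_const]
  exact Finset.sum_congr rfl fun σ hσ => by rw [(Finset.mem_filter.mp hσ).2]

variable {n : ℕ}

/-- Realise the hierarchy as a tree labelled by its own members and use the bound on the number of
vertices. -/
theorem card_lt_of_mem_hierarchies {r : Fin n} {R : Finset (Finset (Fin n))}
    (hR : IsHierarchy (Finset.univ.erase r) R) : R.card < n := by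
  have hmap : IsHierarchyMap r (fun U : R => (U : Finset (Fin n))) := by
    refine ⟨Subtype.val_injective, ?_⟩
    have : Finset.univ.image (fun U : R => (U : Finset (Fin n))) = R := by
      rw [Finset.univ_eq_attach, Finset.attach_image_val]
    rwa [this]
  obtain ⟨G, ℓ, hT, -⟩ := hmap.exists_legTree
  have := hT.card_lt
  rw [Fintype.card_coe] at this
  omega

/-- A hierarchy with k members has k! labellings, which cancels the factor 1/k!; the range n misses
none because a hierarchy has fewer than n members. -/
theorem sum_isHierarchyMap_eq {r : Fin n} (hr : 2 ≤ (Finset.univ.erase r).card)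
    {t : ∀ k, Finset (Fin k → Finset (Fin n))} (ht : ∀ k D, D ∈ t k ↔ IsHierarchyMap r D)
    (W : Finset (Finset (Fin n)) → ℂ) :
    ∑ k ∈ Finset.range n, (1 / (k.factorial : ℂ)) * ∑ D ∈ t k, W (Finset.univ.image D) =
      ∑ R ∈ hierarchies (Finset.univ.erase r), W R := by
  classical
  have h1 : ∀ k, (1 / (k.factorial : ℂ)) * ∑ D ∈ t k, W (Finset.univ.image D) =
      ∑ R ∈ (hierarchies (Finset.univ.erase r)).filter fun R => R.card = k, W R := by
    intro k
    have h := sum_injective_eq (s := Finset.univ.filter fun D : Fin k → Finset (Fin n) =>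
      Function.Injective D) (fun D => by simp)
      (fun R => if IsHierarchy (Finset.univ.erase r) R then W R else 0)
    have h2 : t k = (Finset.univ.filter fun D : Fin k → Finset (Fin n) =>
        Function.Injective D).filter fun D =>
          IsHierarchy (Finset.univ.erase r) (Finset.univ.image D) := by
      ext D
      rw [ht, Finset.mem_filter, Finset.mem_filter, IsHierarchyMap]
      simp
    rw [h2, Finset.sum_filter, h, nsmul_eq_mul, ← mul_assoc, one_div_mul_cancel
      (Nat.cast_ne_zero.mpr k.factorial_ne_zero), one_mul, ← Finset.sum_filter]
    refine Finset.sum_congr ?_ fun _ _ => rfl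
    ext R
    rw [Finset.mem_filter, Finset.mem_powersetCard_univ, Finset.mem_filter, mem_hierarchies hr,
      and_comm]
  rw [Finset.sum_congr rfl fun k _ => h1 k]
  refine Finset.sum_fiberwise_of_maps_to (fun R hR => ?_) W
  rw [Finset.mem_range]
  exact card_lt_of_mem_hierarchies ((mem_hierarchies hr).mp hR)

theorem ofReal_hierarchySum (c : Finset (Fin n) → Finset (Finset (Fin n)) → ℝ)
    (U : Finset (Fin n)) :
    ((hierarchySum c U : ℝ) : ℂ) = ∑ R ∈ hierarchies U, ∏ D ∈ R, ((c D (blocks R D) : ℝ) : ℂ) := by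
  rw [hierarchySum]
  push_cast
  rfl

theorem I_mul_treeAmplitude (a : ℕ → ℝ) (m : ℝ) {q : Fin n → Momentum} (hq : ∑ i, q i = 0)
    {r : Fin n} (hr : 2 ≤ (Finset.univ.erase r).card) :
    Complex.I * treeAmplitude a m q =
      ((hierarchySum (diffeoWeight a m q r) (Finset.univ.erase r) : ℝ) : ℂ) := by
  classical
  rw [ofReal_hierarchySum, ← sum_isHierarchyMap_eq hr
    (t := fun k => Finset.univ.filter fun D : Fin k → Finset (Fin n) => IsHierarchyMap r D)
    (fun k D => by simp) (fun R => ∏ D ∈ R, ((diffeoWeight a m q r D (blocks R D) : ℝ) : ℂ)),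
    treeAmplitude, Finset.mul_sum]
  refine Finset.sum_congr rfl fun k _ => ?_
  rw [mul_left_comm, Finset.mul_sum]
  congr 1
  exact sum_legTrees_eq r (P := fun _ => True) (Q := fun _ => True) (fun T => by simp)
    (fun D => by simp) (fun _ _ => Iff.rfl) (fun T hT => I_mul_treeContribution a m hq r hT)
    (g := fun D => ∏ U ∈ Finset.univ.image D,
      ((diffeoWeight a m q r U (blocks (Finset.univ.image D) U) : ℝ) : ℂ))

end Labellings

end FieldDiffeo

namespace FieldDiffeo

/-! ### Meta-trees as trees with a chosen leg at each vertex -/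

section MetaTrees

variable {n : ℕ}

theorem legsAt_pos {V : Type} {ℓ : Fin n → V} {v : V} {i : Fin n} (h : ℓ i = v) : 0 < legsAt ℓ v := by
  classical
  rw [legsAt, Finset.card_pos]
  exact ⟨i, by simp [h]⟩

/-- The truncation of the formal sum never acts: the vertex has its own leg, and its valence is at
least three, so the index exceeds both bounds. -/
theorem bWeights_eq (a : ℕ → ℝ) {S : Finset (Fin n)} {G : SimpleGraph S} {ℓ : Fin n → S}
    (hT : IsMetaTree S G ℓ) :
    bWeights a n S G ℓ = ∏ v, ((b a (valence G ℓ v - 1) : ℝ) : ℂ) := by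
  refine Finset.prod_congr rfl fun v _ => ?_
  have h1 := hT.1.2 v
  have h2 := legsAt_pos (hT.2 v)
  have h3 : valence G ℓ v = internalValence G v + legsAt ℓ v := rfl
  rw [formalB, PowerSeries.coeff_mk, if_pos]
  rw [max_lt_iff]
  omega

theorem IsMetaTree.mul_prod_edgePairs (a : ℕ → ℝ) (m : ℝ) {q : Fin n → Momentum} (hq : ∑ i, q i = 0)
    (r : Fin n) {S : Finset (Fin n)} {G : SimpleGraph S} {ℓ : Fin n → S} (hT : IsMetaTree S G ℓ) :
    bWeights a n S G ℓ * ∏ e ∈ edgePairs G, 1 / ((offShellVar m (flow G ℓ q e.1 e.2) : ℝ) : ℂ) =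
      ∏ U ∈ Finset.univ.image (legSets G ℓ r),
        ((metaWeight a m q r U (blocks (Finset.univ.image (legSets G ℓ r)) U) : ℝ) : ℂ) := by
  classical
  rw [hT.1.prod_edgePairs hq r, one_pow, one_mul, bWeights_eq a hT,
    hT.1.prod_vertices r (g := fun U =>
      ((b a (blocks (Finset.univ.image (legSets G ℓ r)) U).card : ℝ) : ℂ)), ← Finset.prod_mul_distrib]
  · refine Finset.prod_congr rfl fun U _ => ?_
    rw [metaWeight, Complex.ofReal_mul]
  · intro u
    rw [← hT.1.card_blocks r u, Nat.add_sub_cancel]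

open Classical in
/-- The labelled hierarchies that belong to the meta-trees whose meta-vertices are the legs `σ v`. -/
noncomputable def metaMaps {V : Type} [Fintype V] (r : Fin n) (σ : V → Fin n) :
    Finset (V → Finset (Fin n)) :=
  Finset.univ.filter fun D => IsHierarchyMap r D ∧ ∀ v, LegAt r (Finset.univ.image D) (D v) (σ v)

theorem mem_metaMaps {V : Type} [Fintype V] {r : Fin n} {σ : V → Fin n}
    {D : V → Finset (Fin n)} : D ∈ metaMaps r σ ↔
      IsHierarchyMap r D ∧ ∀ v, LegAt r (Finset.univ.image D) (D v) (σ v) := by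
  classical
  simp [metaMaps]

theorem metaSum_bWeights (a : ℕ → ℝ) (m : ℝ) {q : Fin n → Momentum} (hq : ∑ i, q i = 0)
    (r : Fin n) (S : Finset (Fin n)) :
    metaSum m q (bWeights a n) S = ∑ D ∈ metaMaps r (fun s : S => (s : Fin n)),
      ∏ U ∈ Finset.univ.image D,
        ((metaWeight a m q r U (blocks (Finset.univ.image D) U) : ℝ) : ℂ) := by
  classical
  rw [metaSum]
  let W : SimpleGraph S × (Fin n → S) → ℂ := fun T => ∏ U ∈ Finset.univ.image (legSets T.1 T.2 r),
        ((metaWeight a m q r U (blocks (Finset.univ.image (legSets T.1 T.2 r)) U) : ℝ) : ℂ)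
  rw [show ∀ s : Finset (SimpleGraph S × (Fin n → S)), (∀ T ∈ s, IsMetaTree S T.1 T.2) →
    ∑ T ∈ s, bWeights a n S T.1 T.2 * ∏ e ∈ edgePairs T.1,
      1 / ((offShellVar m (flow T.1 T.2 q e.1 e.2) : ℝ) : ℂ) = ∑ T ∈ s, W T from
      fun s hs => Finset.sum_congr rfl fun T hT => (hs T hT).mul_prod_edgePairs a m hq r]
  · refine sum_legTrees_eq r (P := fun T => ∀ s : S, T.2 s = s)
      (Q := fun D => ∀ s : S, LegAt r (Finset.univ.image D) (D s) s) (fun T => ?_)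
      (fun D => mem_metaMaps) (fun T hT => ?_) (fun T _ => rfl)
      (g := fun D => ∏ U ∈ Finset.univ.image D,
        ((metaWeight a m q r U (blocks (Finset.univ.image D) U) : ℝ) : ℂ))
    · rw [Finset.mem_filter, IsMetaTree]; simp
    · exact forall_congr' fun s => (hT.legAt_iff r s s).symm
  · intro T hT
    exact (Finset.mem_filter.mp hT).2

theorem sum_metaMaps_equiv {V V' : Type} [Fintype V] [Fintype V'] (e : V' ≃ V) (r : Fin n)
    (σ : V → Fin n) {M : Type*} [AddCommMonoid M] (W : Finset (Finset (Fin n)) → M) :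
    ∑ D ∈ metaMaps r σ, W (Finset.univ.image D) =
      ∑ D ∈ metaMaps r (σ ∘ e), W (Finset.univ.image D) := by
  classical
  have himage : ∀ D : V → Finset (Fin n), Finset.univ.image (D ∘ e) = Finset.univ.image D := by
    intro D
    rw [← Finset.image_image, Finset.image_univ_equiv]
  refine Finset.sum_bij' (fun D _ => D ∘ e) (fun D _ => D ∘ e.symm) ?_ ?_ ?_ ?_ ?_
  · intro D hD
    rw [mem_metaMaps] at hD ⊢
    rw [IsHierarchyMap, himage]
    exact ⟨⟨hD.1.1.comp e.injective, hD.1.2⟩, fun v => hD.2 (e v)⟩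
  · intro D hD
    rw [mem_metaMaps] at hD ⊢
    have h : Finset.univ.image (D ∘ e.symm) = Finset.univ.image D := by
      rw [← Finset.image_image, Finset.image_univ_equiv]
    rw [IsHierarchyMap, h]
    refine ⟨⟨hD.1.1.comp e.symm.injective, hD.1.2⟩, fun v => ?_⟩
    have := hD.2 (e.symm v)
    rwa [Function.comp_apply, Equiv.apply_symm_apply] at this
  · intro D _; funext v; simp
  · intro D _; funext v; simp
  · intro D _; rw [himage]

/-- Legs other than r at a vertex are its singleton blocks. The root leg sits at the top set, whose
off-shell variable equals that of r by conservation. -/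
theorem IsHierarchyMap.sum_legAt {V : Type} [Fintype V] {r : Fin n} {D : V → Finset (Fin n)}
    (hD : IsHierarchyMap r D) {m : ℝ} {q : Fin n → Momentum} (hq : ∑ i, q i = 0)
    {U : Finset (Fin n)} (hU : U ∈ Finset.univ.image D) {t : Finset (Fin n)}
    (ht : ∀ i, i ∈ t ↔ LegAt r (Finset.univ.image D) U i) :
    ∑ i ∈ t, offShellVar m (q i) = legSum (partialVar m q) (blocks (Finset.univ.image D) U) +
      if U = Finset.univ.erase r then partialVar m q U else 0 := by
  classical
  set R := Finset.univ.image D with hR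
  have hpart := hD.2.blocks_mem_partitions (hD.2.two_le_card U hU)
  have hrU : r ∉ U := fun h => Finset.notMem_erase r _ (hD.2.subset_top U hU h)
  have hsum : ∑ i ∈ t.filter (· ≠ r), offShellVar m (q i) =
      legSum (partialVar m q) (blocks R U) := by
    rw [legSum, ← Finset.sum_filter]
    refine Finset.sum_bij (fun i _ => {i}) ?_ ?_ ?_ ?_
    · intro i hi
      rw [Finset.mem_filter, ht, LegAt] at hi
      rcases hi with ⟨⟨-, h⟩ | ⟨h, -⟩, hir⟩
      · exact Finset.mem_filter.mpr ⟨h, Finset.card_singleton i⟩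
      · exact absurd h hir
    · intro i _ i' _ h
      exact Finset.singleton_inj.mp h
    · intro B hB
      rw [Finset.mem_filter, Finset.card_eq_one] at hB
      obtain ⟨hB, i, rfl⟩ := hB
      have hi : i ≠ r := by
        rintro rfl
        exact hrU (subset_of_mem_partitions hpart hB (Finset.mem_singleton_self i))
      exact ⟨i, Finset.mem_filter.mpr ⟨(ht i).mpr (Or.inl ⟨hi, hB⟩), hi⟩, rfl⟩
    · intro i _
      rw [partialVar, Finset.sum_singleton]
  rw [← Finset.sum_filter_add_sum_filter_not t (· ≠ r), hsum]
  congr 1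
  by_cases hroot : U = Finset.univ.erase r
  · rw [if_pos hroot, show t.filter (fun i => ¬ i ≠ r) = {r} by
      ext i
      simp only [Finset.mem_filter, ht, LegAt, Finset.mem_singleton, not_not]
      exact ⟨fun h => h.2, fun h => ⟨Or.inr ⟨h, hroot⟩, h⟩⟩, Finset.sum_singleton, hroot,
      partialVar_erase hq]
  · rw [if_neg hroot, show t.filter (fun i => ¬ i ≠ r) = ∅ by
      ext i
      simp only [Finset.mem_filter, ht, LegAt, not_not, Finset.notMem_empty, iff_false]
      rintro ⟨⟨h, -⟩ | ⟨-, h⟩, hi⟩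
      · exact h hi
      · exact hroot h, Finset.sum_empty]

theorem IsHierarchyMap.injective_of_legAt {V : Type} [Fintype V] {r : Fin n}
    {D : V → Finset (Fin n)} (hD : IsHierarchyMap r D) {σ : V → Fin n}
    (hσ : ∀ v, LegAt r (Finset.univ.image D) (D v) (σ v)) : Function.Injective σ := by
  obtain ⟨G, ℓ, hT, rfl⟩ := hD.exists_legTree
  intro v w h
  rw [← (hT.legAt_iff r v (σ v)).mp (hσ v), ← (hT.legAt_iff r w (σ w)).mp (hσ w), h]

/-- Multiply out the product over vertices of the sums of x over their legs. A term picks one leg at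
each vertex, which is a meta-tree on the set of picked legs; a tree with a legless vertex
contributes nothing to either side. -/
theorem sum_powersetCard_metaSum (a : ℕ → ℝ) (m : ℝ) {q : Fin n → Momentum} (hq : ∑ i, q i = 0)
    (r : Fin n) (k : ℕ) {t : Finset (Fin k → Finset (Fin n))}
    (ht : ∀ D, D ∈ t ↔ IsHierarchyMap r D) :
    ∑ S ∈ Finset.powersetCard k Finset.univ,
      (∏ s ∈ S, ((offShellVar m (q s) : ℝ) : ℂ)) * metaSum m q (bWeights a n) S =
    (1 / (k.factorial : ℂ)) * ∑ D ∈ t, ∏ U ∈ Finset.univ.image D,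
      ((legSumWeight a m q r U (blocks (Finset.univ.image D) U) : ℝ) : ℂ) := by
  classical
  set W : Finset (Finset (Fin n)) → ℂ := fun R => ∏ U ∈ R,
    ((metaWeight a m q r U (blocks R U) : ℝ) : ℂ) with hW
  set x : Fin n → ℂ := fun i => ((offShellVar m (q i) : ℝ) : ℂ) with hx
  have h1 := sum_injective_eq (s := Finset.univ.filter fun σ : Fin k → Fin n =>
    Function.Injective σ) (fun σ => by simp)
    (fun S => (∏ s ∈ S, x s) * metaSum m q (bWeights a n) S)
  rw [nsmul_eq_mul] at h1
  rw [eq_comm, ← mul_right_inj' (Nat.cast_ne_zero.mpr k.factorial_ne_zero : (k.factorial : ℂ) ≠ 0),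
    ← h1, ← mul_assoc, mul_one_div_cancel (Nat.cast_ne_zero.mpr k.factorial_ne_zero), one_mul]
  -- The meta-vertices are relabelled by `Fin k` through σ, so that the tree sum ranges over the
  -- same labelled hierarchies for every S.
  have h2 : ∀ σ ∈ Finset.univ.filter fun σ : Fin k → Fin n => Function.Injective σ,
      (∏ s ∈ Finset.univ.image σ, x s) * metaSum m q (bWeights a n) (Finset.univ.image σ) =
        ∑ D ∈ t, if ∀ v, LegAt r (Finset.univ.image D) (D v) (σ v) then
          W (Finset.univ.image D) * ∏ v, x (σ v) else 0 := by
    intro σ hσ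
    have hσ' : Function.Injective σ := (Finset.mem_filter.mp hσ).2
    let e : Fin k ≃ (Finset.univ.image σ : Finset (Fin n)) :=
      Equiv.ofBijective (fun i => ⟨σ i, Finset.mem_image_of_mem _ (Finset.mem_univ i)⟩)
        ⟨fun i i' h => hσ' (by simpa using h), by
          rintro ⟨y, hy⟩
          obtain ⟨i, -, hi⟩ := Finset.mem_image.mp hy
          exact ⟨i, by simpa using hi⟩⟩
    rw [metaSum_bWeights a m hq r, sum_metaMaps_equiv e r _ W, ← Finset.sum_filter,
      Finset.prod_image fun i _ i' _ h => hσ' h, mul_comm, Finset.sum_mul]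
    refine Finset.sum_congr ?_ fun _ _ => rfl
    ext D
    rw [mem_metaMaps, Finset.mem_filter, ht]
    exact Iff.rfl
  rw [Finset.sum_congr rfl h2, Finset.sum_comm]
  refine Finset.sum_congr rfl fun D hD => ?_
  rw [ht] at hD
  rw [← Finset.sum_filter, ← Finset.mul_sum]
  -- Injectivity is automatic because a leg sits at only one vertex; the choices therefore form a
  -- full product set and the sum factorises.
  have h3 : (Finset.univ.filter fun σ : Fin k → Fin n => Function.Injective σ).filter
      (fun σ => ∀ v, LegAt r (Finset.univ.image D) (D v) (σ v)) =
      Fintype.piFinset fun v => Finset.univ.filter fun i =>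
        LegAt r (Finset.univ.image D) (D v) i := by
    ext σ
    simp only [Finset.mem_filter, Finset.mem_univ, true_and, Fintype.mem_piFinset]
    exact ⟨fun h => h.2, fun h => ⟨hD.injective_of_legAt h, h⟩⟩
  rw [h3, ← Finset.prod_univ_sum (fun v => Finset.univ.filter fun i =>
        LegAt r (Finset.univ.image D) (D v) i) (fun _ i => x i),
    Finset.prod_image fun v _ w _ h => hD.1 h]
  simp only [hW]
  rw [Finset.prod_image fun v _ w _ h => hD.1 h, ← Finset.prod_mul_distrib]
  refine Finset.prod_congr rfl fun v _ => ?_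
  have h4 := hD.sum_legAt (m := m) hq (Finset.mem_image_of_mem _ (Finset.mem_univ v))
    (t := Finset.univ.filter fun i => LegAt r (Finset.univ.image D) (D v) i) (fun i => by simp)
  have h5 : ∑ i ∈ Finset.univ.filter (fun i => LegAt r (Finset.univ.image D) (D v) i), x i =
      ((legSum (partialVar m q) (blocks (Finset.univ.image D) (D v)) +
        if D v = Finset.univ.erase r then partialVar m q (D v) else 0 : ℝ) : ℂ) := by
    rw [← h4, Complex.ofReal_sum]
  rw [h5, ← Complex.ofReal_mul, legSumWeight, metaWeight]
  congr 1
  ring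

end MetaTrees

end FieldDiffeo

namespace FieldDiffeo

/-! ### Existence of the expansion -/

section Expansion

variable {n : ℕ}

theorem card_univ_erase (r : Fin n) : (Finset.univ.erase r).card = n - 1 := by
  rw [Finset.card_erase_of_mem (Finset.mem_univ r), Finset.card_univ, Fintype.card_fin]

/-- Both hierarchy sums satisfy the recursions required by `amplitude_eq_of_currents`. General
position supplies the nonvanishing propagators, and the absence of a line at the top set turns the
sums there into amputated amplitudes. -/
theorem hierarchySum_diffeoWeight_eq (a : ℕ → ℝ) (ha : a 0 = 1) {m : ℝ} {j : ℕ} (hn : 3 ≤ n)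
    {q : Fin n → Momentum} (hq : GeneralPosition m j q) (r : Fin n) :
    hierarchySum (diffeoWeight a m q r) (Finset.univ.erase r) =
      hierarchySum (legSumWeight a m q r) (Finset.univ.erase r) := by
  have hI : 2 ≤ (Finset.univ.erase r).card := by rw [card_univ_erase]; omega
  have hx : ∀ U ⊂ Finset.univ.erase r, 2 ≤ U.card → partialVar m q U ≠ 0 := by
    intro U hU h2
    have := Finset.card_lt_card hU
    rw [card_univ_erase] at this
    exact hq.generic U h2 (by omega)
  have h := amplitude_eq_of_currents a ha (partialVar m q) (Finset.univ.erase r) hI hx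
    (hierarchySum (diffeoWeight a m q r)) (hierarchySum (legSumWeight a m q r))
    (hierarchySum_singleton _) (hierarchySum_singleton _) ?_ ?_
  · rw [hierarchySum_eq _ hI, hierarchySum_eq _ hI]
    simp only [diffeoWeight, legSumWeight, lineWeight, if_true, mul_one]
    rw [← h, ← Finset.sum_neg_distrib]
    exact Finset.sum_congr rfl fun π _ => by rw [neg_mul]
  · intro U hU h2
    rw [hierarchySum_eq _ h2, Finset.mul_sum, ← Finset.sum_neg_distrib]
    refine Finset.sum_congr rfl fun π _ => ?_
    rw [diffeoWeight, lineWeight, if_neg hU.ne]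
    field_simp [hx U hU h2]
  · intro U hU h2
    rw [hierarchySum_eq _ h2, Finset.mul_sum]
    refine Finset.sum_congr rfl fun π _ => ?_
    rw [legSumWeight, lineWeight, if_neg hU.ne, if_neg hU.ne, add_zero]
    field_simp [hx U hU h2]

/-- The right-hand side of the expansion, as a sum over all sets of legs. -/
noncomputable def metaExpansion (m : ℝ) (q : Fin n → Momentum) (c : MetaWeights n) : ℂ :=
  ∑ S : Finset (Fin n), (∏ s ∈ S, ((offShellVar m (q s) : ℝ) : ℂ)) * metaSum m q c S

theorem metaSum_univ_eq_zero (m : ℝ) (q : Fin n → Momentum) (c : MetaWeights n)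
    {S : Finset (Fin n)} (hS : n ≤ S.card) : metaSum m q c S = 0 := by
  classical
  rw [metaSum]
  refine Finset.sum_eq_zero fun T hT => ?_
  have := (Finset.mem_filter.mp hT).2.1.card_lt
  rw [Fintype.card_coe] at this
  omega

/-- A set S containing an on-shell leg contributes zero through the factor x of that leg, so S may
range over all sets. -/
theorem sum_offShellLegs_eq {m : ℝ} {j : ℕ} {q : Fin n → Momentum} (hq : GeneralPosition m j q)
    (c : MetaWeights n) :
    ∑ k ∈ Finset.range (j + 1), ∑ S ∈ Finset.powersetCard k (offShellLegs n j),
        (∏ s ∈ S, ((offShellVar m (q s) : ℝ) : ℂ)) * metaSum m q c S = metaExpansion m q c := by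
  classical
  have h : ∑ S ∈ (offShellLegs n j).powerset,
      (∏ s ∈ S, ((offShellVar m (q s) : ℝ) : ℂ)) * metaSum m q c S = metaExpansion m q c := by
    rw [metaExpansion]
    refine Finset.sum_subset (Finset.subset_univ _) fun S _ hS => ?_
    rw [Finset.mem_powerset, Finset.not_subset] at hS
    obtain ⟨i, hi, hi'⟩ := hS
    rw [Finset.prod_eq_zero hi, zero_mul]
    rw [hq.onShell i, Complex.ofReal_zero]
    by_contra hlt
    exact hi' (by simpa [offShellLegs] using hlt)
  rw [← h]
  have hcard : (offShellLegs n j).card ≤ j := by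
    rw [offShellLegs, ← Finset.card_image_of_injective _ Fin.val_injective]
    refine (Finset.card_le_card (t := Finset.range j) ?_).trans_eq (Finset.card_range j)
    intro x hx
    obtain ⟨i, hi, rfl⟩ := Finset.mem_image.mp hx
    exact Finset.mem_range.mpr (Finset.mem_filter.mp hi).2
  have hmaps : ∀ S ∈ (offShellLegs n j).powerset, S.card ∈ Finset.range (j + 1) := fun S hS => by
    have := Finset.card_le_card (Finset.mem_powerset.mp hS)
    exact Finset.mem_range.mpr (by omega)
  rw [← Finset.sum_fiberwise_of_maps_to hmaps]
  refine Finset.sum_congr rfl fun k _ => Finset.sum_congr ?_ fun _ _ => rfl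
  ext S
  rw [Finset.mem_powersetCard, Finset.mem_filter, Finset.mem_powerset]

theorem metaExpansion_bWeights (a : ℕ → ℝ) {m : ℝ} {q : Fin n → Momentum} (hq : ∑ i, q i = 0)
    (hn : 3 ≤ n) (r : Fin n) :
    metaExpansion m q (bWeights a n) =
      ((hierarchySum (legSumWeight a m q r) (Finset.univ.erase r) : ℝ) : ℂ) := by
  classical
  have hr : 2 ≤ (Finset.univ.erase r).card := by rw [card_univ_erase]; omega
  rw [ofReal_hierarchySum, ← sum_isHierarchyMap_eq hr
    (t := fun k => Finset.univ.filter fun D : Fin k → Finset (Fin n) => IsHierarchyMap r D)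
    (fun k D => by simp) (fun R => ∏ D ∈ R, ((legSumWeight a m q r D (blocks R D) : ℝ) : ℂ)),
    ← Finset.sum_congr rfl fun k _ => sum_powersetCard_metaSum a m hq r k (fun D => by simp),
    metaExpansion, ← Finset.sum_filter_add_sum_filter_not Finset.univ fun S => S.card < n,
    Finset.sum_eq_zero (s := Finset.univ.filter fun S : Finset (Fin n) => ¬ S.card < n), add_zero,
    ← Finset.sum_fiberwise_of_maps_to (t := Finset.range n) (g := Finset.card)]
  · refine Finset.sum_congr rfl fun k hk => Finset.sum_congr ?_ fun _ _ => rfl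
    ext S
    rw [Finset.mem_powersetCard_univ, Finset.mem_filter, Finset.mem_filter]
    have := Finset.mem_range.mp hk
    exact ⟨fun h => h.2, fun h => ⟨⟨Finset.mem_univ _, by omega⟩, h⟩⟩
  · intro S hS
    exact Finset.mem_range.mpr (Finset.mem_filter.mp hS).2
  · intro S hS
    rw [metaSum_univ_eq_zero m q _ (not_lt.mp (Finset.mem_filter.mp hS).2), mul_zero]

theorem isExpansion_bWeights (a : ℕ → ℝ) (ha : a 0 = 1) (m : ℝ) (j : ℕ) (hn : 3 ≤ n) :
    IsExpansion a m n j (bWeights a n) := by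
  intro q hq
  have hr : 2 ≤ (Finset.univ.erase (⟨0, by omega⟩ : Fin n)).card := by rw [card_univ_erase]; omega
  rw [sum_offShellLegs_eq hq, metaExpansion_bWeights a hq.conservation hn ⟨0, by omega⟩,
    ← hierarchySum_diffeoWeight_eq a ha hn hq, I_mul_treeAmplitude a m hq.conservation hr]

end Expansion

end FieldDiffeo

namespace FieldDiffeo

/-! ### Generic on-shell momenta -/

section GenericMomenta

/-- An on-shell momentum of mass `m`. -/
noncomputable def shellMomentum (m t : ℝ) : Momentum :=
  ![(1 + m ^ 2 + t ^ 2) / 2, t, 0, (m ^ 2 + t ^ 2 - 1) / 2]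

theorem shellMomentum_zero_pos (m t : ℝ) : 0 < shellMomentum m t 0 := by
  simp only [shellMomentum, Matrix.cons_val_zero]
  positivity

theorem offShellVar_shellMomentum (m t : ℝ) : offShellVar m (shellMomentum m t) = 0 := by
  simp [offShellVar, mink, shellMomentum]
  ring

variable {ι : Type*} [Fintype ι]

/-- In light-cone components, p⁰ − p³ = 1 and p⁰ + p³ = m² + t². The result is a quadratic
polynomial in the parameters. -/
theorem offShellVar_sum_shellMomentum (m : ℝ) (ε t : ι → ℝ) :
    offShellVar m (∑ k, ε k • shellMomentum m (t k)) =
      (∑ k, ε k) * ((∑ k, ε k) * m ^ 2 + ∑ k, ε k * t k ^ 2) - (∑ k, ε k * t k) ^ 2 - m ^ 2 := by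
  have h0 : ∑ k, ε k * ((1 + m ^ 2 + t k ^ 2) / 2) =
      ((∑ k, ε k) * (1 + m ^ 2) + ∑ k, ε k * t k ^ 2) / 2 := by
    rw [Finset.sum_mul, ← Finset.sum_add_distrib, Finset.sum_div]
    exact Finset.sum_congr rfl fun k _ => by ring
  have h3 : ∑ k, ε k * ((m ^ 2 + t k ^ 2 - 1) / 2) =
      ((∑ k, ε k) * (m ^ 2 - 1) + ∑ k, ε k * t k ^ 2) / 2 := by
    rw [Finset.sum_mul, ← Finset.sum_add_distrib, Finset.sum_div]
    exact Finset.sum_congr rfl fun k _ => by ring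
  simp only [offShellVar, mink, Finset.sum_apply, Pi.smul_apply, smul_eq_mul, shellMomentum,
    Matrix.cons_val_zero, Matrix.cons_val_one, Matrix.cons_val]
  rw [h0, h3]
  simp only [mul_zero, Finset.sum_const_zero]
  ring

variable [DecidableEq ι]

theorem sum_mul_two_point (ε : ι → ℝ) {k l : ι} (hkl : k ≠ l) (x y : ℝ) :
    ∑ i, ε i * (if i = k then x else if i = l then y else 0) = ε k * x + ε l * y := by
  rw [Finset.sum_eq_add k l hkl]
  · simp [hkl.symm]
  · intro i _ hi
    simp [hi.1, hi.2]
  · simp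
  · simp

/-- Generic on-shell momenta: no combination with coefficients `1`, `0`, `-1` of at least two of them
is on-shell. -/
theorem exists_generic_shellMomentum (m : ℝ) : ∃ t : ι → ℝ, ∀ A B : Finset ι,
    (∃ k l, k ≠ l ∧ k ∈ symmDiff A B ∧ l ∈ symmDiff A B) →
      offShellVar m (∑ k ∈ A, shellMomentum m (t k) - ∑ k ∈ B, shellMomentum m (t k)) ≠ 0 := by
  classical
  set ε : Finset ι × Finset ι → ι → ℝ := fun AB k =>
    (if k ∈ AB.1 then 1 else 0) - if k ∈ AB.2 then 1 else 0 with hε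
  set f : Finset ι × Finset ι → (ι → ℝ) → ℝ := fun AB t =>
    offShellVar m (∑ k, ε AB k • shellMomentum m (t k)) with hf
  have hsum : ∀ (A B : Finset ι) (t : ι → ℝ), f (A, B) t =
      offShellVar m (∑ k ∈ A, shellMomentum m (t k) - ∑ k ∈ B, shellMomentum m (t k)) := by
    intro A B t
    simp only [hf, hε, sub_smul, ite_smul, one_smul, zero_smul, Finset.sum_sub_distrib,
      Finset.sum_ite_mem, Finset.univ_inter]
  set p : Finset ι × Finset ι → MvPolynomial ι ℝ := fun AB =>
    MvPolynomial.C (∑ k, ε AB k) * (MvPolynomial.C ((∑ k, ε AB k) * m ^ 2) +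
      ∑ k, MvPolynomial.C (ε AB k) * MvPolynomial.X k ^ 2) -
      (∑ k, MvPolynomial.C (ε AB k) * MvPolynomial.X k) ^ 2 - MvPolynomial.C (m ^ 2) with hp
  have heval : ∀ AB t, MvPolynomial.eval t (p AB) = f AB t := by
    intro AB t
    simp only [hp, hf, offShellVar_sum_shellMomentum, map_sub, map_mul, map_add, map_pow, map_sum,
      MvPolynomial.eval_C, MvPolynomial.eval_X]
  set N : Finset (Finset ι × Finset ι) := Finset.univ.filter fun AB =>
    ∃ k l, k ≠ l ∧ k ∈ symmDiff AB.1 AB.2 ∧ l ∈ symmDiff AB.1 AB.2 with hN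
  have hne : ∏ AB ∈ N, p AB ≠ 0 := by
    rw [Finset.prod_ne_zero_iff]
    intro AB hAB h0
    obtain ⟨k, l, hkl, hk, hl⟩ := (Finset.mem_filter.mp hAB).2
    have hε0 : ∀ i, i ∈ symmDiff AB.1 AB.2 → ε AB i ≠ 0 := by
      intro i hi
      rcases Finset.mem_symmDiff.mp hi with h | h <;> simp [hε, h.1, h.2]
    -- If the polynomial were zero, it would vanish with only the parameters k and l switched on.
    have hv : ∀ x y : ℝ, (∑ i, ε AB i) * ((∑ i, ε AB i) * m ^ 2 + (ε AB k * x ^ 2 + ε AB l * y ^ 2)) -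
        (ε AB k * x + ε AB l * y) ^ 2 - m ^ 2 = 0 := by
      intro x y
      have h := heval AB fun i => if i = k then x else if i = l then y else 0
      rw [h0, map_zero, hf] at h
      simp only [offShellVar_sum_shellMomentum, ite_pow, zero_pow two_ne_zero,
        sum_mul_two_point _ hkl] at h
      exact h.symm
    -- The mixed second difference isolates the cross term of the square, which is nonzero since
    -- both signs are ±1.
    have h2 : 2 * ε AB k * ε AB l = 0 := by
      linear_combination hv 1 0 + hv 0 1 - hv 1 1 - hv 0 0
    exact mul_ne_zero (mul_ne_zero two_ne_zero (hε0 k hk)) (hε0 l hl) h2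
  obtain ⟨t, ht⟩ : ∃ t, MvPolynomial.eval t (∏ AB ∈ N, p AB) ≠ 0 := by
    by_contra! hcon
    exact hne (MvPolynomial.funext fun t => by rw [hcon t, map_zero])
  refine ⟨t, fun A B hAB => ?_⟩
  rw [← hsum, ← heval]
  rw [map_prod, Finset.prod_ne_zero_iff] at ht
  exact ht (A, B) (Finset.mem_filter.mpr ⟨Finset.mem_univ _, hAB⟩)

end GenericMomenta

end FieldDiffeo

namespace FieldDiffeo

/-! ### External momenta prescribed along the lines of a tree -/

section TreeMomenta

/-- The external momenta for which the line above `k` carries the momentum `P k`, if `par` is a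
parent map with root `r` on the set of legs. -/
def treeMomenta {ι M : Type*} [Fintype ι] [DecidableEq ι] [AddCommGroup M] (r : ι) (par : ι → ι)
    (P : ι → M) (i : ι) : M :=
  (if i = r then 0 else P i) - ∑ k with k ≠ r ∧ par k = i, P k

theorem sum_treeMomenta {ι M : Type*} [Fintype ι] [DecidableEq ι] [AddCommGroup M] (r : ι)
    (par : ι → ι) (P : ι → M) (U : Finset ι) :
    ∑ i ∈ U, treeMomenta r par P i = ∑ k ∈ U.erase r, P k - ∑ k with k ≠ r ∧ par k ∈ U, P k := by
  have h1 : ∑ i ∈ U, (if i = r then 0 else P i) = ∑ k ∈ U.erase r, P k := by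
    have : U.erase r = U.filter (· ≠ r) := by ext; simp [and_comm]
    rw [this, Finset.sum_filter]
    exact Finset.sum_congr rfl fun i _ => by by_cases h : i = r <;> simp [h]
  have h2 : ∑ i ∈ U, ∑ k with k ≠ r ∧ par k = i, P k = ∑ k with k ≠ r ∧ par k ∈ U, P k := by
    rw [← Finset.sum_fiberwise_of_maps_to (s := Finset.univ.filter fun k => k ≠ r ∧ par k ∈ U) (t := U)
      (g := par) fun k hk => (Finset.mem_filter.mp hk).2.2]
    refine Finset.sum_congr rfl fun i hi => Finset.sum_congr ?_ fun _ _ => rfl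
    ext k
    simp only [Finset.mem_filter, Finset.mem_univ, true_and]
    exact ⟨fun h => ⟨⟨h.1, h.2 ▸ hi⟩, h.2⟩, fun h => ⟨h.1.1, h.2⟩⟩
  simp only [treeMomenta, Finset.sum_sub_distrib]
  rw [h1, h2]

variable {n : ℕ} {S : Finset (Fin n)}

/-- The leg at the vertex to which a line of a meta-tree leads. -/
def legParent (ℓ : Fin n → S) (par : S → S) (i : Fin n) : Fin n :=
  if i ∈ S then (par (ℓ i) : Fin n) else ℓ i

/-- The lines whose momentum contributes to the total momentum of the legs in `U`. -/
def crossing (r : Fin n) (ℓ : Fin n → S) (par : S → S) (U : Finset (Fin n)) : Finset (Fin n) :=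
  symmDiff (U.erase r) (Finset.univ.filter fun k => k ≠ r ∧ legParent ℓ par k ∈ U)

theorem notMem_crossing {r : Fin n} {ℓ : Fin n → S} {par : S → S} {U : Finset (Fin n)} {k : Fin n}
    (hk : k ≠ r) : k ∉ crossing r ℓ par U ↔ (k ∈ U ↔ legParent ℓ par k ∈ U) := by
  rw [crossing, Finset.mem_symmDiff]
  simp only [Finset.mem_erase, Finset.mem_filter, Finset.mem_univ, true_and, ne_eq, hk,
    not_false_eq_true]
  tauto

variable {G : SimpleGraph S} {ℓ : Fin n → S} {r : Fin n} {par : S → S} {depth : S → ℕ}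

theorem IsParentMap.legParent_legsBelow (h : IsParentMap G (ℓ r) par depth)
    (hℓ : ∀ s : S, ℓ s = s) {v : S} (hv : v ≠ ℓ r) {k : Fin n} (hk : k ≠ r) :
    legParent ℓ par k ∈ legsBelow par ℓ r v ↔ k ≠ v ∧ k ∈ legsBelow par ℓ r v := by
  have hlp : (legParent ℓ par k) ∈ legsBelow par ℓ r v ↔
      IsBelow par (ℓ (legParent ℓ par k)) v := by
    rw [mem_legsBelow]
    refine ⟨fun h => h.2, fun hb => ⟨fun he => ?_, hb⟩⟩
    rw [he] at hb
    exact hv (h.eq_of_root_isBelow hb)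
  rw [hlp, mem_legsBelow, legParent]
  by_cases hkS : k ∈ S
  · have h1 : ℓ k = ⟨k, hkS⟩ := hℓ ⟨k, hkS⟩
    rw [if_pos hkS, hℓ, h1]
    constructor
    · intro hb
      refine ⟨?_, hk, hb.of_par⟩
      rintro rfl
      exact h.not_isBelow_par hv hb
    · rintro ⟨hne, -, hb⟩
      exact hb.par_of_ne fun he => hne (congrArg Subtype.val he)
  · rw [if_neg hkS, hℓ]
    refine ⟨fun hb => ⟨?_, hk, hb⟩, fun hb => hb.2.2⟩
    rintro rfl
    exact hkS v.2

/-- The sum telescopes: every line strictly below v cancels between its two ends, and only the line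
leaving upwards from v remains. -/
theorem IsParentMap.sum_treeMomenta_legsBelow (h : IsParentMap G (ℓ r) par depth)
    (hℓ : ∀ s : S, ℓ s = s) {v : S} (hv : v ≠ ℓ r) {M : Type*} [AddCommGroup M] (P : Fin n → M) :
    ∑ i ∈ legsBelow par ℓ r v, treeMomenta r (legParent ℓ par) P i = P v := by
  have hvr : (v : Fin n) ≠ r := by
    rintro rfl
    exact hv (hℓ v).symm
  have hmem : (v : Fin n) ∈ legsBelow par ℓ r v :=
    mem_legsBelow.mpr ⟨hvr, by rw [hℓ]; exact IsBelow.refl par v⟩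
  have h1 : (legsBelow par ℓ r v).erase r = legsBelow par ℓ r v :=
    Finset.erase_eq_of_notMem fun hm => (mem_legsBelow.mp hm).1 rfl
  have h2 : (Finset.univ.filter fun k => k ≠ r ∧ legParent ℓ par k ∈ legsBelow par ℓ r v) =
      (legsBelow par ℓ r v).erase v := by
    ext k
    simp only [Finset.mem_filter, Finset.mem_univ, true_and, Finset.mem_erase]
    constructor
    · rintro ⟨hk, hm⟩
      exact (h.legParent_legsBelow hℓ hv hk).mp hm
    · intro hm
      have hk := (mem_legsBelow.mp hm.2).1
      exact ⟨hk, (h.legParent_legsBelow hℓ hv hk).mpr hm⟩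
  rw [sum_treeMomenta, h1, h2, ← Finset.add_sum_erase _ _ hmem, add_sub_cancel_right]

theorem sum_univ_treeMomenta {M : Type*} [AddCommGroup M] (par : Fin n → Fin n) (P : Fin n → M) :
    ∑ i, treeMomenta r par P i = 0 := by
  rw [sum_treeMomenta, sub_eq_zero]
  refine Finset.sum_congr ?_ fun _ _ => rfl
  ext k
  simp

theorem treeMomenta_of_notMem (hr : r ∈ S) {M : Type*} [AddCommGroup M] (P : Fin n → M) {i : Fin n}
    (hi : i ∉ S) : treeMomenta r (legParent ℓ par) P i = P i := by
  have h1 : i ≠ r := fun h => hi (h ▸ hr)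
  rw [treeMomenta, if_neg h1, Finset.sum_eq_zero, sub_zero]
  intro k hk
  exfalso
  apply hi
  rw [← (Finset.mem_filter.mp hk).2.2, legParent]
  split_ifs
  · exact (par (ℓ k)).2
  · exact (ℓ k).2

theorem eq_or_compl_eq {U A : Finset (Fin n)} {p : Prop} (h : ∀ i, (i ∈ U ↔ p) ↔ i ∉ A) :
    U = A ∨ Uᶜ = A := by
  by_cases hp : p
  · right
    ext i
    have := h i
    rw [Finset.mem_compl]
    tauto
  · left
    ext i
    have := h i
    tauto

/-- If at most one line has exactly one end in U, then U is constant on each side of that line.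
Hence U or its complement is empty, a single leg outside S, or the legs below one vertex. -/
theorem IsParentMap.crossing_cases (h : IsParentMap G (ℓ r) par depth) (hr : r ∈ S)
    (hℓ : ∀ s : S, ℓ s = s) (U : Finset (Fin n)) :
    (∃ k l, k ≠ l ∧ k ∈ crossing r ℓ par U ∧ l ∈ crossing r ℓ par U) ∨
      (∃ A, (A = ∅ ∨ (∃ k ∉ S, A = {k}) ∨ ∃ v, v ≠ ℓ r ∧ A = legsBelow par ℓ r v) ∧
        (U = A ∨ Uᶜ = A)) := by
  by_cases hcase : ∃ k l, k ≠ l ∧ k ∈ crossing r ℓ par U ∧ l ∈ crossing r ℓ par U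
  · exact Or.inl hcase
  right
  push Not at hcase
  have hval : ∀ s : S, (ℓ (s : Fin n) : Fin n) = s := fun s => congrArg Subtype.val (hℓ s)
  have hrv : ((ℓ r : S) : Fin n) = r := hval ⟨r, hr⟩
  have hpar : ∀ s : S, legParent ℓ par s = par s := fun s => by
    rw [legParent, if_pos s.2, hℓ]
  have hother : ∀ i ∉ S, legParent ℓ par i = ℓ i := fun i hi => by rw [legParent, if_neg hi]
  have hne : ∀ s : S, s ≠ ℓ r → (s : Fin n) ≠ r := fun s hs he => hs (by
    apply Subtype.ext; rw [he, hrv])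
  -- the vertices on the side of the root
  have hind : ∀ p : S → Prop, p (ℓ r) → (∀ s, s ≠ ℓ r → p (par s) → p s) → ∀ s, p s := by
    intro p h0 hstep s
    induction hd : depth s using Nat.strong_induction_on generalizing s with
    | _ d ih =>
      by_cases hs : s = ℓ r
      · rw [hs]; exact h0
      · exact hstep s hs (ih (depth (par s)) (by have := h.depth_par s hs; omega) _ rfl)
  by_cases hcS : ∃ v : S, v ≠ ℓ r ∧ (v : Fin n) ∈ crossing r ℓ par U
  · obtain ⟨v, hv, hvc⟩ := hcS
    refine ⟨legsBelow par ℓ r v, Or.inr (Or.inr ⟨v, hv, rfl⟩), ?_⟩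
    have honly : ∀ k, k ≠ r → k ≠ v → (k ∈ U ↔ legParent ℓ par k ∈ U) := fun k hk hkv =>
      (notMem_crossing hk).mp (hcase v k (Ne.symm hkv) hvc)
    have hvU : ¬ ((v : Fin n) ∈ U ↔ (par v : Fin n) ∈ U) := by
      rw [← hpar, ← notMem_crossing (hne v hv), not_not]
      exact hvc
    -- Moving down from the root, membership in U flips exactly when the line above v is passed.
    have hS : ∀ s : S, ((s : Fin n) ∈ U ↔ r ∈ U) ↔ ¬ IsBelow par s v := by
      apply hind
      · rw [hrv]
        exact ⟨fun _ hb => hv (h.eq_of_root_isBelow hb), fun _ => Iff.rfl⟩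
      · intro s hs ih
        by_cases hsv : s = v
        · subst hsv
          have h1 := h.not_isBelow_par hv
          have h2 := IsBelow.refl par s
          tauto
        · have h1 := honly s (hne s hs) fun he => hsv (Subtype.ext he)
          rw [hpar] at h1
          have h2 : IsBelow par (par s) v ↔ IsBelow par s v :=
            ⟨fun hb => hb.of_par, fun hb => hb.par_of_ne hsv⟩
          rw [h1, ih, h2]
    refine eq_or_compl_eq (p := r ∈ U) fun i => ?_
    rw [mem_legsBelow]
    by_cases hir : i = r
    · subst hir; simp
    by_cases hi : i ∈ S
    · have := hS ⟨i, hi⟩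
      have h1 : ℓ i = ⟨i, hi⟩ := hℓ ⟨i, hi⟩
      rw [h1, this]
      simp [hir]
    · have h1 := honly i hir fun he => hi (he ▸ v.2)
      rw [hother i hi] at h1
      rw [h1, hS]
      simp [hir]
  · push Not at hcS
    have hS : ∀ s : S, (s : Fin n) ∈ U ↔ r ∈ U := by
      apply hind
      · rw [hrv]
      · intro s hs ih
        rw [(notMem_crossing (hne s hs)).mp (hcS s hs), hpar, ih]
    by_cases hk : ∃ k ∉ S, k ∈ crossing r ℓ par U
    · obtain ⟨k, hkS, hkc⟩ := hk
      refine ⟨{k}, Or.inr (Or.inl ⟨k, hkS, rfl⟩), ?_⟩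
      refine eq_or_compl_eq (p := r ∈ U) fun i => ?_
      rw [Finset.mem_singleton]
      by_cases hi : i ∈ S
      · have := hS ⟨i, hi⟩
        simp only at this
        simp only [this, true_iff]
        rintro rfl
        exact hkS hi
      · have hir : i ≠ r := fun he => hi (he ▸ hr)
        by_cases hik : i = k
        · subst hik
          have h1 : ¬ (i ∈ U ↔ (ℓ i : Fin n) ∈ U) := by
            rw [← hother i hi, ← notMem_crossing hir, not_not]
            exact hkc
          rw [hS] at h1
          tauto
        · have h1 := (notMem_crossing hir).mp (hcase k i (Ne.symm hik) hkc)
          rw [hother i hi, hS] at h1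
          tauto
    · push Not at hk
      refine ⟨∅, Or.inl rfl, eq_or_compl_eq (p := r ∈ U) fun i => ?_⟩
      simp only [Finset.notMem_empty, not_false_eq_true, iff_true]
      by_cases hi : i ∈ S
      · exact hS ⟨i, hi⟩
      · have hir : i ≠ r := fun he => hi (he ▸ hr)
        rw [(notMem_crossing hir).mp (hk i hi), hother i hi, hS]

end TreeMomenta

end FieldDiffeo

namespace FieldDiffeo

/-! ### Momenta making the lines of one meta-tree singular -/

section Degeneration

open Filter Topology

variable {n : ℕ}

theorem continuous_offShellVar (m : ℝ) : Continuous (offShellVar m) := by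
  unfold offShellVar mink
  fun_prop

theorem offShellVar_add_single (m t : ℝ) (p : Momentum) :
    offShellVar m (p + t • Pi.single 0 1) = offShellVar m p + t * (2 * p 0 + t) := by
  simp [offShellVar, mink]
  ring

/-- For every meta-tree there are admissible momenta for which exactly the propagators of its lines
become singular in a limit. -/
theorem IsMetaTree.exists_momenta {S : Finset (Fin n)} {G : SimpleGraph S} {ℓ : Fin n → S}
    (hT : IsMetaTree S G ℓ) (m : ℝ) {r : Fin n} (hr : r ∈ S) :
    ∃ q : ℝ → Fin n → Momentum, (∀ t, ∑ i, q t i = 0) ∧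
      (∀ t, ∀ i ∉ S, offShellVar m (q t i) = 0) ∧
      (∀ U, Continuous fun t => partialVar m (q t) U) ∧
      (∀ v, v ≠ ℓ r → partialVar m (q 0) (legSets G ℓ r v) = 0 ∧
        ∀ t > 0, partialVar m (q t) (legSets G ℓ r v) ≠ 0) ∧
      ∀ U : Finset (Fin n), partialVar m (q 0) U = 0 →
        ∃ A, (A = ∅ ∨ (∃ k ∉ S, A = {k}) ∨ ∃ v, v ≠ ℓ r ∧ A = legSets G ℓ r v) ∧
          (U = A ∨ Uᶜ = A) := by
  classical
  obtain ⟨par, depth, h, he⟩ := hT.1.exists_legSets_eq r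
  obtain ⟨τ, hτ⟩ := exists_generic_shellMomentum (ι := Fin n) m
  rw [he]
  -- At t = 0 every prescribed momentum is on-shell and generic. Only those of legs in S are shifted
  -- in energy, so internal lines leave the shell for t > 0 while legs outside S stay on it.
  set P : ℝ → Fin n → Momentum := fun t k =>
    shellMomentum m (τ k) + (t * if k ∈ S then 1 else 0) • Pi.single 0 1 with hP
  have hq : ∀ t U, partialVar m (treeMomenta r (legParent ℓ par) (P t)) U =
      offShellVar m (∑ k ∈ U.erase r, P t k - ∑ k with k ≠ r ∧ legParent ℓ par k ∈ U, P t k) :=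
    fun t U => by rw [partialVar, sum_treeMomenta]
  have hbelow : ∀ v, v ≠ ℓ r → ∀ t,
      partialVar m (treeMomenta r (legParent ℓ par) (P t)) (legsBelow par ℓ r v) =
        t * (2 * shellMomentum m (τ v) 0 + t) := by
    intro v hv t
    rw [partialVar, h.sum_treeMomenta_legsBelow hT.2 hv, hP]
    simp only [if_pos v.2, mul_one]
    rw [offShellVar_add_single, offShellVar_shellMomentum, zero_add]
  refine ⟨fun t => treeMomenta r (legParent ℓ par) (P t), fun t => sum_univ_treeMomenta _ _,
    fun t i hi => ?_, fun U => ?_, fun v hv => ⟨?_, fun t ht => ?_⟩, fun U hU => ?_⟩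
  · show offShellVar m (treeMomenta r (legParent ℓ par) (P t) i) = 0
    rw [treeMomenta_of_notMem hr _ hi, hP]
    simp only [if_neg hi, mul_zero, zero_smul, add_zero]
    exact offShellVar_shellMomentum m _
  · simp only [hq]
    refine (continuous_offShellVar m).comp ?_
    simp only [hP]
    fun_prop
  · rw [hbelow v hv, zero_mul]
  · rw [hbelow v hv]
    have := shellMomentum_zero_pos m (τ v)
    positivity
  · refine (h.crossing_cases hr hT.2 U).resolve_left fun hc => ?_
    rw [hq] at hU
    refine hτ _ _ hc ?_
    simpa [hP] using hU

end Degeneration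

end FieldDiffeo

namespace FieldDiffeo

/-! ### Uniqueness of the coefficients -/

section Uniqueness

open Filter Topology

variable {n : ℕ} {S : Finset (Fin n)}

/-- No relabelling freedom remains: the vertex s is the one that carries the leg s, which the
hierarchy already shows. -/
theorem IsMetaTree.eq_of_image_eq {G G' : SimpleGraph S} {ℓ ℓ' : Fin n → S}
    (hT : IsMetaTree S G ℓ) (hT' : IsMetaTree S G' ℓ') (r : Fin n)
    (he : Finset.univ.image (legSets G ℓ r) = Finset.univ.image (legSets G' ℓ' r)) :
    G = G' ∧ ℓ = ℓ' := by
  refine hT.1.eq_of_legSets_eq (r := r) hT'.1 (funext fun s => ?_)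
  have hs : legSets G ℓ r s ∈ Finset.univ.image (legSets G' ℓ' r) := by
    rw [← he]
    exact Finset.mem_image_of_mem _ (Finset.mem_univ s)
  obtain ⟨w, -, hw⟩ := Finset.mem_image.mp hs
  have h1 := (hT.1.legAt_iff r s s).mpr (hT.2 s)
  rw [he, ← hw, hT'.1.legAt_iff, hT'.2] at h1
  rw [← hw, h1]

theorem IsMetaTree.card_image_legSets {G : SimpleGraph S} {ℓ : Fin n → S}
    (hT : IsMetaTree S G ℓ) (r : Fin n) : (Finset.univ.image (legSets G ℓ r)).card = S.card := by
  rw [Finset.card_image_of_injective _ (hT.1.isHierarchyMap r).1, Finset.card_univ,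
    Fintype.card_coe]

theorem IsMetaTree.legSets_root {G : SimpleGraph S} {ℓ : Fin n → S} (hT : IsMetaTree S G ℓ)
    (r : Fin n) : legSets G ℓ r (ℓ r) = Finset.univ.erase r := by
  obtain ⟨par, depth, h, he⟩ := hT.1.exists_legSets_eq r
  rw [he, h.legsBelow_root]

theorem IsMetaTree.legSets_eq_erase_iff {G : SimpleGraph S} {ℓ : Fin n → S}
    (hT : IsMetaTree S G ℓ) (r : Fin n) (v : S) :
    legSets G ℓ r v = Finset.univ.erase r ↔ v = ℓ r := by
  rw [← hT.legSets_root, (hT.1.isHierarchyMap r).1.eq_iff]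

open Classical in
theorem metaSum_eq (m : ℝ) {q : Fin n → Momentum} (hq : ∑ i, q i = 0) (c : MetaWeights n)
    (r : Fin n) :
    metaSum m q c S =
      ∑ T ∈ (Finset.univ : Finset (SimpleGraph S × (Fin n → S))).filter
          (fun T => IsMetaTree S T.1 T.2),
        c S T.1 T.2 * ((∏ U ∈ Finset.univ.image (legSets T.1 T.2 r), lineWeight m q r U : ℝ) : ℂ) := by
  rw [metaSum]
  refine Finset.sum_congr rfl fun T hT => ?_
  rw [(Finset.mem_filter.mp hT).2.1.prod_edgePairs hq r, one_pow, one_mul, Complex.ofReal_prod]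

/-- If the momenta `q t` make the lines of `(G, ℓ)` singular as `t → 0`, the meta-tree `(G, ℓ)`
dominates all others. -/
theorem IsMetaTree.tendsto_prod_lineWeight {G G' : SimpleGraph S} {ℓ ℓ' : Fin n → S}
    (hT : IsMetaTree S G ℓ) (hT' : IsMetaTree S G' ℓ') (hne : (G', ℓ') ≠ (G, ℓ)) {m : ℝ}
    {r : Fin n} {q : ℝ → Fin n → Momentum}
    (hcont : ∀ U, Continuous fun t => partialVar m (q t) U)
    (hzero : ∀ v, v ≠ ℓ r → partialVar m (q 0) (legSets G ℓ r v) = 0 ∧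
        ∀ t > 0, partialVar m (q t) (legSets G ℓ r v) ≠ 0)
    (hreg : ∀ U ⊂ Finset.univ.erase r, 2 ≤ U.card → U ∉ Finset.univ.image (legSets G ℓ r) →
      partialVar m (q 0) U ≠ 0) :
    Tendsto (fun t => (∏ U ∈ Finset.univ.image (legSets G' ℓ' r), lineWeight m (q t) r U) *
      ∏ U ∈ Finset.univ.image (legSets G ℓ r), (lineWeight m (q t) r U)⁻¹) (𝓝[>] 0) (𝓝 0) := by
  classical
  set R := Finset.univ.image (legSets G ℓ r) with hR
  set R' := Finset.univ.image (legSets G' ℓ' r) with hR'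
  have htop : Finset.univ.erase r ∈ R := (hT.1.isHierarchyMap r).2.top_mem
  have htop' : Finset.univ.erase r ∈ R' := (hT'.1.isHierarchyMap r).2.top_mem
  have hw0 : ∀ U ∈ R, ∀ t > 0, lineWeight m (q t) r U ≠ 0 := by
    intro U hU t ht
    obtain ⟨v, -, rfl⟩ := Finset.mem_image.mp hU
    rw [lineWeight]
    split_ifs with h
    · exact one_ne_zero
    · exact inv_ne_zero ((hzero v fun hv => h ((hT.legSets_eq_erase_iff r v).mpr hv)).2 t ht)
  -- Common lines cancel before the limit is taken, so no singular factor survives on the left.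
  have hprod : ∀ t > 0, (∏ U ∈ R' \ R, lineWeight m (q t) r U) *
      ∏ U ∈ R \ R', (lineWeight m (q t) r U)⁻¹ =
        (∏ U ∈ R', lineWeight m (q t) r U) * ∏ U ∈ R, (lineWeight m (q t) r U)⁻¹ := by
    intro t ht
    rw [← Finset.prod_inter_mul_prod_sdiff R' R, ← Finset.prod_inter_mul_prod_sdiff R R',
      mul_mul_mul_comm, Finset.inter_comm R' R, ← Finset.prod_mul_distrib,
      Finset.prod_eq_one (s := R ∩ R'), one_mul]
    intro U hU
    exact mul_inv_cancel₀ (hw0 U (Finset.mem_inter.mp hU).1 t ht)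
  have h1 : Tendsto (fun t => ∏ U ∈ R' \ R, lineWeight m (q t) r U) (𝓝[>] 0)
      (𝓝 (∏ U ∈ R' \ R, (partialVar m (q 0) U)⁻¹)) := by
    refine tendsto_finsetProd _ fun U hU => ?_
    obtain ⟨hU', hUR⟩ := Finset.mem_sdiff.mp hU
    have hI : U ≠ Finset.univ.erase r := fun h => hUR (h ▸ htop)
    have hH := (hT'.1.isHierarchyMap r).2
    simp only [lineWeight, if_neg hI]
    exact (((hcont U).tendsto 0).mono_left nhdsWithin_le_nhds).inv₀
      (hreg U ((hH.subset_top U hU').ssubset_of_ne hI) (hH.two_le_card U hU') hUR)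
  have h2 : Tendsto (fun t => ∏ U ∈ R \ R', (lineWeight m (q t) r U)⁻¹) (𝓝[>] 0)
      (𝓝 (∏ U ∈ R \ R', (0 : ℝ))) := by
    refine tendsto_finsetProd _ fun U hU => ?_
    obtain ⟨hUR, hU'⟩ := Finset.mem_sdiff.mp hU
    have hI : U ≠ Finset.univ.erase r := fun h => hU' (h ▸ htop')
    simp only [lineWeight, if_neg hI, inv_inv]
    obtain ⟨v, -, rfl⟩ := Finset.mem_image.mp hUR
    have h0 := (hcont (legSets G ℓ r v)).tendsto 0
    rw [(hzero v fun hv => hI ((hT.legSets_eq_erase_iff r v).mpr hv)).1] at h0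
    exact h0.mono_left nhdsWithin_le_nhds
  -- Both families have |S| members and differ, so some singular line of the chosen tree is missing
  -- from the other.
  have hex : (R \ R').Nonempty := by
    rw [Finset.sdiff_nonempty]
    intro hsub
    have := Finset.eq_of_subset_of_card_le hsub
      (by rw [hR, hR', hT.card_image_legSets, hT'.card_image_legSets])
    have h3 := hT'.eq_of_image_eq hT r this.symm
    exact hne (Prod.ext h3.1 h3.2)
  rw [Finset.prod_const, zero_pow hex.card_ne_zero] at h2
  have h3 := h1.mul h2
  rw [mul_zero] at h3
  refine h3.congr' ?_
  filter_upwards [self_mem_nhdsWithin] with t ht using hprod t ht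

/-- Divide the vanishing sum by the propagators of the given tree and let its lines go on-shell: its
own term stays equal to its coefficient, all others tend to zero. -/
theorem IsMetaTree.coeff_eq_zero {G : SimpleGraph S} {ℓ : Fin n → S} (hT : IsMetaTree S G ℓ)
    (hn : 3 ≤ n) {m : ℝ} {j : ℕ} (hS : S ⊆ offShellLegs n j) (c : MetaWeights n)
    (hc : ∀ q : Fin n → Momentum, GeneralPosition m j q → (∀ i ∉ S, offShellVar m (q i) = 0) →
      (∀ s ∈ S, offShellVar m (q s) ≠ 0) → metaSum m q c S = 0) : c S G ℓ = 0 := by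
  classical
  obtain ⟨r, hr⟩ : ∃ r, r ∈ S := ⟨_, (ℓ ⟨0, by omega⟩).2⟩
  obtain ⟨q, hsum, hon, hcont, hzero, hspec⟩ := hT.exists_momenta m hr
  have hH := (hT.1.isHierarchyMap r).2
  have hmem : ∀ v, legSets G ℓ r v ∈ Finset.univ.image (legSets G ℓ r) := fun v =>
    Finset.mem_image_of_mem _ (Finset.mem_univ v)
  have h2 : ∀ v, 2 ≤ (legSets G ℓ r v).card := fun v => hH.two_le_card _ (hmem v)
  have hrD : ∀ v, r ∉ legSets G ℓ r v := fun v hv =>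
    Finset.notMem_erase r _ (hH.subset_top _ (hmem v) hv)
  have hcompl : ∀ U : Finset (Fin n), U.card + Uᶜ.card = n := fun U => by
    rw [Finset.card_add_card_compl, Fintype.card_fin]
  have hev : ∀ U, partialVar m (q 0) U ≠ 0 → ∀ᶠ t in 𝓝[>] 0, partialVar m (q t) U ≠ 0 :=
    fun U hU => (((hcont U).tendsto 0).mono_left nhdsWithin_le_nhds).eventually_ne hU
  -- The cardinality bounds exclude empty sets, single legs and their complements, leaving only the
  -- lines of the tree.
  have hgen : ∀ U : Finset (Fin n), 2 ≤ U.card → U.card + 2 ≤ n →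
      partialVar m (q 0) U = 0 → ∃ v, v ≠ ℓ r ∧ (U = legSets G ℓ r v ∨ Uᶜ = legSets G ℓ r v) := by
    intro U hU2 hUn hU
    have hcU := hcompl U
    obtain ⟨A, rfl | ⟨k, -, rfl⟩ | ⟨v, hv, rfl⟩, hA⟩ := hspec U hU
    · rcases hA with hA | hA <;> have hcA := congrArg Finset.card hA <;>
        rw [Finset.card_empty] at hcA <;> omega
    · rcases hA with hA | hA <;> have hcA := congrArg Finset.card hA <;>
        rw [Finset.card_singleton] at hcA <;> omega
    · exact ⟨v, hv, hA⟩
  have hgen' : ∀ U : Finset (Fin n), 2 ≤ U.card → U.card + 2 ≤ n →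
      ∀ᶠ t in 𝓝[>] 0, partialVar m (q t) U ≠ 0 := by
    intro U hU2 hUn
    by_cases hU : partialVar m (q 0) U = 0
    · obtain ⟨v, hv, hA⟩ := hgen U hU2 hUn hU
      filter_upwards [self_mem_nhdsWithin] with t ht
      rcases hA with hA | hA
      · rw [hA]; exact (hzero v hv).2 t ht
      · rw [← partialVar_compl (hsum t), hA]; exact (hzero v hv).2 t ht
    · exact hev U hU
  -- The legs in S stay off-shell near t = 0: a vanishing {s} would have to be a leg outside S or
  -- come from the leg set of a non-root vertex, whose complement contains more than r.
  have hsing : ∀ s ∈ S, ∀ᶠ t in 𝓝[>] 0, offShellVar m (q t s) ≠ 0 := by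
    intro s hs
    have h := hev {s} fun h0 => ?_
    · simpa only [partialVar, Finset.sum_singleton] using h
    · have hcU := hcompl {s}
      rw [Finset.card_singleton] at hcU
      obtain ⟨A, rfl | ⟨k, hk, rfl⟩ | ⟨v, hv, rfl⟩, hA⟩ := hspec {s} h0
      · rcases hA with hA | hA
        · exact Finset.singleton_ne_empty s hA
        · rw [hA, Finset.card_empty] at hcU; omega
      · rcases hA with hA | hA
        · rw [Finset.singleton_inj] at hA; exact hk (hA ▸ hs)
        · rw [hA, Finset.card_singleton] at hcU; omega
      · rcases hA with hA | hA
        · have := h2 v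
          rw [← hA, Finset.card_singleton] at this
          omega
        · have hrs : r = s := by
            by_contra hne
            apply hrD v
            rw [← hA]
            simpa using hne
          apply hv
          rw [← hT.legSets_eq_erase_iff, ← hA, hrs]
          ext; simp
  have hgp : ∀ᶠ t in 𝓝[>] (0 : ℝ), metaSum m (q t) c S = 0 := by
    have e1 : ∀ᶠ t in 𝓝[>] (0 : ℝ), ∀ U : Finset (Fin n), 2 ≤ U.card → U.card + 2 ≤ n →
        partialVar m (q t) U ≠ 0 := by
      rw [eventually_all]
      intro U
      by_cases hU : 2 ≤ U.card ∧ U.card + 2 ≤ n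
      · filter_upwards [hgen' U hU.1 hU.2] with t ht _ _ using ht
      · exact Eventually.of_forall fun t h1 h2 => absurd ⟨h1, h2⟩ hU
    have e2 : ∀ᶠ t in 𝓝[>] (0 : ℝ), ∀ s ∈ S, offShellVar m (q t s) ≠ 0 :=
      (eventually_all_finset S).mpr hsing
    filter_upwards [e1, e2] with t ht1 ht2
    refine hc (q t) ⟨hsum t, fun i hi => hon t i fun hiS => ?_, ht1⟩ (hon t) ht2
    have := (Finset.mem_filter.mp (hS hiS)).2
    omega
  set lw : ℝ → SimpleGraph S × (Fin n → S) → ℝ := fun t T =>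
    (∏ U ∈ Finset.univ.image (legSets T.1 T.2 r), lineWeight m (q t) r U) *
      ∏ U ∈ Finset.univ.image (legSets G ℓ r), (lineWeight m (q t) r U)⁻¹ with hlw
  set F : Finset (SimpleGraph S × (Fin n → S)) := Finset.univ.filter
    fun T => IsMetaTree S T.1 T.2 with hF
  have hsum0 : ∀ᶠ t in 𝓝[>] (0 : ℝ), ∑ T ∈ F, c S T.1 T.2 * ((lw t T : ℝ) : ℂ) = 0 := by
    filter_upwards [hgp] with t ht
    rw [metaSum_eq m (hsum t) c r] at ht
    simp only [hlw, Complex.ofReal_mul, ← mul_assoc]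
    rw [← Finset.sum_mul, ht, zero_mul]
  have hreg : ∀ U ⊂ Finset.univ.erase r, 2 ≤ U.card → U ∉ Finset.univ.image (legSets G ℓ r) →
      partialVar m (q 0) U ≠ 0 := by
    intro U hU hU2 hUR h0
    have hlt := Finset.card_lt_card hU
    rw [card_univ_erase] at hlt
    obtain ⟨v, -, hA | hA⟩ := hgen U hU2 (by omega) h0
    · exact hUR (hA ▸ hmem v)
    · apply hrD v
      rw [← hA, Finset.mem_compl]
      exact fun h => Finset.notMem_erase r _ (hU.subset h)
  have hlim : ∀ T ∈ F, Tendsto (fun t => c S T.1 T.2 * ((lw t T : ℝ) : ℂ)) (𝓝[>] 0)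
      (𝓝 (if T = (G, ℓ) then c S T.1 T.2 else 0)) := by
    intro T hTF
    by_cases hne : T = (G, ℓ)
    · subst hne
      rw [if_pos rfl]
      refine Tendsto.congr' ?_ tendsto_const_nhds
      filter_upwards [self_mem_nhdsWithin] with t ht
      have h1 : lw t (G, ℓ) = 1 := by
        simp only [hlw]
        rw [← Finset.prod_mul_distrib]
        refine Finset.prod_eq_one fun U hU => mul_inv_cancel₀ ?_
        obtain ⟨v, -, rfl⟩ := Finset.mem_image.mp hU
        rw [lineWeight]
        split_ifs with h
        · exact one_ne_zero
        · exact inv_ne_zero ((hzero v fun hv => h ((hT.legSets_eq_erase_iff r v).mpr hv)).2 t ht)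
      rw [h1, Complex.ofReal_one, mul_one]
    · rw [if_neg hne]
      have h1 := hT.tendsto_prod_lineWeight (Finset.mem_filter.mp hTF).2 hne hcont hzero hreg
      have h2 := ((Complex.continuous_ofReal.tendsto 0).comp h1).const_mul (c S T.1 T.2)
      rw [Complex.ofReal_zero, mul_zero] at h2
      exact h2
  have htot := tendsto_finsetSum F hlim
  rw [Finset.sum_ite_eq' F (G, ℓ), if_pos (show (G, ℓ) ∈ F from Finset.mem_filter.mpr ⟨Finset.mem_univ _, hT⟩)] at htot
  exact tendsto_nhds_unique_of_eventuallyEq htot tendsto_const_nhds hsum0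

theorem metaSum_eq_zero (m : ℝ) (q : Fin n → Momentum) {c : MetaWeights n}
    (hc : ∀ (G : SimpleGraph S) (ℓ : Fin n → S), IsMetaTree S G ℓ → c S G ℓ = 0) :
    metaSum m q c S = 0 := by
  classical
  rw [metaSum]
  exact Finset.sum_eq_zero fun T hT => by rw [hc _ _ (Finset.mem_filter.mp hT).2, zero_mul]

/-- An expansion in elementary symmetric monomials and propagators of meta-trees vanishes only if
its coefficients do. -/
theorem eq_zero_of_metaExpansion_eq_zero (hn : 3 ≤ n) {m : ℝ} {j : ℕ} (c : MetaWeights n)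
    (hc : ∀ q : Fin n → Momentum, GeneralPosition m j q → metaExpansion m q c = 0)
    (hS : S ⊆ offShellLegs n j) (G : SimpleGraph S) (ℓ : Fin n → S) (hT : IsMetaTree S G ℓ) :
    c S G ℓ = 0 := by
  classical
  induction S using Finset.strongInduction with
  | H S ih =>
    refine hT.coeff_eq_zero (m := m) hn hS c fun q hq hon hoff => ?_
    have h := hc q hq
    rw [metaExpansion, Finset.sum_eq_single S] at h
    -- The monomial of S is nonzero because its legs are off-shell, so the coefficient sum itself
    -- must vanish.
    · refine (mul_eq_zero.mp h).resolve_left ?_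
      exact Finset.prod_ne_zero_iff.mpr fun s hs => Complex.ofReal_ne_zero.mpr (hoff s hs)
    · intro S' _ hne
      by_cases hsub : S' ⊆ S
      · rw [metaSum_eq_zero m q fun G' ℓ' hT' =>
          ih S' (hsub.ssubset_of_ne hne) (hsub.trans hS) G' ℓ' hT', mul_zero]
      · obtain ⟨i, hi, hiS⟩ := Finset.not_subset.mp hsub
        rw [Finset.prod_eq_zero hi (by rw [hon i hiS, Complex.ofReal_zero]), zero_mul]
    · exact fun h => absurd (Finset.mem_univ S) h

theorem metaExpansion_sub (m : ℝ) (q : Fin n → Momentum) (c c' : MetaWeights n) :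
    metaExpansion m q (fun S G ℓ => c S G ℓ - c' S G ℓ) =
      metaExpansion m q c - metaExpansion m q c' := by
  simp only [metaExpansion, metaSum, sub_mul, Finset.sum_sub_distrib, mul_sub]

end Uniqueness

end FieldDiffeo

theorem mainTheorem4 (a : ℕ → ℝ) (ha : a 0 = 1) (m : ℝ) (n j : ℕ) (hn : 3 ≤ n) (hj : j ≤ n) :
    FieldDiffeo.IsExpansion a m n j (FieldDiffeo.bWeights a n) ∧
      ∀ c : FieldDiffeo.MetaWeights n, FieldDiffeo.IsExpansion a m n j c →
        ∀ S : Finset (Fin n), S ⊆ FieldDiffeo.offShellLegs n j →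
          ∀ (G : SimpleGraph S) (ℓ : Fin n → S), FieldDiffeo.IsMetaTree S G ℓ →
            c S G ℓ = FieldDiffeo.bWeights a n S G ℓ := by
  refine ⟨FieldDiffeo.isExpansion_bWeights a ha m j hn, fun c hc S hS G ℓ hT => ?_⟩
  have h := FieldDiffeo.eq_zero_of_metaExpansion_eq_zero (m := m) hn
    (fun S G ℓ => c S G ℓ - FieldDiffeo.bWeights a n S G ℓ) (fun q hq => ?_) hS G ℓ hT
  · exact sub_eq_zero.mp h
  · rw [FieldDiffeo.metaExpansion_sub, ← FieldDiffeo.sum_offShellLegs_eq hq,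
      ← FieldDiffeo.sum_offShellLegs_eq hq, ← hc q hq,
      ← FieldDiffeo.isExpansion_bWeights a ha m j hn q hq, sub_self]
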